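/- **Setting.** Let $X$ be a locally finite combinatorial tree (every vertex has finitely many neighbours) and let $w$ assign a positive real length to every edge. Let $Y=\mathrm{Real}(X,w)$ be the geometric realization: every edge $e$ is an interval of length $w(e)$, and $Y$ carries the path metric $d$. An automorphism of $(X,w)$ is an isometry of $Y$ onto itself. It is *elliptic* if it has a fixed point in $Y$, with fixed subtree $T_g=\{x: gx=x\}$, and *hyperbolic* otherwise. A hyperbolic $g$ has translation length $m_g=\inf_{x} d(x,gx)$ and axis $A_g=\{x: d(x,gx)=m_g\}$. The length of a subsegment of a line is denoted by $\ell$ (so $\ell=0$ for the empty set and for a point). Two subtrees are called *disjoint* if they have at most one point in common. A group $G$ of automorphisms is *discrete* if some finite subtree of $X$ has trivial pointwise stabilizer in $G$. A *half-tree* is a connected component of the complement of a point. Two hyperbolic elements $a,b$ form a *Schottky pair* if there are half-trees $H_a^\pm,H_b^\pm$ with pairwise disjoint closures such that $g(Y\setminus\overline{H_g^-})=H_g^+$ and $g^{-1}(Y\setminus\overline{H_g^+})=H_g^-$ for $g=a,b$. Let $\gamma_1,\gamma_2$ be hyperbolic automorphisms of $(X,w)$ such that $\Gamma=\langle\gamma_1,\gamma_2\rangle$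 is discrete. Put $m_i=m_{\gamma_i}$, suppose $m_1\ge m_2$, and suppose that $l=\ell(A_{\gamma_1}\cap A_{\gamma_2})$ is finite. If $l>0$, write $A_{\gamma_1}\cap A_{\gamma_2}=[v^-,v^+]$ and suppose that both $\gamma_1$ and $\gamma_2$ translate from $v^-$ toward $v^+$. For $i\ge1$, as long as $m_{i+1}>0$, put $$q_i=\lfloor m_i/m_{i+1}\rfloor,\qquad m_{i+2}=m_i-q_im_{i+1},\qquad \gamma_{i+2}=\gamma_i\gamma_{i+1}^{-q_i}.$$ For $j\ge1$ and $0\le q\le q_j-1$, say that $l$ lies in the *window* $(j,q)$ if $$(m_1+m_2)-m_j+(q-1)m_{j+1}<l\le(m_1+m_2)-m_j+qm_{j+1}.$$ **Theorem.** **(A)** Suppose $m_2/m_1$ is rational. Then the sequence $(m_i)$ is finite: there is $k\ge2$ with $m_1,\dots,m_k>0$ and $m_{k+1}=0$, and $m_k=\gcd(m_1,m_2)$ is the largest positive real number of which $m_1$ and $m_2$ are integer multiples. Exactly one of the following cases holds. 1. $l=0$. Then (D) below holds. 2. $0<l\le m_1+m_2-\gcd(m_1,m_2)$. Then $l$ lies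 in the window $(j,q)$ for exactly one pair of integers $(j,q)$ with $1\le j\le k-1$ and $0\le q\le q_j-1$, and (W) below holds for this pair. 3. $l>m_1+m_2-\gcd(m_1,m_2)$. Then $\Gamma$ is not free. It is generated by the hyperbolic element $\gamma_{\mathrm a}=\gamma_k$, of translation length $m_k$, and the elliptic element $\gamma_{\mathrm b}=\gamma_{k+1}$. The intersection $A_{\gamma_{\mathrm a}}\cap T_{\gamma_{\mathrm b}}$ is a segment of length $l-m_1-m_2+m_k>0$ with $v^+$ as an endpoint. **(B)** Suppose $m_2/m_1$ is irrational. Then the sequence $(m_i)$ is infinite, with all $m_i>0$, and the following hold. 1. If $l=0$, then (D) holds. 2. If $0<l<m_1+m_2$, then $l$ lies in the window $(j,q)$ for exactly one pair of integers $(j,q)$ with $j\ge1$ and $0\le q\le q_j-1$, and (W) holds for this pair. 3. $l\ge m_1+m_2$ is impossible. **(D)** $\Gamma$ is free of rank two, $(\gamma_{\mathrm a},\gamma_{\mathrm b})=(\gamma_1,\gamma_2)$ is a Schottky pair of generators of translation lengths $m_1,m_2$, and the axes of $\gamma_1$ and $\gamma_2$ are disjoint. **(W)** Put $\gamma_{\mathrm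 a}=\gamma_{j+1}$, which is hyperbolic of translation length $m_{j+1}$. * (a) If $l=(m_1+m_2)-m_j+qm_{j+1}$, then $\gamma_j\gamma_{j+1}^{-q}$ is hyperbolic. Put $l_0=\ell\big(A_{\gamma_j\gamma_{j+1}^{-q}}\cap\gamma_{j+1}A_{\gamma_j\gamma_{j+1}^{-q}}\big)$, $D=m_j-(q+1)m_{j+1}$ and $\gamma_{\mathrm b}=\gamma_j\gamma_{j+1}^{-q-1}$. In both cases below, $\gamma_{\mathrm a}$ and $\gamma_{\mathrm b}$ generate $\Gamma$. * (i) If $l_0\ge D/2$, then $\Gamma$ is not free, $\gamma_{\mathrm b}$ is elliptic, $A_{\gamma_{\mathrm a}}$ and $T_{\gamma_{\mathrm b}}$ are disjoint, and $d(A_{\gamma_{\mathrm a}},T_{\gamma_{\mathrm b}})=D/2$. * (ii) If $l_0<D/2$, then $\Gamma$ is free of rank two, $(\gamma_{\mathrm a},\gamma_{\mathrm b})$ is a Schottky pair, $\gamma_{\mathrm b}$ is hyperbolic of translation length $D-2l_0$, the axes $A_{\gamma_{\mathrm a}},A_{\gamma_{\mathrm b}}$ are disjoint, and $d(A_{\gamma_{\mathrm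 a}},A_{\gamma_{\mathrm b}})=l_0$. * (b) If $l<(m_1+m_2)-m_j+qm_{j+1}$, put $\gamma_{\mathrm b}=\gamma_j\gamma_{j+1}^{-q}$. Then $\Gamma$ is free of rank two, $(\gamma_{\mathrm a},\gamma_{\mathrm b})$ is a Schottky pair of generators of $\Gamma$, $\gamma_{\mathrm b}$ is hyperbolic of translation length $m_j-qm_{j+1}$, and $A_{\gamma_{\mathrm a}}\cap A_{\gamma_{\mathrm b}}$ is a segment of length $l-m_1-m_2+m_j-(q-1)m_{j+1}>0$ with $v^+$ as an endpoint. -/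

import Mathlib

open scoped ENNReal

/-- A weighted tree `(X, w)`: a combinatorial tree on the vertex set `V` together with a positive
real weight on every edge.  The values of `weight` off the edge set play no role. -/
structure WeightedTree (V : Type*) where
  graph : SimpleGraph V
  isTree : graph.IsTree
  weight : Sym2 V → ℝ
  weight_pos : ∀ e ∈ graph.edgeSet, 0 < weight e

namespace WeightedTree

variable {V : Type*} (T : WeightedTree V)

/-- Every vertex has finitely many neighbours. -/
def IsLocallyFinite : Prop := ∀ v : V, (T.graph.neighborSet v).Finite

/-- The length of a walk: the sum of the weights of its edges. -/
def walkLength {u v : V} (p : T.graph.Walk u v) : ℝ := (p.edges.map T.weight).sum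

/-- The unique simple path `[u, v]`. -/
noncomputable def path (u v : V) : T.graph.Walk u v :=
  (T.isTree.existsUnique_path u v).choose

/-- The distance between two vertices: the length of the path `[u, v]`. -/
noncomputable def vdist (u v : V) : ℝ := T.walkLength (T.path u v)

lemma path_isPath (u v : V) : (T.path u v).IsPath :=
  (T.isTree.existsUnique_path u v).choose_spec.1

lemma vdist_eq_of_isPath {u v : V} {p : T.graph.Walk u v} (hp : p.IsPath) :
    T.vdist u v = T.walkLength p := by
  rw [vdist, (T.isTree.existsUnique_path u v).unique (T.path_isPath u v) hp]

lemma walkLength_nonneg {u v : V} (p : T.graph.Walk u v) : 0 ≤ T.walkLength p := by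
  refine List.sum_nonneg fun x hx => ?_
  obtain ⟨e, he, rfl⟩ := List.mem_map.1 hx
  exact (T.weight_pos e (p.edges_subset_edgeSet he)).le

lemma walkLength_append {u v w : V} (p : T.graph.Walk u v) (q : T.graph.Walk v w) :
    T.walkLength (p.append q) = T.walkLength p + T.walkLength q := by
  simp [walkLength, SimpleGraph.Walk.edges_append]

lemma vdist_le_walkLength {u v : V} (p : T.graph.Walk u v) :
    T.vdist u v ≤ T.walkLength p := by
  classical
  rw [T.vdist_eq_of_isPath p.bypass_isPath]
  refine List.Sublist.sum_le_sum ((p.edges_bypass_sublist_edges).map T.weight) fun x hx => ?_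
  obtain ⟨e, he, rfl⟩ := List.mem_map.1 hx
  exact (T.weight_pos e (p.edges_subset_edgeSet he)).le

lemma vdist_nonneg (u v : V) : 0 ≤ T.vdist u v := T.walkLength_nonneg _

@[simp] lemma vdist_self (u : V) : T.vdist u u = 0 := by
  rw [T.vdist_eq_of_isPath (SimpleGraph.Walk.IsPath.nil (u := u))]
  simp [walkLength]

lemma vdist_comm (u v : V) : T.vdist u v = T.vdist v u := by
  rw [T.vdist_eq_of_isPath (T.path_isPath v u).reverse, vdist]
  simp [walkLength, SimpleGraph.Walk.edges_reverse]

lemma vdist_triangle (u v w : V) : T.vdist u w ≤ T.vdist u v + T.vdist v w := by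
  have := T.vdist_le_walkLength ((T.path u v).append (T.path v w))
  rwa [walkLength_append] at this

lemma vdist_adj {u v : V} (h : T.graph.Adj u v) : T.vdist u v = T.weight s(u, v) := by
  have hp : (SimpleGraph.Walk.cons h SimpleGraph.Walk.nil).IsPath := by
    simp [SimpleGraph.Walk.cons_isPath_iff, h.ne]
  rw [T.vdist_eq_of_isPath hp]
  simp [walkLength]

lemma vdist_pos {u v : V} (h : T.graph.Adj u v) : 0 < T.vdist u v := by
  rw [T.vdist_adj h]; exact T.weight_pos _ h

lemma vdist_eq_zero {u v : V} (h : T.vdist u v = 0) : u = v := by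
  cases hp : T.path u v with
  | nil => rfl
  | cons h' p =>
    exfalso
    have h1 := T.weight_pos _ ((SimpleGraph.mem_edgeSet _).2 h')
    have h2 := T.walkLength_nonneg p
    rw [vdist, hp] at h
    simp only [walkLength, SimpleGraph.Walk.edges_cons, List.map_cons, List.sum_cons] at h h2
    linarith

lemma vdist_of_mem {u v x : V} (h : x ∈ (T.path u v).support) :
    T.vdist u v = T.vdist u x + T.vdist x v := by
  classical
  rw [T.vdist_eq_of_isPath ((T.path_isPath u v).takeUntil h),
    T.vdist_eq_of_isPath ((T.path_isPath u v).dropUntil h), ← walkLength_append,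
    SimpleGraph.Walk.take_spec, vdist]

/-- Two points of a path: their distances add up on one side or the other. -/
lemma vdist_of_mem_mem {u v x y : V} (hx : x ∈ (T.path u v).support)
    (hy : y ∈ (T.path u v).support) :
    T.vdist u x = T.vdist u y + T.vdist y x ∨ T.vdist x v = T.vdist x y + T.vdist y v := by
  classical
  have hy' := hy
  rw [← (T.path u v).take_spec hx, SimpleGraph.Walk.mem_support_append_iff] at hy'
  rcases hy' with hy' | hy'
  · left
    have e : (T.path u v).takeUntil x hx = T.path u x :=
      (T.isTree.existsUnique_path u x).unique ((T.path_isPath u v).takeUntil hx)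
        (T.path_isPath u x)
    rw [e] at hy'
    exact T.vdist_of_mem hy'
  · right
    have e : (T.path u v).dropUntil x hx = T.path x v :=
      (T.isTree.existsUnique_path x v).unique ((T.path_isPath u v).dropUntil hx)
        (T.path_isPath x v)
    rw [e] at hy'
    exact T.vdist_of_mem hy'

/-- Seen from any vertex `x`, one end of an edge lies on the path to the other end. -/
lemma mem_path_of_adj {u v : V} (h : T.graph.Adj u v) (x : V) :
    u ∈ (T.path x v).support ∨ v ∈ (T.path x u).support := by
  by_cases hv : v ∈ (T.path x u).support
  · exact Or.inr hv
  · left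
    have hp := (T.path_isPath x u).concat hv h
    rw [(T.isTree.existsUnique_path x v).unique (T.path_isPath x v) hp]
    simp [SimpleGraph.Walk.support_concat]

/-- A point of the disjoint union of all vertices and of all closed intervals `e × [0, w(e)]`.
The point `⟨src, tgt, _, pos, _, _⟩` is the one at distance `pos` from `src` on the oriented edge
from `src` to `tgt`; a vertex `v` is represented with `src = tgt = v` (and then `pos = 0`). -/
structure PrePoint where
  src : V
  tgt : V
  eq_or_adj : src = tgt ∨ T.graph.Adj src tgt
  pos : ℝ
  pos_nonneg : 0 ≤ pos
  pos_le : pos ≤ T.vdist src tgt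

namespace PrePoint

variable {T}

/-- The distance from a point on an edge to a vertex: the shorter of the two routes through the
ends of the edge. -/
noncomputable def distVertex (p : T.PrePoint) (x : V) : ℝ :=
  min (p.pos + T.vdist p.src x) (T.vdist p.src p.tgt - p.pos + T.vdist p.tgt x)

open Classical in
/-- The path metric of the realization.  On one edge it is the metric of the interval (`p` and `q`
are compared by their distance to a common end of the edge, since they may carry opposite
orientations); between different edges it is the length of the shortest of the four routes through
ends of the edges. -/
noncomputable def pdist (p q : T.PrePoint) : ℝ :=
  if s(p.src, p.tgt) = s(q.src, q.tgt) then |p.distVertex p.src - q.distVertex p.src|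
  else min (p.distVertex q.src + q.pos) (p.distVertex q.tgt + (T.vdist q.src q.tgt - q.pos))

/-- The same point with the orientation of its edge reversed. -/
noncomputable def flip (p : T.PrePoint) : T.PrePoint where
  src := p.tgt
  tgt := p.src
  eq_or_adj := p.eq_or_adj.imp Eq.symm SimpleGraph.Adj.symm
  pos := T.vdist p.src p.tgt - p.pos
  pos_nonneg := by linarith [p.pos_le]
  pos_le := by rw [T.vdist_comm p.tgt]; linarith [p.pos_nonneg]

lemma distVertex_flip (p : T.PrePoint) (x : V) : p.flip.distVertex x = p.distVertex x := by
  simp only [distVertex, flip, T.vdist_comm p.tgt p.src]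
  rw [min_comm]
  congr 1
  ring

lemma distVertex_src (p : T.PrePoint) : p.distVertex p.src = p.pos := by
  have h1 := p.pos_le
  simp only [distVertex, T.vdist_self, T.vdist_comm p.tgt p.src, add_zero]
  rw [min_eq_left]
  linarith

lemma distVertex_tgt (p : T.PrePoint) : p.distVertex p.tgt = T.vdist p.src p.tgt - p.pos := by
  have h1 := p.pos_nonneg
  simp only [distVertex, T.vdist_self, add_zero]
  rw [min_eq_right]
  linarith

lemma distVertex_lipschitz (p : T.PrePoint) (x y : V) :
    p.distVertex x ≤ p.distVertex y + T.vdist y x := by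
  have h1 := T.vdist_triangle p.src y x
  have h2 := T.vdist_triangle p.tgt y x
  simp only [distVertex]
  rcases min_choice (p.pos + T.vdist p.src y)
    (T.vdist p.src p.tgt - p.pos + T.vdist p.tgt y) with h | h <;> rw [h]
  · exact (min_le_left _ _).trans (by linarith)
  · exact (min_le_right _ _).trans (by linarith)

lemma vdist_le_distVertex (p : T.PrePoint) (x y : V) :
    T.vdist x y ≤ p.distVertex x + p.distVertex y := by
  have h1 := T.vdist_triangle x p.src y
  have h2 := T.vdist_triangle x p.tgt y
  have h3 := T.vdist_triangle x p.src p.tgt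
  have h4 := T.vdist_triangle p.src p.tgt y
  have h5 := T.vdist_triangle x p.tgt p.src
  have h6 := T.vdist_triangle p.tgt p.src y
  have h7 := p.pos_nonneg
  have h8 := p.pos_le
  rw [T.vdist_comm p.tgt p.src] at h5 h6
  rw [T.vdist_comm x p.src] at *
  rw [T.vdist_comm x p.tgt] at *
  simp only [distVertex]
  rcases min_choice (p.pos + T.vdist p.src x)
    (T.vdist p.src p.tgt - p.pos + T.vdist p.tgt x) with h | h <;>
  rcases min_choice (p.pos + T.vdist p.src y)
    (T.vdist p.src p.tgt - p.pos + T.vdist p.tgt y) with h' | h' <;> rw [h, h'] <;> linarith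

/-- Seen from a point outside an edge, one end of the edge is behind the other one. -/
lemma distVertex_adj (p : T.PrePoint) {u v : V} (h : T.graph.Adj u v)
    (hne : s(p.src, p.tgt) ≠ s(u, v)) :
    p.distVertex v = p.distVertex u + T.vdist u v ∨
      p.distVertex u = p.distVertex v + T.vdist u v := by
  -- the key point: an edge cannot be crossed in opposite directions from `p.src` and `p.tgt`
  have key : ∀ {a b u v : V}, (a = b ∨ T.graph.Adj a b) → T.graph.Adj u v → s(a, b) ≠ s(u, v) →
      T.vdist a v = T.vdist a u + T.vdist u v → T.vdist b u = T.vdist b v + T.vdist u v →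
      False := by
    intro a b u v hab huv hne h1 h2
    have hw := T.vdist_pos huv
    rcases hab with rfl | hab
    · linarith
    have hw' := T.vdist_pos hab
    have hu : u ∈ (T.path a v).support := by
      rcases T.mem_path_of_adj huv a with h | h
      · exact h
      · have := T.vdist_of_mem h
        rw [T.vdist_comm v u] at this
        linarith
    have e1 := T.vdist_comm v a
    have e2 := T.vdist_comm v b
    have e3 := T.vdist_comm u a
    have e4 := T.vdist_comm u b
    have e5 := T.vdist_comm b a
    have e6 := T.vdist_comm v u
    have t1 := T.vdist_triangle a b v
    have t2 := T.vdist_triangle b a u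
    have hva : T.vdist v a = T.vdist v b + T.vdist b a := by
      rcases T.mem_path_of_adj hab v with h | h
      · have := T.vdist_of_mem h
        have t3 := T.vdist_triangle b a u
        linarith
      · exact T.vdist_of_mem h
    have hb : b ∈ (T.path a v).support := by
      rcases T.mem_path_of_adj hab.symm v with h | h
      · have hr : T.path a v = (T.path v a).reverse :=
          (T.isTree.existsUnique_path a v).unique (T.path_isPath a v) (T.path_isPath v a).reverse
        rw [hr, SimpleGraph.Walk.support_reverse]
        exact List.mem_reverse.2 h
      · have := T.vdist_of_mem h
        linarith
    have n1 := T.vdist_nonneg a u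
    have n2 := T.vdist_nonneg b v
    rcases T.vdist_of_mem_mem hb hu with h | h
    · have hau : T.vdist a u = 0 := by
        rcases T.mem_path_of_adj hab u with h' | h'
        · have := T.vdist_of_mem h'
          linarith
        · have := T.vdist_of_mem h'
          linarith
      have hbv : T.vdist b v = 0 := by linarith
      exact hne (by rw [T.vdist_eq_zero hau, T.vdist_eq_zero hbv])
    · linarith
  have alt : ∀ a : V, T.vdist a v = T.vdist a u + T.vdist u v ∨
      T.vdist a u = T.vdist a v + T.vdist u v := by
    intro a
    rcases T.mem_path_of_adj h a with h' | h'
    · exact Or.inl (T.vdist_of_mem h')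
    · right
      rw [T.vdist_of_mem h', T.vdist_comm v u]
  simp only [distVertex]
  rcases alt p.src with h1 | h1 <;> rcases alt p.tgt with h2 | h2
  · left
    rw [h1, h2, ← add_assoc, ← add_assoc, min_add_add_right]
  · exact (key p.eq_or_adj h hne h1 h2).elim
  · refine (key (p.eq_or_adj.imp Eq.symm SimpleGraph.Adj.symm) h ?_ h2 h1).elim
    rwa [Sym2.eq_swap]
  · right
    rw [h1, h2, ← add_assoc, ← add_assoc, min_add_add_right]

lemma abs_distVertex_sub_le (p q : T.PrePoint) (x : V) :
    |p.distVertex x - q.distVertex x| ≤ pdist p q := by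
  unfold pdist
  split_ifs with h
  · wlog hs : p.src = q.src ∧ p.tgt = q.tgt generalizing q
    · have := this q.flip (by rw [h]; exact Sym2.eq_swap) (by
        rcases Sym2.eq_iff.1 h with h' | h'
        · exact absurd h' hs
        · exact h')
      simpa only [distVertex_flip] using this
    obtain ⟨h1, h2⟩ := hs
    have hq : q.distVertex p.src = q.pos := by rw [h1, distVertex_src]
    rw [distVertex_src, hq]
    simp only [distVertex, ← h1, ← h2]
    refine (abs_min_sub_min_le_max _ _ _ _).trans (max_le ?_ ?_)
    · rw [add_sub_add_right_eq_sub]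
    · rw [add_sub_add_right_eq_sub, sub_sub_sub_cancel_left, abs_sub_comm]
  · have a1 := p.distVertex_lipschitz x q.src
    have a2 := p.distVertex_lipschitz x q.tgt
    have a3 := p.vdist_le_distVertex q.src x
    have a4 := p.vdist_le_distVertex q.tgt x
    have a5 := p.distVertex_lipschitz q.src q.tgt
    have a6 := p.distVertex_lipschitz q.tgt q.src
    rw [T.vdist_comm q.tgt q.src] at a5
    have b0 := q.pos_nonneg
    have b1 := q.pos_le
    have c1 : q.distVertex x ≤ q.pos + T.vdist q.src x := min_le_left _ _
    have c2 : q.distVertex x ≤ T.vdist q.src q.tgt - q.pos + T.vdist q.tgt x := min_le_right _ _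
    have c3 : q.distVertex x = q.pos + T.vdist q.src x ∨
        q.distVertex x = T.vdist q.src q.tgt - q.pos + T.vdist q.tgt x := min_choice _ _
    rw [abs_le]
    constructor
    · rcases min_choice (p.distVertex q.src + q.pos)
        (p.distVertex q.tgt + (T.vdist q.src q.tgt - q.pos)) with h' | h' <;> rw [h'] <;> linarith
    · refine le_min ?_ ?_ <;> rcases c3 with h' | h' <;> rw [h'] <;> linarith

lemma exists_pdist_eq (p q : T.PrePoint) :
    ∃ x, pdist p q = |p.distVertex x - q.distVertex x| := by
  unfold pdist
  split_ifs with h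
  · exact ⟨p.src, rfl⟩
  · have n1 : ∀ x, 0 ≤ p.distVertex x := fun x => by
      have := p.vdist_le_distVertex x x
      rw [T.vdist_self] at this
      linarith
    have b0 := q.pos_nonneg
    have b1 := q.pos_le
    rcases q.eq_or_adj with he | he
    · refine ⟨q.src, ?_⟩
      rw [distVertex_src]
      rw [← he, T.vdist_self] at b1 ⊢
      have : q.pos = 0 := le_antisymm b1 b0
      rw [this]
      simp [abs_of_nonneg (n1 q.src)]
    · rcases p.distVertex_adj he h with h' | h'
      · refine ⟨q.tgt, ?_⟩
        rw [distVertex_tgt, h', min_eq_left (by linarith), abs_of_nonneg]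
        · ring
        · linarith [n1 q.src]
      · refine ⟨q.src, ?_⟩
        rw [distVertex_src, h', min_eq_right (by linarith), abs_of_nonneg]
        · ring
        · linarith [n1 q.tgt]

end PrePoint

noncomputable instance : PseudoMetricSpace T.PrePoint where
  dist := PrePoint.pdist
  dist_self p := by
    simp [PrePoint.pdist]
  dist_comm p q := by
    apply le_antisymm
    · obtain ⟨x, hx⟩ := PrePoint.exists_pdist_eq p q
      rw [hx, abs_sub_comm]
      exact PrePoint.abs_distVertex_sub_le q p x
    · obtain ⟨x, hx⟩ := PrePoint.exists_pdist_eq q p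
      rw [hx, abs_sub_comm]
      exact PrePoint.abs_distVertex_sub_le p q x
  dist_triangle p q r := by
    obtain ⟨x, hx⟩ := PrePoint.exists_pdist_eq p r
    rw [hx]
    exact (abs_sub_le _ (q.distVertex x) _).trans
      (add_le_add (PrePoint.abs_distVertex_sub_le p q x) (PrePoint.abs_distVertex_sub_le q r x))

/-- The geometric realization `Real(X, w)`: the disjoint union of the vertices and of the intervals
`e × [0, w(e)]`, glued along the ends of the intervals (that is, points at distance `0` are
identified), with its path metric. -/
abbrev Realization : Type _ := SeparationQuotient T.PrePoint

/-- A vertex, as a point of the realization. -/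
noncomputable def vertex (v : V) : T.Realization :=
  SeparationQuotient.mk ⟨v, v, Or.inl rfl, 0, le_rfl, (T.vdist_self v).ge⟩

/-- The group of automorphisms of the weighted tree: the isometries of the realization. -/
abbrev Aut : Type _ := T.Realization ≃ᵢ T.Realization

/-- A group of automorphisms is discrete if some finite subtree has trivial pointwise
stabilizer. -/
def IsDiscrete (Γ : Subgroup T.Aut) : Prop :=
  ∃ S : T.graph.Subgraph, S.verts.Finite ∧ S.coe.IsTree ∧
    ∀ g ∈ Γ, (∀ v ∈ S.verts, g (T.vertex v) = T.vertex v) → g = 1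

end WeightedTree

/-! ### Isometries of a metric tree -/

section Isometries

variable {Y : Type*} [MetricSpace Y]

/-- The geodesic segment `[x, y]`. -/
def geodSegment (x y : Y) : Set Y := {z | dist x z + dist z y = dist x y}

/-- `g` is elliptic if it has a fixed point. -/
def IsElliptic (g : Y ≃ᵢ Y) : Prop := ∃ x, g x = x

/-- `g` is hyperbolic if it has no fixed point (in the realization of a tree: it fixes no vertex
and no edge, up to inversion). -/
def IsHyperbolic (g : Y ≃ᵢ Y) : Prop := ∀ x, g x ≠ x

/-- The minimal displacement of `g`. -/
noncomputable def translationLength (g : Y ≃ᵢ Y) : ℝ := ⨅ x : Y, dist x (g x)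

/-- The axis of a hyperbolic `g`: the set of points of minimal displacement. -/
def axis (g : Y ≃ᵢ Y) : Set Y := {x | dist x (g x) = translationLength g}

/-- The fixed subtree of an elliptic `g`. -/
def fixedTree (g : Y ≃ᵢ Y) : Set Y := {x | g x = x}

/-- The length of a subsegment of a geodesic line, such as the intersection of an axis with another
axis or with a fixed subtree; it is `0` for an empty or one-point set and may be infinite. -/
noncomputable def arcLength (S : Set Y) : ℝ≥0∞ := Metric.ediam S

/-- The distance between two sets. -/
noncomputable def setDist (A B : Set Y) : ℝ≥0∞ := ⨅ x ∈ A, Metric.infEDist x B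

/-- Two subtrees are *disjoint* if they share no edge; they may meet in a point. -/
def EdgeDisjoint (A B : Set Y) : Prop := (A ∩ B).Subsingleton

/-- `g` translates from `x` toward `y` along its axis, where `x ≠ y` are points of the axis:
`y` is between `x` and `g y`. -/
def TranslatesToward (g : Y ≃ᵢ Y) (x y : Y) : Prop := y ∈ geodSegment x (g y)

/-- A half-tree: the connected component, in the complement of a point `p`, of another point `x`,
that is, the set of points that can be joined to `x` without passing through `p`. -/
def IsHalfTree (H : Set Y) : Prop := ∃ p x : Y, x ≠ p ∧ H = {y | p ∉ geodSegment x y}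

/-- A Schottky pair: there are four half-trees with disjoint closures such that `a` maps the
exterior of the first onto the second and `a⁻¹` maps the exterior of the second onto the first, and
likewise for `b` and the two others (so that the complement of the four half-trees is a
fundamental domain and the group plays ping-pong). -/
def IsSchottkyPair (a b : Y ≃ᵢ Y) : Prop :=
  ∃ Am Ap Bm Bp : Set Y,
    IsHalfTree Am ∧ IsHalfTree Ap ∧ IsHalfTree Bm ∧ IsHalfTree Bp ∧
    [closure Am, closure Ap, closure Bm, closure Bp].Pairwise Disjoint ∧
    a '' (closure Am)ᶜ = Ap ∧ ⇑a⁻¹ '' (closure Ap)ᶜ = Am ∧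
    b '' (closure Bm)ᶜ = Bp ∧ ⇑b⁻¹ '' (closure Bp)ᶜ = Bm

end Isometries

/-- Free of rank two. -/
def IsFreeOfRankTwo (G : Type*) [Group G] : Prop := Nonempty (G ≃* FreeGroup (Fin 2))

/-! ### The Euclidean algorithm -/

/-- The sequence `m₁, m₂, m₃, …` of the Euclidean algorithm, `mᵢ₊₂ = mᵢ - ⌊mᵢ / mᵢ₊₁⌋ mᵢ₊₁`.
The index starts at `1`; the value at `0` plays no role. -/
noncomputable def euclidSeq (m₁ m₂ : ℝ) : ℕ → ℝ
  | 0 => 0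
  | 1 => m₁
  | 2 => m₂
  | i + 3 => euclidSeq m₁ m₂ (i + 1) -
      ⌊euclidSeq m₁ m₂ (i + 1) / euclidSeq m₁ m₂ (i + 2)⌋ * euclidSeq m₁ m₂ (i + 2)

/-- The partial quotients `qᵢ = ⌊mᵢ / mᵢ₊₁⌋`. -/
noncomputable def euclidQuot (m₁ m₂ : ℝ) (i : ℕ) : ℤ :=
  ⌊euclidSeq m₁ m₂ i / euclidSeq m₁ m₂ (i + 1)⌋

/-- The sequence `γ₁, γ₂, γ₃, …` with `γᵢ₊₂ = γᵢ γᵢ₊₁ ^ (-qᵢ)`.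
The index starts at `1`; the value at `0` plays no role. -/
noncomputable def euclidGen {G : Type*} [Group G] (m₁ m₂ : ℝ) (γ₁ γ₂ : G) : ℕ → G
  | 0 => 1
  | 1 => γ₁
  | 2 => γ₂
  | i + 3 => euclidGen m₁ m₂ γ₁ γ₂ (i + 1) *
      euclidGen m₁ m₂ γ₁ γ₂ (i + 2) ^ (-euclidQuot m₁ m₂ (i + 1))

/-- The positive reals of which both `m₁` and `m₂` are integer multiples. -/
def commonDivisors (m₁ m₂ : ℝ) : Set ℝ :=
  {d | 0 < d ∧ (∃ a : ℤ, m₁ = a * d) ∧ ∃ b : ℤ, m₂ = b * d}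

/-- The window of indices: `j ≥ 1`, `0 ≤ q ≤ q_j - 1` and
`(m₁ + m₂) - m_j + (q - 1) m_{j+1} < l ≤ (m₁ + m₂) - m_j + q m_{j+1}`. -/
def InWindow (m₁ m₂ l : ℝ) (j : ℕ) (q : ℤ) : Prop :=
  1 ≤ j ∧ 0 ≤ q ∧ q ≤ euclidQuot m₁ m₂ j - 1 ∧
  m₁ + m₂ - euclidSeq m₁ m₂ j + (q - 1) * euclidSeq m₁ m₂ (j + 1) < l ∧
  l ≤ m₁ + m₂ - euclidSeq m₁ m₂ j + q * euclidSeq m₁ m₂ (j + 1)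

/-! ### The cases of the classification -/

section Cases

variable {Y : Type*} [MetricSpace Y]

/-- `γ₁, γ₂` generate a free group of rank two for which `(a, b)` is a Schottky pair of
generators; `a` and `b` are hyperbolic of translation lengths `ma` and `mb`. -/
def FreeSchottky (γ₁ γ₂ a b : Y ≃ᵢ Y) (ma mb : ℝ) : Prop :=
  IsFreeOfRankTwo (Subgroup.closure {γ₁, γ₂}) ∧
  Subgroup.closure {a, b} = Subgroup.closure {γ₁, γ₂} ∧ IsSchottkyPair a b ∧
  IsHyperbolic a ∧ translationLength a = ma ∧ IsHyperbolic b ∧ translationLength b = mb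

/-- `γ₁, γ₂` generate a group that is not free (of any rank), generated by the hyperbolic
element `a`, of translation length `ma`, and the elliptic element `b`. -/
def NotFreeElliptic (γ₁ γ₂ a b : Y ≃ᵢ Y) (ma : ℝ) : Prop :=
  ¬ IsFreeGroup (Subgroup.closure {γ₁, γ₂}) ∧
  Subgroup.closure {a, b} = Subgroup.closure {γ₁, γ₂} ∧
  IsHyperbolic a ∧ translationLength a = ma ∧ IsElliptic b

/-- The conclusion when the axes share no edge. -/
def CaseDisjoint (γ₁ γ₂ : Y ≃ᵢ Y) (m₁ m₂ : ℝ) : Prop :=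
  FreeSchottky γ₁ γ₂ γ₁ γ₂ m₁ m₂ ∧ EdgeDisjoint (axis γ₁) (axis γ₂)

/-- The conclusion for an overlap `l` in the window `(j, q)`.  Here `g i` and `m i` are the
terms `γᵢ` and `mᵢ` of the Euclidean sequences, `c` is `γ_j γ_{j+1} ^ (-q)` and `b` is
`γ_j γ_{j+1} ^ (-q-1)`. -/
def CaseWindow (γ₁ γ₂ : Y ≃ᵢ Y) (m₁ m₂ l : ℝ) (vplus : Y) (j : ℕ) (q : ℤ) : Prop :=
  let m := euclidSeq m₁ m₂
  let g := euclidGen m₁ m₂ γ₁ γ₂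
  let c := g j * g (j + 1) ^ (-q)
  let b := g j * g (j + 1) ^ (-q - 1)
  let D := m j - (q + 1) * m (j + 1)
  (l = m₁ + m₂ - m j + q * m (j + 1) →
    IsHyperbolic c ∧
    let l₀ := arcLength (axis c ∩ g (j + 1) '' axis c)
    (ENNReal.ofReal (D / 2) ≤ l₀ →
      NotFreeElliptic γ₁ γ₂ (g (j + 1)) b (m (j + 1)) ∧
      EdgeDisjoint (axis (g (j + 1))) (fixedTree b) ∧
      setDist (axis (g (j + 1))) (fixedTree b) = ENNReal.ofReal (D / 2)) ∧
    (l₀ < ENNReal.ofReal (D / 2) →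
      FreeSchottky γ₁ γ₂ (g (j + 1)) b (m (j + 1)) (D - 2 * l₀.toReal) ∧
      EdgeDisjoint (axis (g (j + 1))) (axis b) ∧
      setDist (axis (g (j + 1))) (axis b) = l₀)) ∧
  (l < m₁ + m₂ - m j + q * m (j + 1) →
    FreeSchottky γ₁ γ₂ (g (j + 1)) c (m (j + 1)) (m j - q * m (j + 1)) ∧
    (∃ y, axis (g (j + 1)) ∩ axis c = geodSegment y vplus) ∧
    0 < l - m₁ - m₂ + m j - (q - 1) * m (j + 1) ∧
    arcLength (axis (g (j + 1)) ∩ axis c) =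
      ENNReal.ofReal (l - m₁ - m₂ + m j - (q - 1) * m (j + 1)))

/-- The conclusion for a long overlap in the commensurable case, where the Euclidean algorithm
stops with `m_k = gcd (m₁, m₂)` and `m_{k+1} = 0`. -/
def CaseLong (γ₁ γ₂ : Y ≃ᵢ Y) (m₁ m₂ l : ℝ) (vplus : Y) (k : ℕ) : Prop :=
  let m := euclidSeq m₁ m₂
  let g := euclidGen m₁ m₂ γ₁ γ₂
  NotFreeElliptic γ₁ γ₂ (g k) (g (k + 1)) (m k) ∧
  (∃ y, axis (g k) ∩ fixedTree (g (k + 1)) = geodSegment y vplus) ∧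
  arcLength (axis (g k) ∩ fixedTree (g (k + 1))) = ENNReal.ofReal (l - m₁ - m₂ + m k)

end Cases

/-! The proof runs the Euclidean algorithm on pairs of isometries and watches how far their axes
overlap. Let `a`, `b` translate by `p > q` in the same direction along axes that share a segment of
length `Δ > q`. On the part of the segment that `b⁻¹` keeps inside it, `a * b⁻¹` is translation by
`p - q`. Hence `a * b⁻¹` is hyperbolic of translation length `p - q`, and its axis shares with that
of `b` a segment of length `Δ - q` with the same forward end (`AxisPair.step`). The translation
lengths and the overlap drop together, so `κ = Δ - p - q` is invariant, with value `l - (m₁ + m₂)`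
throughout. A window `(j, q)` is exactly the condition that the pair `γ_j γ_{j+1}^(-q)`, `γ_{j+1}`
is reached with a positive overlap no longer than `m_{j+1}`, where the reduction stops.

What happens there depends on the remaining overlap. If it is shorter than both translation lengths,
four cuts outside the overlap give a Schottky pair, and ping-pong gives freeness
(`AxisPair.isSchottkyPair`, `IsSchottkyPair.isFreeOfRankTwo`). If it equals the smaller length `q`,
the axis of `a` and its translate by `b` leave the axis of `b` at the same point and run together
for a length `l₀`. Since `a * b⁻¹` carries the translate to the axis, it fixes the point at distance
`(p - q) / 2` if `l₀` reaches that far (`AxisPair.apply_eq_of_le_arcLength`). Otherwise it is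
hyperbolic through the point where the two lines part, and its axis is disjoint from that of `b`
(`AxisPair.exists_axisLine_of_arcLength_lt`). If the lengths have become equal with overlap at least
`p`, then `a * b⁻¹` fixes the end of the overlap.

An elliptic `a * b⁻¹` is never trivial, because the overlap is bounded. By local finiteness and
discreteness it has finite order (`WeightedTree.isOfFinOrder_of_isElliptic`), so the group is not
free.

For incommensurable lengths an overlap of length at least `m₁ + m₂` is impossible: its end is a
branch point, and moving it by `-m₁` or `+m₂` inside the overlap would produce infinitely many
branch points on one segment (`IsReducedPair.neg_of_irrational`). -/

/-- A real tree: a geodesic metric space that satisfies the four point condition. -/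
class IsRealTree (Y : Type*) [MetricSpace Y] : Prop where
  exists_point : ∀ (x y : Y) (t : ℝ), 0 ≤ t → t ≤ dist x y →
    ∃ z, dist x z = t ∧ dist z y = dist x y - t
  four_point : ∀ x y z w : Y, dist x y + dist z w ≤ dist x z + dist y w ∨
    dist x y + dist z w ≤ dist x w + dist y z

/-! ### Segments and medians in a real tree. -/

section RealTree

variable {Y : Type*} [MetricSpace Y]

lemma mem_geodSegment {x y z : Y} : z ∈ geodSegment x y ↔ dist x z + dist z y = dist x y := Iff.rfl

lemma geodSegment_comm (x y : Y) : geodSegment x y = geodSegment y x := by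
  ext z
  rw [mem_geodSegment, mem_geodSegment, dist_comm x y, dist_comm x z, dist_comm z y, add_comm]

lemma left_mem_geodSegment (x y : Y) : x ∈ geodSegment x y := by simp [mem_geodSegment]

lemma right_mem_geodSegment (x y : Y) : y ∈ geodSegment x y := by simp [mem_geodSegment]

lemma apply_mem_geodSegment (g : Y ≃ᵢ Y) {x y z : Y} :
    g z ∈ geodSegment (g x) (g y) ↔ z ∈ geodSegment x y := by
  simp only [mem_geodSegment, g.dist_eq]

lemma apply_mem_geodSegment_iff (g : Y ≃ᵢ Y) {x y z : Y} :
    g z ∈ geodSegment x y ↔ z ∈ geodSegment (g⁻¹ x) (g⁻¹ y) := by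
  simpa using apply_mem_geodSegment g (x := g⁻¹ x) (y := g⁻¹ y) (z := z)

variable [IsRealTree Y]

lemma geodSegment_point_unique {x y z w : Y} (hz : z ∈ geodSegment x y) (hw : w ∈ geodSegment x y)
    (h : dist x z = dist x w) : z = w := by
  rw [mem_geodSegment] at hz hw
  have c1 := dist_comm y w
  have c2 := dist_comm y z
  have : dist z w ≤ 0 := by
    rcases IsRealTree.four_point x y z w with h' | h' <;> linarith
  exact dist_le_zero.1 this

lemma dist_of_mem_geodSegment {x y z w : Y} (hz : z ∈ geodSegment x y) (hw : w ∈ geodSegment x y)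
    (h : dist x z ≤ dist x w) : dist z w = dist x w - dist x z := by
  rw [mem_geodSegment] at hz hw
  have c1 := dist_comm y w
  have c2 := dist_comm y z
  have t := dist_triangle x z w
  rcases IsRealTree.four_point x y z w with h' | h' <;> linarith

lemma abs_dist_of_mem_geodSegment {x y z w : Y} (hz : z ∈ geodSegment x y)
    (hw : w ∈ geodSegment x y) : dist z w = |dist x w - dist x z| := by
  rcases le_total (dist x z) (dist x w) with h | h
  · rw [dist_of_mem_geodSegment hz hw h, abs_of_nonneg (by linarith)]
  · rw [dist_comm, dist_of_mem_geodSegment hw hz h, abs_of_nonpos (by linarith)]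
    ring

/-- Two geodesics that overlap in a nondegenerate segment form a geodesic. -/
lemma dist_concat {x y z w : Y} (h₁ : y ∈ geodSegment x z) (h₂ : z ∈ geodSegment y w)
    (hne : y ≠ z) : dist x w = dist x y + dist y z + dist z w := by
  rw [mem_geodSegment] at h₁ h₂
  have hp := dist_pos.2 hne
  have c := dist_comm y z
  have t1 := dist_triangle x y w
  rcases IsRealTree.four_point x z y w with h' | h' <;> linarith

/-- The two alternatives of the four-point condition for `x`, `z`, `y`, `p` are the two cases:
triangles in a tree are tripods. -/
lemma mem_geodSegment_or_mem_geodSegment {x y z p : Y} (h : p ∈ geodSegment x z) :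
    p ∈ geodSegment x y ∨ p ∈ geodSegment y z := by
  simp only [mem_geodSegment] at *
  have t1 := dist_triangle x p y
  have t2 := dist_triangle y p z
  have c1 := dist_comm y p
  have c2 := dist_comm z p
  have c3 := dist_comm z y
  rcases IsRealTree.four_point x z y p with h' | h'
  · left; linarith
  · right; linarith

lemma exists_median (x y z : Y) :
    ∃ c, c ∈ geodSegment x y ∧ c ∈ geodSegment x z ∧ c ∈ geodSegment y z := by
  have t1 := dist_triangle x y z
  have t2 := dist_triangle x z y
  have t3 := dist_triangle y x z
  have c1 := dist_comm y z
  have c2 := dist_comm x y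
  -- The Gromov product of `y` and `z` at `x`, the length of the common beginning of `[x, y]` and
  -- `[x, z]`.
  obtain ⟨c, h1, h2⟩ := IsRealTree.exists_point x y ((dist x y + dist x z - dist y z) / 2)
    (by linarith) (by linarith)
  have c3 := dist_comm c y
  have c4 := dist_comm c z
  have t4 := dist_triangle x c z
  have t5 := dist_triangle y c z
  refine ⟨c, ?_, ?_, ?_⟩ <;> rw [mem_geodSegment]
  · linarith
  all_goals rcases IsRealTree.four_point x y z c with h' | h' <;> linarith

/-! ### Geodesic lines -/

omit [IsRealTree Y] in
lemma Isometry.dist_line {f : ℝ → Y} (hf : Isometry f) {s t : ℝ} (h : s ≤ t) :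
    dist (f s) (f t) = t - s := by
  rw [hf.dist_eq, Real.dist_eq, abs_of_nonpos (by linarith)]
  ring

omit [IsRealTree Y] in
lemma Isometry.mem_geodSegment_line {f : ℝ → Y} (hf : Isometry f) {s t u : ℝ} (h : s ≤ t)
    (h' : t ≤ u) : f t ∈ geodSegment (f s) (f u) := by
  rw [mem_geodSegment, hf.dist_line h, hf.dist_line h', hf.dist_line (h.trans h')]
  ring

lemma Isometry.eq_of_mem_geodSegment {f : ℝ → Y} (hf : Isometry f) {s t : ℝ} (h : s ≤ t) {z : Y}
    (hz : z ∈ geodSegment (f s) (f t)) :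
    z = f (s + dist (f s) z) ∧ s + dist (f s) z ≤ t := by
  have hz' := mem_geodSegment.1 hz
  rw [hf.dist_line h] at hz'
  have h0 := dist_nonneg (x := z) (y := f t)
  have h1 := dist_nonneg (x := f s) (y := z)
  have h2 : s + dist (f s) z ≤ t := by linarith
  refine ⟨geodSegment_point_unique hz (hf.mem_geodSegment_line (by linarith) h2) ?_, h2⟩
  rw [hf.dist_line (by linarith)]
  ring

lemma Isometry.geodSegment_eq_image {f : ℝ → Y} (hf : Isometry f) {s t : ℝ} (h : s ≤ t) :
    geodSegment (f s) (f t) = f '' Set.Icc s t := by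
  ext z
  constructor
  · intro hz
    obtain ⟨h1, h2⟩ := hf.eq_of_mem_geodSegment h hz
    exact ⟨_, ⟨by linarith [dist_nonneg (x := f s) (y := z)], h2⟩, h1.symm⟩
  · rintro ⟨u, ⟨h1, h2⟩, rfl⟩
    exact hf.mem_geodSegment_line h1 h2

/-- Two lines that agree at two parameters agree between them. -/
lemma Isometry.line_eq_of_eq {f h : ℝ → Y} (hf : Isometry f) (hh : Isometry h) {s t u : ℝ}
    (hs : f s = h s) (hu : f u = h u) (h1 : s ≤ t) (h2 : t ≤ u) : f t = h t := by
  refine geodSegment_point_unique (hf.mem_geodSegment_line h1 h2) ?_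
    (by rw [hf.dist_line h1, hs, hh.dist_line h1])
  rw [hs, hu]
  exact hh.mem_geodSegment_line h1 h2

/-- The projection of a point to a line. -/
lemma Isometry.exists_projection {f : ℝ → Y} (hf : Isometry f) (y : Y) :
    ∃ t, ∀ s, dist y (f s) = dist y (f t) + |s - t| := by
  set r := dist y (f 0) with hr
  have hr0 : 0 ≤ r := dist_nonneg
  -- With `N > dist y (f 0)`, the median of `f (-N)`, `f N` and `y` cannot be an end of `[f (-N), f
  -- N]`; it is the projection.
  set N := r + 1 with hN
  obtain ⟨c, hc1, hc2, hc3⟩ := exists_median (f (-N)) (f N) y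
  obtain ⟨h1, h2⟩ := hf.eq_of_mem_geodSegment (by linarith) hc1
  set t := -N + dist (f (-N)) c with ht
  have ht1 : -N ≤ t := by linarith [dist_nonneg (x := f (-N)) (y := c)]
  rw [h1] at hc1 hc2 hc3
  have c1 := dist_comm y (f (-N))
  have c2 := dist_comm y (f N)
  have c3 := dist_comm y (f t)
  have e1 := mem_geodSegment.1 hc2
  have e2 := mem_geodSegment.1 hc3
  rw [hf.dist_line ht1] at e1
  rw [dist_comm, hf.dist_line h2] at e2
  have b1 := dist_triangle y (f 0) (f (-N))
  have b2 := dist_triangle y (f 0) (f N)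
  rw [hf.dist_line (by linarith)] at b2
  rw [dist_comm (f 0), hf.dist_line (by linarith)] at b1
  have b3 := dist_nonneg (x := y) (y := f t)
  have lt1 : -N < t := by
    by_contra hcon
    have : t = -N := by linarith
    rw [this] at *
    linarith
  have lt2 : t < N := by
    by_contra hcon
    have : t = N := by linarith
    rw [this] at *
    linarith
  refine ⟨t, fun s => ?_⟩
  rcases le_total s t with hs | hs
  · rw [abs_of_nonpos (by linarith)]
    rcases le_total (-N) s with h' | h'
    · have b4 := dist_triangle y (f s) (f (-N))
      have b5 := dist_triangle y (f t) (f s)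
      rw [dist_comm (f s), hf.dist_line h'] at b4
      rw [dist_comm (f t), hf.dist_line hs] at b5
      linarith
    · have := dist_concat (x := y) (y := f t) (z := f (-N)) (w := f s)
        (by rw [geodSegment_comm]; exact hc2)
        (by rw [geodSegment_comm]; exact hf.mem_geodSegment_line h' ht1)
        (fun h => by have := hf.injective h; linarith)
      rw [this, dist_comm (f t), hf.dist_line ht1, dist_comm (f (-N)), hf.dist_line h']
      ring
  · rw [abs_of_nonneg (by linarith)]
    rcases le_total s N with h' | h'
    · have b4 := dist_triangle y (f s) (f N)
      have b5 := dist_triangle y (f t) (f s)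
      rw [hf.dist_line h'] at b4
      rw [hf.dist_line hs] at b5
      linarith
    · have := dist_concat (x := y) (y := f t) (z := f N) (w := f s)
        (by rw [geodSegment_comm]; exact hc3)
        (hf.mem_geodSegment_line h2 h')
        (fun h => by have := hf.injective h; linarith)
      rw [this, hf.dist_line h2, hf.dist_line h']
      ring

/-! ### Hyperbolic isometries -/

/-- `f` parametrizes by arc length a line along which `g` translates by `m > 0`. -/
structure IsAxisLine (g : Y ≃ᵢ Y) (f : ℝ → Y) (m : ℝ) : Prop where
  isometry : Isometry f
  pos : 0 < m
  map : ∀ t, g (f t) = f (t + m)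

namespace IsAxisLine

variable {g : Y ≃ᵢ Y} {f : ℝ → Y} {m : ℝ}

omit [IsRealTree Y] in
lemma inv_map (h : IsAxisLine g f m) (t : ℝ) : g⁻¹ (f t) = f (t - m) := by
  have := h.map (t - m)
  rw [sub_add_cancel] at this
  rw [← this, IsometryEquiv.inv_apply_self]

omit [IsRealTree Y] in
lemma shift (h : IsAxisLine g f m) (u : ℝ) : IsAxisLine g (fun t => f (t + u)) m where
  isometry := h.isometry.comp (Isometry.of_dist_eq fun s t => by simp [Real.dist_eq])
  pos := h.pos
  map t := by rw [h.map, add_right_comm]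

/-- Let `f t` be the projection of `y`. Then `f (t + m)` is the projection of `g y`, and as `m > 0`
the path from `y` to `g y` runs through both. Hyperbolicity, translation length and axis are all
read off from this formula. -/
lemma exists_dist_apply (h : IsAxisLine g f m) (y : Y) :
    ∃ t, dist y (g y) = m + 2 * dist y (f t) := by
  obtain ⟨t, ht⟩ := h.isometry.exists_projection y
  refine ⟨t, ?_⟩
  have hg : ∀ s, dist (g y) (f s) = dist y (f t) + |s - (t + m)| := fun s => by
    have := ht (s - m)
    rw [← h.inv_map, ← g.dist_eq, IsometryEquiv.apply_inv_self] at this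
    rw [this]
    congr 2
    ring
  have e1 := ht (t + m)
  have e2 := hg (t + m)
  have e3 := hg t
  have hm := h.pos
  rw [add_sub_cancel_left, abs_of_pos hm] at e1
  rw [sub_self, abs_zero] at e2
  rw [sub_add_cancel_left, abs_neg, abs_of_pos hm] at e3
  have hd := h.isometry.dist_line (s := t) (t := t + m) (by linarith)
  have := dist_concat (x := y) (y := f t) (z := f (t + m)) (w := g y)
    (by rw [mem_geodSegment, e1, hd]; ring)
    (by rw [mem_geodSegment, dist_comm _ (g y), dist_comm (f t) (g y), e2, e3, hd]; ring)
    (fun he => by have := h.isometry.injective he; linarith)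
  rw [this, hd, dist_comm _ (g y), e2]
  ring

lemma hyperbolic (h : IsAxisLine g f m) : IsHyperbolic g := by
  intro x hx
  obtain ⟨t, ht⟩ := h.exists_dist_apply x
  rw [hx, dist_self] at ht
  linarith [h.pos, dist_nonneg (x := x) (y := f t)]

lemma translationLength_eq (h : IsAxisLine g f m) : translationLength g = m := by
  have : Nonempty Y := ⟨f 0⟩
  apply le_antisymm
  · refine (ciInf_le ⟨0, ?_⟩ (f 0)).trans ?_
    · rintro _ ⟨x, rfl⟩
      exact dist_nonneg
    · rw [h.map, h.isometry.dist_line (by linarith [h.pos])]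
      linarith
  · refine le_ciInf fun x => ?_
    obtain ⟨t, ht⟩ := h.exists_dist_apply x
    linarith [dist_nonneg (x := x) (y := f t)]

lemma axis_eq (h : IsAxisLine g f m) : axis g = Set.range f := by
  ext x
  rw [axis, Set.mem_ofPred_eq, h.translationLength_eq]
  constructor
  · intro hx
    obtain ⟨t, ht⟩ := h.exists_dist_apply x
    exact ⟨t, (dist_le_zero.1 (by linarith)).symm⟩
  · rintro ⟨t, rfl⟩
    rw [h.map, h.isometry.dist_line (by linarith [h.pos])]
    ring

lemma mem_range_iff (h : IsAxisLine g f m) {x : Y} : x ∈ Set.range f ↔ dist x (g x) = m := by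
  rw [← h.axis_eq, axis, Set.mem_ofPred_eq, h.translationLength_eq]

lemma map_mem_range_iff (h : IsAxisLine g f m) {x : Y} :
    g x ∈ Set.range f ↔ x ∈ Set.range f := by
  rw [h.mem_range_iff, h.mem_range_iff, g.dist_eq]

end IsAxisLine

/-- In a tree a path that is geodesic over any two consecutive steps is geodesic. The induction
carries two successive distances, because `dist_concat` glues the next step along the last one. -/
lemma dist_zpow_apply {g : Y ≃ᵢ Y} {c : Y} (hc : g c ∈ geodSegment c (g (g c))) (hne : c ≠ g c)
    {i j : ℤ} (hij : i ≤ j) : dist ((g ^ i) c) ((g ^ j) c) = (j - i) * dist c (g c) := by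
  have key : ∀ n : ℕ, dist c ((g ^ n) c) = n * dist c (g c) ∧
      dist c ((g ^ (n + 1)) c) = (n + 1) * dist c (g c) := by
    intro n
    induction n with
    | zero => simp
    | succ n ih =>
      refine ⟨by rw [ih.2]; push_cast; ring, ?_⟩
      have e : ∀ x, (g ^ (n + 1)) x = (g ^ n) (g x) := fun x => by
        rw [pow_succ, IsometryEquiv.mul_apply]
      have e' : (g ^ (n + 1 + 1)) c = (g ^ n) (g (g c)) := by
        rw [pow_succ, IsometryEquiv.mul_apply, e]
      have := dist_concat (x := c) (y := (g ^ n) c) (z := (g ^ (n + 1)) c)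
        (w := (g ^ (n + 1 + 1)) c)
        (by rw [mem_geodSegment, ih.1, ih.2, e, (g ^ n).dist_eq]; ring)
        (by rw [e, e', apply_mem_geodSegment]; exact hc)
        (by rw [e]; exact fun h => hne ((g ^ n).injective h))
      rw [this, ih.1, e, e', (g ^ n).dist_eq, (g ^ n).dist_eq, g.dist_eq]
      push_cast
      ring
  obtain ⟨n, hn⟩ := Int.eq_ofNat_of_zero_le (sub_nonneg.2 hij)
  have hj : j = i + n := by omega
  subst hj
  rw [zpow_add, IsometryEquiv.mul_apply, (g ^ i).dist_eq, zpow_natCast, (key n).1]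
  push_cast
  ring

/-- A point that is moved along a geodesic in two steps lies on an axis. -/
lemma exists_axisLine_of_mem {g : Y ≃ᵢ Y} {c : Y} (hc : g c ∈ geodSegment c (g (g c)))
    (hne : c ≠ g c) : ∃ f, IsAxisLine g f (dist c (g c)) ∧ f 0 = c := by
  set m := dist c (g c) with hm
  have hm0 : 0 < m := dist_pos.2 hne
  have hd : ∀ i j : ℤ, i ≤ j → dist ((g ^ i) c) ((g ^ j) c) = (j - i) * m :=
    fun i j hij => dist_zpow_apply hc hne hij
  -- The point at signed distance `t` from `c` on the union of the segments `[g⁻ⁿ c, gⁿ c]`. It is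
  -- chosen on the smallest segment that is long enough and then has the right distances in all
  -- larger ones.
  have hex : ∀ t : ℝ, ∃ z, ∀ n : ℕ, |t| ≤ n * m →
      dist ((g ^ (-(n : ℤ))) c) z = n * m + t ∧ dist z ((g ^ (n : ℤ)) c) = n * m - t := by
    intro t
    set N := ⌈|t| / m⌉₊ with hN
    have hNt : |t| ≤ N * m := by
      rw [← div_le_iff₀ hm0]
      exact Nat.le_ceil _
    have hdN := hd (-(N : ℤ)) N (by omega)
    push_cast at hdN
    obtain ⟨h1, h2⟩ := abs_le.1 hNt
    obtain ⟨z, hz1, hz2⟩ := IsRealTree.exists_point ((g ^ (-(N : ℤ))) c) ((g ^ (N : ℤ)) c)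
      (N * m + t) (by linarith) (by rw [hdN]; linarith)
    refine ⟨z, fun n hn => ?_⟩
    have hNn : N ≤ n := by
      rw [hN, Nat.ceil_le, div_le_iff₀ hm0]
      exact hn
    have e1 := hd (-(n : ℤ)) (-(N : ℤ)) (by omega)
    have e2 := hd (N : ℤ) n (by omega)
    have e3 := hd (-(n : ℤ)) n (by omega)
    push_cast at e1 e2 e3
    have t1 := dist_triangle ((g ^ (-(n : ℤ))) c) ((g ^ (-(N : ℤ))) c) z
    have t2 := dist_triangle z ((g ^ (N : ℤ)) c) ((g ^ (n : ℤ)) c)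
    have t3 := dist_triangle ((g ^ (-(n : ℤ))) c) z ((g ^ (n : ℤ)) c)
    constructor <;> linarith
  choose f hf using hex
  have hbig : ∀ r : ℝ, ∃ n : ℕ, r ≤ n * m := fun r => by
    obtain ⟨n, hn⟩ := exists_nat_ge (r / m)
    exact ⟨n, (div_le_iff₀ hm0).1 hn⟩
  have hmem : ∀ (t : ℝ) (n : ℕ), |t| ≤ n * m →
      f t ∈ geodSegment ((g ^ (-(n : ℤ))) c) ((g ^ (n : ℤ)) c) := fun t n hn => by
    obtain ⟨h1, h2⟩ := hf t n hn
    have := hd (-(n : ℤ)) n (by omega)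
    push_cast at this
    rw [mem_geodSegment, h1, h2, this]
    ring
  refine ⟨f, ⟨Isometry.of_dist_eq fun s t => ?_, hm0, fun t => ?_⟩, ?_⟩
  · obtain ⟨n, hn⟩ := hbig (max |s| |t|)
    have hs := (le_max_left _ _).trans hn
    have ht := (le_max_right _ _).trans hn
    rw [abs_dist_of_mem_geodSegment (hmem s n hs) (hmem t n ht), (hf s n hs).1, (hf t n ht).1,
      Real.dist_eq, abs_sub_comm]
    congr 1
    ring
  · obtain ⟨n, hn⟩ := hbig (max |t| |t + m|)
    have ht := (le_max_left _ _).trans hn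
    have ht' := (le_max_right _ _).trans hn
    have a1 : |t| ≤ ((n + 2 : ℕ) : ℝ) * m := ht.trans (by push_cast; nlinarith)
    have a2 : |t + m| ≤ ((n + 1 : ℕ) : ℝ) * m := ht'.trans (by push_cast; nlinarith)
    have e1 : dist ((g ^ (-((n + 1 : ℕ) : ℤ))) c) (g (f t)) = ((n + 1 : ℕ) : ℝ) * m + (t + m) := by
      have : (-((n + 1 : ℕ) : ℤ)) = 1 + -((n + 2 : ℕ) : ℤ) := by push_cast; ring
      rw [this, zpow_add, zpow_one, IsometryEquiv.mul_apply, g.dist_eq, (hf t _ a1).1]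
      push_cast
      ring
    have e2 : dist (g (f t)) ((g ^ ((n + 1 : ℕ) : ℤ)) c) = ((n + 1 : ℕ) : ℝ) * m - (t + m) := by
      have : ((n + 1 : ℕ) : ℤ) = 1 + (n : ℤ) := by push_cast; ring
      rw [this, zpow_add, zpow_one, IsometryEquiv.mul_apply, g.dist_eq, (hf t _ ht).2]
      push_cast
      ring
    have hm' := hmem (t + m) _ a2
    obtain ⟨e3, e4⟩ := hf (t + m) _ a2
    -- `g (f t)` and `f (t + m)` lie on the same segment at the same distance from its start.
    refine geodSegment_point_unique ?_ hm' (by rw [e1, e3])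
    rw [mem_geodSegment] at hm' ⊢
    rw [e1, e2, ← hm', e3, e4]
  · have := (hf 0 0 (by simp)).1
    simp only [CharP.cast_eq_zero, neg_zero, zpow_zero, zero_mul, add_zero,
      IsometryEquiv.coe_one, id_eq] at this
    exact (dist_eq_zero.1 this).symm

/-- The path `x, g x, g² x` backtracks at `g x` by the Gromov product `D - E / 2`. If this is at
least `D / 2`, the midpoint of `[x, g x]` is fixed. Otherwise cutting off the backtrack leaves a
point that moves straight on, hence a point of an axis. -/
lemma IsHyperbolic.exists_axisLine {g : Y ≃ᵢ Y} (hg : IsHyperbolic g) [Nonempty Y] :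
    ∃ f, IsAxisLine g f (translationLength g) := by
  obtain ⟨x⟩ := ‹Nonempty Y›
  set D := dist x (g x) with hD
  set E := dist x (g (g x)) with hE
  have t1 := dist_triangle x (g x) (g (g x))
  rw [g.dist_eq] at t1
  have hE0 : 0 ≤ E := dist_nonneg
  obtain ⟨p, hp1, hp2, hp3⟩ := exists_median x (g x) (g (g x))
  rw [mem_geodSegment] at hp1 hp2 hp3
  rw [g.dist_eq] at hp3
  have cp := dist_comm p (g x)
  by_cases hDE : E ≤ D
  · exfalso
    obtain ⟨z, hz1, hz2⟩ := IsRealTree.exists_point x (g x) (D / 2)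
      (by linarith [dist_nonneg (x := x) (y := g x)])
      (by linarith [dist_nonneg (x := x) (y := g x)])
    have hzm : z ∈ geodSegment (g x) x := by
      rw [mem_geodSegment, dist_comm _ z, dist_comm z x, hz1, hz2, dist_comm (g x) x]
      ring
    have hpm : p ∈ geodSegment (g x) x := by
      rw [mem_geodSegment, dist_comm p x, dist_comm (g x) x]
      linarith
    have hpm' : p ∈ geodSegment (g x) (g (g x)) := by
      rw [mem_geodSegment, g.dist_eq]
      linarith
    have hgz : g z ∈ geodSegment (g x) (g (g x)) := by
      rw [apply_mem_geodSegment, mem_geodSegment]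
      linarith
    have e1 : dist (g x) z = D / 2 := by rw [dist_comm, hz2]; linarith
    have e2 : dist (g x) (g z) = D / 2 := by rw [g.dist_eq, hz1]
    -- Both `z` and `g z` lie on `[g x, p]` at distance `D / 2` from `g x`.
    have f1 := dist_of_mem_geodSegment hzm hpm (by linarith)
    have f2 := dist_of_mem_geodSegment hgz hpm' (by linarith)
    refine hg z (geodSegment_point_unique (x := g x) (y := p) ?_ ?_ (by linarith))
    · rw [mem_geodSegment]; linarith
    · rw [mem_geodSegment]; linarith
  · push Not at hDE
    -- This choice makes `g c = p`, since `p` has distance `D - E / 2` from `g x`.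
    obtain ⟨c, hc1, hc2⟩ := IsRealTree.exists_point x (g x) (D - E / 2)
      (by linarith) (by linarith)
    rw [← hD] at hc2
    have hpm : p ∈ geodSegment (g x) (g (g x)) := by
      rw [mem_geodSegment, g.dist_eq]
      linarith
    have hcm : c ∈ geodSegment x (g x) := by rw [mem_geodSegment]; linarith
    have hpm' : p ∈ geodSegment x (g x) := by rw [mem_geodSegment]; linarith
    have hgcm : g c ∈ geodSegment (g x) (g (g x)) := by rwa [apply_mem_geodSegment]
    have hgc : g c = p := by
      refine geodSegment_point_unique hgcm hpm ?_
      rw [g.dist_eq, hc1]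
      linarith
    have f1 := dist_of_mem_geodSegment hcm hpm' (by linarith)
    have hne : c ≠ g c := by
      rw [hgc, ← dist_pos, f1]
      linarith
    have hggc : g p ∈ geodSegment (g x) (g (g x)) := by rwa [apply_mem_geodSegment]
    have e1 : dist (g x) (g p) = dist x p := by rw [g.dist_eq]
    have f2 := dist_of_mem_geodSegment hpm hggc (by linarith)
    have hggc' := mem_geodSegment.1 hggc
    rw [g.dist_eq x (g x)] at hggc'
    obtain ⟨f, hf, -⟩ := exists_axisLine_of_mem (g := g) (c := c) (by
      rw [hgc, mem_geodSegment]
      have t2 := dist_triangle x c (g p)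
      have t3 := dist_triangle c p (g p)
      have t4 := dist_triangle x (g p) (g (g x))
      linarith) hne
    exact ⟨f, hf.translationLength_eq.symm ▸ hf⟩

end RealTree

/-! ### Pairs of lines that share a segment. -/

section Overlap

variable {Y : Type*} [MetricSpace Y]

/-- The lines `f` and `h` meet exactly in the segment with parameters `[α, β]`, on which the two
parametrizations agree. -/
structure Overlap (f h : ℝ → Y) (α β : ℝ) : Prop where
  isometry_left : Isometry f
  isometry_right : Isometry h
  le : α ≤ β
  eq : ∀ t, α ≤ t → t ≤ β → f t = h t
  mem : ∀ s t, f s = h t → α ≤ s ∧ s ≤ β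

namespace Overlap

variable {f h : ℝ → Y} {α β : ℝ}

/-- This is why the field `mem` has to bound the parameter of `f` only: there `f s = h s`, and `h`
is injective. -/
lemma param_eq (o : Overlap f h α β) {s t : ℝ} (e : f s = h t) : s = t := by
  obtain ⟨h1, h2⟩ := o.mem s t e
  rw [o.eq s h1 h2] at e
  exact o.isometry_right.injective e

lemma symm (o : Overlap f h α β) : Overlap h f α β where
  isometry_left := o.isometry_right
  isometry_right := o.isometry_left
  le := o.le
  eq t h1 h2 := (o.eq t h1 h2).symm
  mem s t e := by
    have := o.param_eq e.symm
    rw [← this]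
    exact o.mem t s e.symm

lemma reverse (o : Overlap f h α β) : Overlap (fun t => f (-t)) (fun t => h (-t)) (-β) (-α) where
  isometry_left := o.isometry_left.comp (Isometry.of_dist_eq fun s t => dist_neg_neg s t)
  isometry_right := o.isometry_right.comp (Isometry.of_dist_eq fun s t => dist_neg_neg s t)
  le := by linarith [o.le]
  eq t h1 h2 := o.eq _ (by linarith) (by linarith)
  mem s t e := by
    obtain ⟨h1, h2⟩ := o.mem _ _ e
    constructor <;> linarith

lemma translate (o : Overlap f h α β) (g : Y ≃ᵢ Y) (u : ℝ) :
    Overlap (fun t => g (f (t - u))) (fun t => g (h (t - u))) (α + u) (β + u) where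
  isometry_left := g.isometry.comp (o.isometry_left.comp
    (Isometry.of_dist_eq fun s t => dist_sub_right s t u))
  isometry_right := g.isometry.comp (o.isometry_right.comp
    (Isometry.of_dist_eq fun s t => dist_sub_right s t u))
  le := by linarith [o.le]
  eq t h1 h2 := by rw [o.eq _ (by linarith) (by linarith)]
  mem s t e := by
    obtain ⟨h1, h2⟩ := o.mem _ _ (g.injective e)
    constructor <;> linarith

lemma range_inter (o : Overlap f h α β) : Set.range f ∩ Set.range h = h '' Set.Icc α β := by
  ext z
  constructor
  · rintro ⟨⟨s, rfl⟩, t, ht⟩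
    obtain ⟨h1, h2⟩ := o.mem s t ht.symm
    exact ⟨s, ⟨h1, h2⟩, (o.eq s h1 h2).symm⟩
  · rintro ⟨t, ⟨h1, h2⟩, rfl⟩
    exact ⟨⟨t, o.eq t h1 h2⟩, t, rfl⟩

end Overlap

variable [IsRealTree Y]

/-- A point `p` lies between `x` and `y` if the segments from `p` to `x` and `y` meet only in `p`. -/
lemma mem_geodSegment_of_inter {p x y : Y}
    (h : ∀ c, c ∈ geodSegment p x → c ∈ geodSegment p y → c = p) : p ∈ geodSegment x y := by
  obtain ⟨c, h1, h2, h3⟩ := exists_median p x y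
  rwa [← h c h1 h2]

namespace Overlap

variable {f h : ℝ → Y} {α β : ℝ}

/-- Beyond `β` the line `h` has left `f` for good, so it is reached from `f` only through the fork
`h β`. -/
lemma mem_geodSegment_top (o : Overlap f h α β) (s : ℝ) {t : ℝ} (ht : β ≤ t) :
    h β ∈ geodSegment (f s) (h t) := by
  refine mem_geodSegment_of_inter fun c h1 h2 => ?_
  rw [o.isometry_right.geodSegment_eq_image ht] at h2
  obtain ⟨u, ⟨hu1, hu2⟩, rfl⟩ := h2
  have hmem : ∃ v, f v = h u := by
    rw [← o.eq β o.le le_rfl] at h1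
    rcases le_total s β with hs | hs
    · rw [geodSegment_comm, o.isometry_left.geodSegment_eq_image hs] at h1
      obtain ⟨v, -, hv⟩ := h1
      exact ⟨v, hv⟩
    · rw [o.isometry_left.geodSegment_eq_image hs] at h1
      obtain ⟨v, -, hv⟩ := h1
      exact ⟨v, hv⟩
  obtain ⟨v, hv⟩ := hmem
  obtain ⟨h3, h4⟩ := o.symm.mem _ _ hv.symm
  rw [le_antisymm h4 hu1]

lemma dist_top (o : Overlap f h α β) (s : ℝ) {t : ℝ} (ht : β ≤ t) :
    dist (f s) (h t) = |s - β| + (t - β) := by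
  rw [← mem_geodSegment.1 (o.mem_geodSegment_top s ht), o.isometry_right.dist_line ht,
    ← o.eq β o.le le_rfl, o.isometry_left.dist_eq, Real.dist_eq]

lemma mem_geodSegment_bot (o : Overlap f h α β) (s : ℝ) {t : ℝ} (ht : t ≤ α) :
    h α ∈ geodSegment (f s) (h t) := by
  simpa using o.reverse.mem_geodSegment_top (-s) (t := -t) (by linarith)

lemma dist_bot (o : Overlap f h α β) (s : ℝ) {t : ℝ} (ht : t ≤ α) :
    dist (f s) (h t) = |s - α| + (α - t) := by
  rw [← mem_geodSegment.1 (o.mem_geodSegment_bot s ht), dist_comm (h α),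
    o.isometry_right.dist_line ht, ← o.eq α le_rfl o.le, o.isometry_left.dist_eq, Real.dist_eq]

/-- To know where two lines part it suffices to look near the ends of a common segment. -/
lemma of_local (hf : Isometry f) (hh : Isometry h) (hle : α ≤ β)
    (heq : ∀ t, α ≤ t → t ≤ β → f t = h t)
    (htop : ∀ ε > 0, ∃ s, β < s ∧ s < β + ε ∧ f s ∉ Set.range h)
    (hbot : ∀ ε > 0, ∃ s, α - ε < s ∧ s < α ∧ f s ∉ Set.range h) : Overlap f h α β where
  isometry_left := hf
  isometry_right := hh
  le := hle
  eq := heq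
  mem s t e := by
    -- The parameters at which `f` lies on `h` form an interval, so a single point off `h` just past
    -- an end excludes everything further out.
    have conv : ∀ {u v w : ℝ}, f u ∈ Set.range h → f w ∈ Set.range h → u ≤ v → v ≤ w →
        f v ∈ Set.range h := by
      rintro u v w ⟨u', hu⟩ ⟨w', hw⟩ h1 h2
      have hm := hf.mem_geodSegment_line h1 h2
      rw [← hu, ← hw] at hm
      rcases le_total u' w' with h3 | h3
      · rw [hh.geodSegment_eq_image h3] at hm
        obtain ⟨z, -, hz⟩ := hm
        exact ⟨z, hz⟩
      · rw [geodSegment_comm, hh.geodSegment_eq_image h3] at hm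
        obtain ⟨z, -, hz⟩ := hm
        exact ⟨z, hz⟩
    constructor
    · by_contra hcon
      push Not at hcon
      obtain ⟨v, h1, h2, h3⟩ := hbot (α - s) (by linarith)
      exact h3 (conv ⟨t, e.symm⟩ ⟨α, (heq α le_rfl hle).symm⟩ (by linarith) h2.le)
    · by_contra hcon
      push Not at hcon
      obtain ⟨v, h1, h2, h3⟩ := htop (s - β) (by linarith)
      exact h3 (conv ⟨β, (heq β hle le_rfl).symm⟩ ⟨t, e.symm⟩ h1.le (by linarith))

end Overlap

-- Normalizes an axis to start at `v`. In the opposite order, `w` would not lie between `v` and `g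
-- w`, so the direction hypothesis fixes the orientation.
omit [IsRealTree Y] in
lemma IsAxisLine.exists_shift {g : Y ≃ᵢ Y} {f : ℝ → Y} {m : ℝ} (hf : IsAxisLine g f m) {v w : Y}
    (hv : v ∈ Set.range f) (hw : w ∈ Set.range f) (ht : TranslatesToward g v w) :
    ∃ f', IsAxisLine g f' m ∧ f' 0 = v ∧ f' (dist v w) = w := by
  obtain ⟨s, rfl⟩ := hv
  obtain ⟨t, rfl⟩ := hw
  refine ⟨fun u => f (u + s), hf.shift s, by simp, ?_⟩
  have hm := hf.pos
  rw [TranslatesToward, hf.map, mem_geodSegment, hf.isometry.dist_line (s := t) (by linarith),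
    hf.isometry.dist_eq, hf.isometry.dist_eq, Real.dist_eq, Real.dist_eq] at ht
  have hst : s ≤ t := by
    by_contra hcon
    push Not at hcon
    rw [abs_of_pos (by linarith)] at ht
    rcases abs_cases (s - (t + m)) with h | h <;> linarith
  change f (dist (f s) (f t) + s) = f t
  rw [hf.isometry.dist_line hst]
  simp

lemma arcLength_geodSegment (x y : Y) : arcLength (geodSegment x y) = ENNReal.ofReal (dist x y) := by
  apply le_antisymm
  · refine Metric.ediam_le fun z hz w hw => ?_
    rw [edist_dist]
    apply ENNReal.ofReal_le_ofReal
    rw [abs_dist_of_mem_geodSegment hz hw]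
    rw [mem_geodSegment] at hz hw
    rw [abs_le]
    have h1 := dist_nonneg (x := x) (y := z)
    have h2 := dist_nonneg (x := x) (y := w)
    have h3 := dist_nonneg (x := z) (y := y)
    have h4 := dist_nonneg (x := w) (y := y)
    constructor <;> linarith
  · rw [← edist_dist]
    exact Metric.edist_le_ediam_of_mem (left_mem_geodSegment x y) (right_mem_geodSegment x y)

omit [IsRealTree Y] in
lemma setDist_eq_ofReal {A B : Set Y} {r : ℝ} (h : ∀ x ∈ A, ∀ y ∈ B, r ≤ dist x y)
    (h' : ∃ x ∈ A, ∃ y ∈ B, dist x y = r) : setDist A B = ENNReal.ofReal r := by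
  apply le_antisymm
  · obtain ⟨x, hx, y, hy, e⟩ := h'
    rw [← e, ← edist_dist]
    exact (iInf₂_le x hx).trans (Metric.infEDist_le_edist_of_mem hy)
  · refine le_iInf₂ fun x hx => Metric.le_infEDist.2 fun y hy => ?_
    rw [edist_dist]
    exact ENNReal.ofReal_le_ofReal (h x hx y hy)

lemma fixedTree_convex {g : Y ≃ᵢ Y} {x y z : Y} (hx : g x = x) (hy : g y = y)
    (hz : z ∈ geodSegment x y) : g z = z := by
  refine geodSegment_point_unique (x := x) (y := y) ?_ hz ?_
  · rw [← hx, ← hy]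
    rwa [apply_mem_geodSegment]
  · conv_lhs => rw [← hx, g.dist_eq]

lemma Isometry.range_convex {f : ℝ → Y} (hf : Isometry f) {x y z : Y} (hx : x ∈ Set.range f)
    (hy : y ∈ Set.range f) (hz : z ∈ geodSegment x y) : z ∈ Set.range f := by
  obtain ⟨s, rfl⟩ := hx
  obtain ⟨t, rfl⟩ := hy
  rcases le_total s t with h | h
  · rw [hf.geodSegment_eq_image h] at hz
    obtain ⟨u, -, rfl⟩ := hz
    exact ⟨u, rfl⟩
  · rw [geodSegment_comm, hf.geodSegment_eq_image h] at hz
    obtain ⟨u, -, rfl⟩ := hz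
    exact ⟨u, rfl⟩

/-- An isometry that translates a nondegenerate segment along a geodesic is hyperbolic. -/
lemma exists_axisLine_of_translate {g : Y ≃ᵢ Y} {k : ℝ → Y} (hk : Isometry k) {s t m : ℝ}
    (hst : s < t) (hm : 0 < m) (h : ∀ u, s ≤ u → u ≤ t → g (k u) = k (u + m)) :
    ∃ f, IsAxisLine g f m ∧ ∀ u, s ≤ u → u ≤ t + m → f u = k u := by
  have hd : dist (k s) (g (k s)) = m := by
    rw [h s le_rfl hst.le, hk.dist_line (by linarith)]
    ring
  have hc : g (k s) ∈ geodSegment (k s) (g (g (k s))) := by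
    -- Small enough that `g (k w)` is still known and lies before `g (g (k s))`: the two steps of
    -- the orbit of `k s` then overlap in the nondegenerate segment `[g (k s), g (k w)]`.
    set w := min t (s + m) with hw
    have hw1 : w ≤ t := min_le_left _ _
    have hw2 : w ≤ s + m := min_le_right _ _
    have hw3 : s < w := lt_min hst (by linarith)
    have e := h s le_rfl hst.le
    have e1 := h w hw3.le hw1
    have i1 : g (k s) ∈ geodSegment (k s) (g (k w)) := by
      rw [e1, e]
      exact hk.mem_geodSegment_line (by linarith) (by linarith)
    have i2 : g (k w) ∈ geodSegment (g (k s)) (g (g (k s))) := by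
      rw [apply_mem_geodSegment, e]
      exact hk.mem_geodSegment_line hw3.le hw2
    have hne : g (k s) ≠ g (k w) := fun h' => by
      have := hk.injective (g.injective h')
      linarith
    have := dist_concat i1 i2 hne
    rw [mem_geodSegment, this, ← mem_geodSegment.1 i2]
    ring
  have hne : k s ≠ g (k s) := by
    rw [← dist_pos, hd]
    exact hm
  obtain ⟨f₀, hf₀, h0⟩ := exists_axisLine_of_mem hc hne
  rw [hd] at hf₀
  have hax : ∀ u, s ≤ u → u ≤ t → k u ∈ Set.range f₀ := fun u h1 h2 => by
    rw [hf₀.mem_range_iff, h u h1 h2, hk.dist_line (by linarith)]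
    ring
  obtain ⟨p, hp⟩ := hf₀.map_mem_range_iff.2 (hax t hst.le le_rfl)
  rw [h t hst.le le_rfl] at hp
  have hp1 : f₀ m = k (s + m) := by
    have := hf₀.map 0
    rw [h0, zero_add, h s le_rfl hst.le] at this
    exact this.symm
  have e1 := hf₀.isometry.dist_eq 0 p
  have e2 := hf₀.isometry.dist_eq m p
  rw [h0, hp, hk.dist_line (by linarith), Real.dist_eq, zero_sub, abs_neg] at e1
  rw [hp1, hp, hk.dist_line (by linarith), Real.dist_eq] at e2
  -- The distances of the point from `f₀ 0` and from `f₀ m` together rule out the opposite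
  -- orientation.
  have hpe : p = t + m - s := by
    rcases abs_cases p with h1 | h1 <;> rcases abs_cases (m - p) with h2 | h2 <;> linarith
  refine ⟨fun u => f₀ (u + -s), hf₀.shift (-s), fun u h1 h2 => ?_⟩
  refine (hf₀.shift (-s)).isometry.line_eq_of_eq hk (s := s) (u := t + m) ?_ ?_ h1 h2
  · simp [h0]
  · rw [← hp, hpe]
    congr 1

/-! ### Two hyperbolic isometries with overlapping axes -/

/-- `a` and `b` translate by `p` and `q` in the same direction along the lines `f` and `h`, which
overlap in the segment with parameters `[α, β]`. -/
structure AxisPair (a b : Y ≃ᵢ Y) (f h : ℝ → Y) (p q α β : ℝ) : Prop where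
  left : IsAxisLine a f p
  right : IsAxisLine b h q
  overlap : Overlap f h α β

namespace AxisPair

variable {a b : Y ≃ᵢ Y} {f h : ℝ → Y} {p q α β : ℝ}

omit [IsRealTree Y] in
lemma symm (P : AxisPair a b f h p q α β) : AxisPair b a h f q p α β :=
  ⟨P.right, P.left, P.overlap.symm⟩

-- `b⁻¹` slides the point back into the overlap, where it is also a point of `f` and is pushed on by
-- `a`.
omit [IsRealTree Y] in
lemma mul_inv_apply (P : AxisPair a b f h p q α β) {t : ℝ} (h1 : α + q ≤ t) (h2 : t ≤ β + q) :
    (a * b⁻¹) (h t) = f (t + (p - q)) := by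
  rw [IsometryEquiv.mul_apply, P.right.inv_map, ← P.overlap.eq _ (by linarith) (by linarith),
    P.left.map]
  congr 1
  ring

omit [IsRealTree Y] in
lemma mul_inv_translate (P : AxisPair a b f h p q α β) (t : ℝ) :
    (a * b⁻¹) (b (f (t - q))) = f (t + (p - q)) := by
  rw [IsometryEquiv.mul_apply, IsometryEquiv.inv_apply_self, P.left.map]
  congr 1
  ring

-- If `a = b`, all powers would carry the common point `f α = h α` along both lines, against the
-- bounded overlap. This makes an elliptic `a * b⁻¹` a nontrivial torsion element.
omit [IsRealTree Y] in
lemma mul_inv_ne_one (P : AxisPair a b f h p q α β) : a * b⁻¹ ≠ 1 := by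
  intro e
  have hab : a = b := mul_inv_eq_one.1 e
  have P' := P
  subst hab
  have hq := P.right.pos
  obtain ⟨n, hn⟩ := exists_nat_gt ((β - α) / q)
  have hn' : β < α + n * q := by
    rw [div_lt_iff₀ hq] at hn
    linarith
  have k1 : ∀ n : ℕ, (a ^ n) (h α) = h (α + n * q) := fun n => by
    induction n with
    | zero => simp
    | succ n ih =>
      rw [pow_succ', IsometryEquiv.mul_apply, ih, P.right.map]
      congr 1
      push_cast
      ring
  have k2 : ∀ n : ℕ, (a ^ n) (f α) = f (α + n * p) := fun n => by
    induction n with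
    | zero => simp
    | succ n ih =>
      rw [pow_succ', IsometryEquiv.mul_apply, ih, P.left.map]
      congr 1
      push_cast
      ring
  have e1 : f (α + n * p) = h (α + n * q) := by
    rw [← k1, ← k2, P.overlap.eq α le_rfl P.overlap.le]
  have e2 := P.overlap.param_eq e1
  have e3 := (P.overlap.mem _ _ e1).2
  linarith

/-- One step of the Euclidean algorithm. -/
lemma step (P : AxisPair a b f h p q α β) (hpq : q < p) (hl : α + q < β) :
    ∃ f', AxisPair (a * b⁻¹) b f' h (p - q) q (α + q) β := by
  have hq := P.right.pos
  have o := P.overlap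
  -- The piece `[α + q, β]` of `f` is translated by `p - q`, so the new axis follows `f` up to
  -- parameter `β + p - q`.
  obtain ⟨f', hf', he⟩ := exists_axisLine_of_translate (g := a * b⁻¹) P.left.isometry
    (s := α + q) (t := β) (m := p - q) hl (by linarith) (fun u h1 h2 => by
      rw [o.eq u (by linarith) h2]
      exact P.mul_inv_apply h1 (by linarith))
  refine ⟨f', hf', P.right, Overlap.of_local hf'.isometry P.right.isometry hl.le
    (fun t h1 h2 => ?_) (fun ε hε => ?_) fun ε hε => ?_⟩
  · rw [he t h1 (by linarith), o.eq t (by linarith) h2]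
  -- Just after `β` the new axis still follows `f`, which has already left `h`.
  · have h1 : 0 < min (ε / 2) (p - q) := lt_min (by linarith) (by linarith)
    have h2 := min_le_left (ε / 2) (p - q)
    have h3 := min_le_right (ε / 2) (p - q)
    refine ⟨β + min (ε / 2) (p - q), by linarith, by linarith, ?_⟩
    rw [he _ (by linarith) (by linarith)]
    rintro ⟨t, ht⟩
    have := (o.mem _ _ ht.symm).2
    linarith
  · have h1 : 0 < min (ε / 2) (p - q) := lt_min (by linarith) (by linarith)
    have h2 := min_le_left (ε / 2) (p - q)
    have h3 := min_le_right (ε / 2) (p - q)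
    refine ⟨α + q - min (ε / 2) (p - q), by linarith, by linarith, ?_⟩
    set t := α + q - min (ε / 2) (p - q) with ht
    -- Just before `α + q` the new axis is the translate by `b` of a part of `f` before `α`. That
    -- part is off `h`, and `b` preserves `h`.
    have e1 : f' t = b (f (t - q)) := by
      have e2 := hf'.map t
      rw [he (t + (p - q)) (by linarith) (by linarith), ← P.mul_inv_translate] at e2
      exact (a * b⁻¹).injective e2
    rw [e1, P.right.map_mem_range_iff]
    rintro ⟨u, hu⟩
    have := (o.mem _ _ hu.symm).1
    linarith

/-- The last step of the Euclidean algorithm, for equal translation lengths. -/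
lemma range_inter_fixedTree (P : AxisPair a b f h p p α β) (hl : α + p ≤ β) :
    Set.range h ∩ fixedTree (a * b⁻¹) = h '' Set.Icc (α + p) β := by
  have hp := P.right.pos
  have o := P.overlap
  have hfix : ∀ t, α + p ≤ t → t ≤ β → (a * b⁻¹) (h t) = h t := fun t h1 h2 => by
    rw [P.mul_inv_apply h1 (by linarith), sub_self, add_zero, o.eq t (by linarith) h2]
  ext z
  constructor
  · rintro ⟨⟨t, rfl⟩, ht⟩
    refine ⟨t, ⟨?_, ?_⟩, rfl⟩
    · by_contra hcon
      push Not at hcon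
      -- By convexity a fixed point before `α + p` can be moved into `[α, α + p)`. There `a⁻¹` and
      -- `b⁻¹` would have a common value on both lines, at parameter `s - p < α`.
      set s := max t α with hs
      have h1 : t ≤ s := le_max_left _ _
      have h2 : α ≤ s := le_max_right _ _
      have h3 : s < α + p := max_lt hcon (by linarith)
      have hfs := fixedTree_convex ht (hfix (α + p) le_rfl hl)
        (P.right.isometry.mem_geodSegment_line h1 h3.le)
      rw [IsometryEquiv.mul_apply, P.right.inv_map] at hfs
      have e : h (s - p) = a⁻¹ (h s) := by rw [← hfs, IsometryEquiv.inv_apply_self]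
      rw [← o.eq s h2 (by linarith), P.left.inv_map] at e
      have := (o.mem _ _ e.symm).1
      linarith
    · by_contra hcon
      push Not at hcon
      -- Moved into `(β, β + p]`, the fixed point would be `f s = h s`, beyond the overlap.
      set s := min t (β + p) with hs
      have h1 : s ≤ t := min_le_left _ _
      have h2 : s ≤ β + p := min_le_right _ _
      have h3 : β < s := lt_min hcon (by linarith)
      have hfs := fixedTree_convex (hfix β hl le_rfl) ht
        (P.right.isometry.mem_geodSegment_line h3.le h1)
      rw [P.mul_inv_apply (by linarith) h2] at hfs
      have := (o.mem _ _ hfs).2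
      linarith
  · rintro ⟨t, ⟨h1, h2⟩, rfl⟩
    exact ⟨⟨t, rfl⟩, hfix t h1 h2⟩

end AxisPair

/-! ### Overlaps exactly as long as the smaller translation length. -/

/-- Two lines that meet exactly in a common ray or segment starting at parameter `β`: the length of
the intersection tells how far they agree. -/
lemma line_eq_iff_le_arcLength {f k : ℝ → Y} (hf : Isometry f) (hk : Isometry k) {β : ℝ}
    (hβ : f β = k β) (hmem : ∀ s t, f s = k t → s = t ∧ β ≤ s) {r : ℝ} (hr : 0 ≤ r) :
    f (β + r) = k (β + r) ↔ ENNReal.ofReal r ≤ arcLength (Set.range f ∩ Set.range k) := by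
  constructor
  · intro h
    have := Metric.edist_le_ediam_of_mem (s := Set.range f ∩ Set.range k) (x := f β)
      (y := f (β + r)) ⟨⟨_, rfl⟩, _, hβ.symm⟩ ⟨⟨_, rfl⟩, _, h.symm⟩
    rwa [edist_dist, hf.dist_line (by linarith), add_sub_cancel_left] at this
  · intro h
    -- The diameter is only a supremum, so agreement is first proved strictly before `r` and then
    -- passes to `r` by continuity.
    have below : ∀ s, 0 ≤ s → s < r → f (β + s) = k (β + s) := by
      intro s hs hsr
      by_contra hne
      have hb : ∀ u v, f u = k v → u ≤ β + s := fun u v e => by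
        by_contra hcon
        push Not at hcon
        obtain ⟨e', -⟩ := hmem u v e
        subst e'
        exact hne (hf.line_eq_of_eq hk hβ e (by linarith) hcon.le)
      have : arcLength (Set.range f ∩ Set.range k) ≤ ENNReal.ofReal s := by
        refine Metric.ediam_le ?_
        rintro _ ⟨⟨u, rfl⟩, u', hu⟩ _ ⟨⟨v, rfl⟩, v', hv⟩
        rw [edist_dist, hf.dist_eq, Real.dist_eq]
        apply ENNReal.ofReal_le_ofReal
        have h1 := hb u u' hu.symm
        have h2 := hb v v' hv.symm
        have h3 := (hmem u u' hu.symm).2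
        have h4 := (hmem v v' hv.symm).2
        rw [abs_le]
        constructor <;> linarith
      exact absurd ((ENNReal.ofReal_lt_ofReal_iff (by linarith)).2 hsr)
        (not_lt.2 (h.trans this))
    rcases hr.eq_or_lt with rfl | hr'
    · simpa using hβ
    · apply dist_le_zero.1
      by_contra hcon
      push Not at hcon
      set d := dist (f (β + r)) (k (β + r)) with hd
      set e := min (d / 4) (r / 2) with he
      have h1 : 0 < e := lt_min (by linarith) (by linarith)
      have h2 : e ≤ d / 4 := min_le_left _ _
      have h3 : e ≤ r / 2 := min_le_right _ _
      have h4 := below (r - e) (by linarith) (by linarith)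
      have t1 := dist_triangle (f (β + r)) (f (β + (r - e))) (k (β + r))
      rw [dist_comm (f (β + r)) (f (β + (r - e))), hf.dist_line (by linarith), h4,
        hk.dist_line (by linarith), ← hd] at t1
      linarith

namespace AxisPair

variable {a b : Y ≃ᵢ Y} {f h : ℝ → Y} {p q α β : ℝ}

/-- If the overlap has the length of the smaller translation length, then the axis of `a` and its
translate by `b` meet only beyond the end of the overlap. -/
lemma eq_translate (P : AxisPair a b f h p q α β) (hl : α + q = β) {s t : ℝ}
    (e : f s = b (f (2 * β - t - q))) : s = t ∧ β ≤ s := by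
  have hq := P.right.pos
  have o := P.overlap
  have hbh : ∀ t, b (h (t - q)) = h t := fun t => by rw [P.right.map, sub_add_cancel]
  -- The translate of `f` by `b` shares with `h` the parameters `[α + q, β + q]`. As `α + q = β`, it
  -- has its lower fork at the very point where `f` leaves `h`. The argument `2 * β - t - q` runs
  -- through this translate backwards, away from `h`.
  have o' := o.translate b q
  simp only [hbh] at o'
  rw [hl] at o'
  have hb1 := o'.dist_bot (2 * β - t) (t := β) le_rfl
  have ht1 := o.dist_top s (t := β) le_rfl
  rw [← e] at hb1
  rw [hb1] at ht1
  -- Before `β` the line `f` approaches `h β` along `h` or from its fork at `α`, while the translate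
  -- reaches all earlier points of `h` only through `h β`. The distances from `h (max s α)`
  -- disagree. The bound on `t` is symmetric.
  have hs : β ≤ s := by
    by_contra hcon
    push Not at hcon
    have h1 : s ≤ max s α := le_max_left _ _
    have h2 : α ≤ max s α := le_max_right _ _
    have h3 : max s α < β := max_lt hcon (by linarith)
    have hb2 := o'.dist_bot (2 * β - t) (t := max s α) h3.le
    rw [← e, ← o.eq _ h2 h3.le, P.left.isometry.dist_line h1] at hb2
    rw [abs_of_neg (a := s - β) (by linarith)] at ht1
    linarith
  have ht : β ≤ t := by
    by_contra hcon
    push Not at hcon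
    have h1 : min (2 * β - t) (β + q) ≤ 2 * β - t := min_le_left _ _
    have h2 : min (2 * β - t) (β + q) ≤ β + q := min_le_right _ _
    have h3 : β < min (2 * β - t) (β + q) := lt_min (by linarith) (by linarith)
    have ht2 := o.dist_top s h3.le
    rw [← o'.eq _ h3.le h2, e, o'.isometry_left.dist_eq, Real.dist_eq, abs_of_nonneg (by linarith)]
      at ht2
    rw [abs_of_pos (a := 2 * β - t - β) (by linarith)] at ht1
    linarith
  rw [abs_of_nonpos (a := 2 * β - t - β) (by linarith), abs_of_nonneg (by linarith)] at ht1
  exact ⟨by linarith, hs⟩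

omit [IsRealTree Y] in
lemma isometry_translate (P : AxisPair a b f h p q α β) :
    Isometry fun t => b (f (2 * β - t - q)) :=
  b.isometry.comp (P.left.isometry.comp (Isometry.of_dist_eq fun s t => by
    rw [dist_sub_right, dist_sub_left]))

omit [IsRealTree Y] in
lemma range_translate : Set.range (fun t => b (f (2 * β - t - q))) = b '' Set.range f := by
  ext z
  constructor
  · rintro ⟨t, rfl⟩
    exact ⟨_, ⟨_, rfl⟩, rfl⟩
  · rintro ⟨_, ⟨t, rfl⟩, rfl⟩
    exact ⟨2 * β - t - q, by simp only; congr 2; ring⟩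

/-- Both lines pass `h β` at parameter `β` and can meet only at equal parameters from there on, so
the length of their intersection says how far they agree. -/
lemma eq_translate_iff (P : AxisPair a b f h p q α β) (hl : α + q = β) {r : ℝ} (hr : 0 ≤ r) :
    f (β + r) = b (f (β - r - q)) ↔
      ENNReal.ofReal r ≤ arcLength (Set.range f ∩ b '' Set.range f) := by
  have hβ : f β = b (f (2 * β - β - q)) := by
    have : 2 * β - β - q = α := by linarith
    rw [this, P.overlap.eq α le_rfl P.overlap.le, P.right.map, hl,
      P.overlap.eq β P.overlap.le le_rfl]
  rw [← range_translate (b := b) (f := f) (β := β) (q := q),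
    ← line_eq_iff_le_arcLength P.left.isometry P.isometry_translate hβ
      (fun s t => P.eq_translate hl) hr]
  have : 2 * β - (β + r) - q = β - r - q := by ring
  rw [this]

omit [IsRealTree Y] in
lemma dist_mul_inv_apply (P : AxisPair a b f h p q α β) (hl : α + q = β) (hpq : q ≤ p) :
    dist (h β) ((a * b⁻¹) (h β)) = p - q := by
  rw [P.mul_inv_apply hl.le (by linarith [P.right.pos]), ← P.overlap.eq β P.overlap.le le_rfl,
    P.left.isometry.dist_line (by linarith)]
  ring

/-- If the axis of `a` and its translate by `b` share a long segment, then `a * b⁻¹` is elliptic. -/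
lemma apply_eq_of_le_arcLength (P : AxisPair a b f h p q α β) (hl : α + q = β) (hpq : q ≤ p)
    (hr : ENNReal.ofReal ((p - q) / 2) ≤ arcLength (Set.range f ∩ b '' Set.range f)) :
    (a * b⁻¹) (f (β + (p - q) / 2)) = f (β + (p - q) / 2) := by
  rw [← P.eq_translate_iff hl (by linarith)] at hr
  -- With `r = (p - q) / 2` the new parameter `β - r + (p - q)` is `β + r` again.
  conv_lhs => rw [hr, P.mul_inv_translate]
  congr 1
  ring

/-- The known fixed point on `f` lies beyond the fork `h β`. If `y` did too, `h β` would lie between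
two fixed points and be fixed, but it moves by `p - q`. -/
lemma mem_geodSegment_of_fixed (P : AxisPair a b f h p q α β) (hl : α + q = β) (hpq : q < p)
    (hr : ENNReal.ofReal ((p - q) / 2) ≤ arcLength (Set.range f ∩ b '' Set.range f)) {y : Y}
    (hy : (a * b⁻¹) y = y) (t : ℝ) : h β ∈ geodSegment y (h t) := by
  have hz := P.apply_eq_of_le_arcLength hl hpq.le hr
  have h1 := P.overlap.symm.mem_geodSegment_top t (t := β + (p - q) / 2) (by linarith)
  rw [P.overlap.eq β P.overlap.le le_rfl] at h1
  rcases mem_geodSegment_or_mem_geodSegment (y := y) h1 with h2 | h2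
  · rwa [geodSegment_comm]
  · have h3 := fixedTree_convex hy hz h2
    have h4 := P.dist_mul_inv_apply hl hpq.le
    rw [h3, dist_self] at h4
    linarith

/-- A point that moves by `p - q` is at least half as far from any fixed point. The known fixed
point on `f` attains this bound at the fork `h β`. -/
lemma setDist_fixedTree (P : AxisPair a b f h p q α β) (hl : α + q = β) (hpq : q < p)
    (hr : ENNReal.ofReal ((p - q) / 2) ≤ arcLength (Set.range f ∩ b '' Set.range f)) :
    EdgeDisjoint (Set.range h) (fixedTree (a * b⁻¹)) ∧
      setDist (Set.range h) (fixedTree (a * b⁻¹)) = ENNReal.ofReal ((p - q) / 2) := by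
  have hle : ∀ y, (a * b⁻¹) y = y → (p - q) / 2 ≤ dist y (h β) := fun y hy => by
    have t1 := dist_triangle (h β) y ((a * b⁻¹) (h β))
    have e : dist y ((a * b⁻¹) (h β)) = dist y (h β) := by
      conv_lhs => rw [← hy, IsometryEquiv.dist_eq]
    rw [P.dist_mul_inv_apply hl hpq.le, e, dist_comm] at t1
    linarith
  have hle' : ∀ x ∈ Set.range h, ∀ y ∈ fixedTree (a * b⁻¹), (p - q) / 2 ≤ dist x y := by
    rintro _ ⟨t, rfl⟩ y hy
    have h1 := mem_geodSegment.1 (P.mem_geodSegment_of_fixed hl hpq hr hy t)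
    rw [dist_comm]
    linarith [hle y hy, dist_nonneg (x := h β) (y := h t)]
  refine ⟨?_, setDist_eq_ofReal hle' ⟨h β, ⟨β, rfl⟩, _,
    P.apply_eq_of_le_arcLength hl hpq.le hr, ?_⟩⟩
  · rintro x ⟨hx, hx'⟩
    have := hle' x hx x hx'
    rw [dist_self] at this
    linarith
  · rw [← P.overlap.eq β P.overlap.le le_rfl, P.left.isometry.dist_line (by linarith)]
    ring

/-- If the axis of `a` and its translate by `b` share a short segment, then `a * b⁻¹` is
hyperbolic with an axis disjoint from that of `b`. -/
lemma exists_axisLine_of_arcLength_lt (P : AxisPair a b f h p q α β) (hl : α + q = β)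
    (hr : arcLength (Set.range f ∩ b '' Set.range f) < ENNReal.ofReal ((p - q) / 2)) :
    ∃ k, IsAxisLine (a * b⁻¹) k
        (p - q - 2 * (arcLength (Set.range f ∩ b '' Set.range f)).toReal) ∧
      EdgeDisjoint (Set.range h) (Set.range k) ∧
      setDist (Set.range h) (Set.range k) = arcLength (Set.range f ∩ b '' Set.range f) := by
  set L := arcLength (Set.range f ∩ b '' Set.range f) with hL
  set r := L.toReal with hrdef
  set g := a * b⁻¹ with hg
  have hfin : L ≠ ⊤ := hr.ne_top
  have hLr : ENNReal.ofReal r = L := ENNReal.ofReal_toReal hfin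
  have hr0 : 0 ≤ r := ENNReal.toReal_nonneg
  have hrD : r < (p - q) / 2 := by
    rw [← hLr] at hr
    exact (ENNReal.ofReal_lt_ofReal_iff_of_nonneg hr0).1 hr
  have hq := P.right.pos
  have o := P.overlap
  have hc : f (β + r) = b (f (β - r - q)) := (P.eq_translate_iff hl hr0).2 hLr.le
  have hgc : g (f (β + r)) = f (β - r + (p - q)) := by rw [hc, P.mul_inv_translate]
  have hgc' : g⁻¹ (f (β + r)) = b (f (β + r - (p - q) - q)) := by
    have := P.mul_inv_translate (β + r - (p - q))
    rw [sub_add_cancel] at this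
    rw [← this, hg, IsometryEquiv.inv_apply_self]
  -- `f (β + r)` is where the axis of `a` and its translate part. Its image under `g` lies ahead on
  -- the axis and its preimage ahead on the translate, so it lies between the two and hence on an
  -- axis of `g`.
  have hmid : f (β + r) ∈ geodSegment (g⁻¹ (f (β + r))) (g (f (β + r))) := by
    refine mem_geodSegment_of_inter fun c h1 h2 => ?_
    rw [hgc, P.left.isometry.geodSegment_eq_image (by linarith)] at h2
    obtain ⟨u, ⟨hu1, hu2⟩, rfl⟩ := h2
    have hi := P.isometry_translate
    have e1 : b (f (β + r - (p - q) - q)) =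
        (fun t => b (f (2 * β - t - q))) (β - r + (p - q)) := by
      simp only
      congr 2
      ring
    have e2 : f (β + r) = (fun t => b (f (2 * β - t - q))) (β + r) := by
      rw [hc]
      simp only
      congr 2
      ring
    rw [hgc', e1, e2, hi.geodSegment_eq_image (by linarith)] at h1
    obtain ⟨v, ⟨hv1, hv2⟩, hv⟩ := h1
    obtain ⟨h3, h4⟩ := P.eq_translate hl hv.symm
    subst h3
    have h5 : f (β + (u - β)) = b (f (β - (u - β) - q)) := by
      rw [add_sub_cancel, ← hv]
      simp only
      congr 2
      ring
    rw [P.eq_translate_iff hl (by linarith), ← hL, ← hLr,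
      ENNReal.ofReal_le_ofReal_iff hr0] at h5
    congr 1
    linarith
  have hdist : dist (f (β + r)) (g (f (β + r))) = p - q - 2 * r := by
    rw [hgc, P.left.isometry.dist_line (by linarith)]
    ring
  have hmid' : g (f (β + r)) ∈ geodSegment (f (β + r)) (g (g (f (β + r)))) := by
    have := (apply_mem_geodSegment g).2 hmid
    rwa [IsometryEquiv.apply_inv_self] at this
  obtain ⟨k, hk, hk0⟩ := exists_axisLine_of_mem hmid' (by
    rw [← dist_pos, hdist]
    linarith)
  rw [hdist] at hk
  have hfb : f β = h β := o.eq β o.le le_rfl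
  have hDx := P.dist_mul_inv_apply hl (by linarith)
  have key : ∀ y ∈ Set.range k, ∀ t, h β ∈ geodSegment y (h t) := by
    intro y hy t
    -- If `r = 0`, the new axis passes through `h β` itself. On each side, over one period, it
    -- follows the axis of `a` or its translate, and neither returns to `h`.
    rcases hr0.eq_or_lt with hr1 | hr1
    · rw [← hr1, add_zero] at hk0 hgc hgc'
      rw [← hr1, mul_zero, sub_zero] at hk
      rw [sub_zero] at hgc
      have hk1 : k (p - q) = f (β + (p - q)) := by
        rw [← hgc, ← hk0, hk.map, zero_add]
      have hk2 : k (-(p - q)) = b (f (β - (p - q) - q)) := by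
        rw [← hgc', ← hk0, hk.inv_map, zero_sub]
      refine mem_geodSegment_of_inter fun c h1 h2 => ?_
      have hhb : h β = k 0 := by rw [hk0, hfb]
      obtain ⟨u, rfl⟩ := hk.isometry.range_convex (by rw [hhb]; exact ⟨0, rfl⟩) hy h1
      obtain ⟨w, hw⟩ := P.right.isometry.range_convex ⟨β, rfl⟩ ⟨t, rfl⟩ h2
      have hin : ∀ v, v ∈ Set.Icc (min 0 u) (max 0 u) → k v ∈ Set.range h := by
        rintro v ⟨hv1, hv2⟩
        rcases le_total 0 u with hu | hu
        · rw [min_eq_left hu] at hv1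
          rw [max_eq_right hu] at hv2
          exact P.right.isometry.range_convex ⟨β, hhb⟩ ⟨w, hw⟩
            (hk.isometry.mem_geodSegment_line hv1 hv2)
        · rw [min_eq_right hu] at hv1
          rw [max_eq_left hu] at hv2
          exact P.right.isometry.range_convex ⟨w, hw⟩ ⟨β, hhb⟩
            (hk.isometry.mem_geodSegment_line hv1 hv2)
      rcases lt_trichotomy u 0 with hu | hu | hu
      · exfalso
        set v := max u (-(p - q)) with hv
        have hv1 : u ≤ v := le_max_left _ _
        have hv2 : -(p - q) ≤ v := le_max_right _ _
        have hv3 : v < 0 := max_lt hu (by linarith)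
        obtain ⟨x, hx⟩ := hin v ⟨by rw [min_eq_right hu.le]; exact hv1,
          by rw [max_eq_left hu.le]; exact hv3.le⟩
        have hbh : ∀ t, b (h (t - q)) = h t := fun t => by rw [P.right.map, sub_add_cancel]
        have o' := o.translate b q
        simp only [hbh] at o'
        rw [hl] at o'
        have hkv : k v = b (f (v + β - q)) := by
          have i1 : Isometry fun t => b (f (t + β - q)) :=
            b.isometry.comp (P.left.isometry.comp (Isometry.of_dist_eq fun s t => by
              rw [dist_sub_right, dist_add_right]))
          refine hk.isometry.line_eq_of_eq i1 (s := -(p - q)) (u := 0) ?_ ?_ hv2 hv3.le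
          · rw [hk2]
            congr 2
            ring
          · rw [hk0, hfb, zero_add, ← hbh β]
            rw [o.eq (β - q) (by linarith) (by linarith)]
        rw [hkv] at hx
        have := (o'.mem _ _ hx.symm).1
        linarith
      · rw [hu, hhb]
      · exfalso
        set v := min u (p - q) with hv
        have hv1 : v ≤ u := min_le_left _ _
        have hv2 : v ≤ p - q := min_le_right _ _
        have hv3 : 0 < v := lt_min hu (by linarith)
        obtain ⟨x, hx⟩ := hin v ⟨by rw [min_eq_left hu.le]; exact hv3.le,
          by rw [max_eq_right hu.le]; exact hv1⟩
        have hkv : k v = f (v + β) := by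
          have i1 : Isometry fun t => f (t + β) :=
            P.left.isometry.comp (Isometry.of_dist_eq fun s t => by rw [dist_add_right])
          refine hk.isometry.line_eq_of_eq i1 (s := 0) (u := p - q) ?_ ?_ hv3.le hv2
          · rw [hk0, zero_add]
          · rw [hk1, add_comm]
        rw [hkv] at hx
        have := (o.mem _ _ hx.symm).2
        linarith
    · have h1 := o.symm.mem_geodSegment_top t (t := β + r) (by linarith)
      rw [hfb] at h1
      -- If `r > 0` and `h β` did not separate, it would lie on the new axis by convexity; but it
      -- moves by `p - q`, not by `p - q - 2 * r`.
      rcases mem_geodSegment_or_mem_geodSegment (y := y) h1 with h2 | h2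
      · rwa [geodSegment_comm]
      · have h3 := hk.isometry.range_convex hy (by rw [← hk0]; exact ⟨0, rfl⟩) h2
        rw [hk.mem_range_iff, hDx] at h3
        linarith
  have hle : ∀ y ∈ Set.range k, r ≤ dist y (h β) := fun y hy => by
    rw [hk.mem_range_iff] at hy
    have t1 := dist_triangle (h β) y (g (h β))
    have t2 := dist_triangle y (g y) (g (h β))
    rw [hDx, dist_comm] at t1
    rw [hy, g.dist_eq] at t2
    linarith
  refine ⟨k, hk, ?_, ?_⟩
  · have huniq : ∀ x ∈ Set.range h ∩ Set.range k, x = h β := by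
      rintro _ ⟨⟨t, rfl⟩, hx⟩
      have := mem_geodSegment.1 (key _ hx t)
      rw [dist_self, dist_comm] at this
      exact (dist_le_zero.1 (by linarith [dist_nonneg (x := h β) (y := h t)])).symm
    intro x hx y hy
    rw [huniq x hx, huniq y hy]
  · rw [← hLr]
    refine setDist_eq_ofReal ?_ ⟨h β, ⟨β, rfl⟩, k 0, ⟨0, rfl⟩, ?_⟩
    · rintro _ ⟨t, rfl⟩ y hy
      have h1 := mem_geodSegment.1 (key y hy t)
      rw [dist_comm]
      linarith [hle y hy, dist_nonneg (x := h β) (y := h t)]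
    · rw [hk0, ← hfb, P.left.isometry.dist_line (by linarith)]
      ring

end AxisPair

end Overlap

/-! ### Branch points, half-trees and ping-pong. -/

section Schottky

variable {Y : Type*} [MetricSpace Y]

/-- A point whose complement has at least three components. -/
def IsBranchPoint (p : Y) : Prop :=
  ∃ x y z : Y, x ≠ p ∧ y ≠ p ∧ z ≠ p ∧ p ∈ geodSegment x y ∧ p ∈ geodSegment y z ∧
    p ∈ geodSegment x z

lemma IsBranchPoint.map {p : Y} (hp : IsBranchPoint p) (g : Y ≃ᵢ Y) : IsBranchPoint (g p) := by
  obtain ⟨x, y, z, h1, h2, h3, h4, h5, h6⟩ := hp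
  exact ⟨g x, g y, g z, g.injective.ne h1, g.injective.ne h2, g.injective.ne h3,
    (apply_mem_geodSegment g).2 h4, (apply_mem_geodSegment g).2 h5,
    (apply_mem_geodSegment g).2 h6⟩

lemma isBranchPoint_map_iff {p : Y} (g : Y ≃ᵢ Y) : IsBranchPoint (g p) ↔ IsBranchPoint p :=
  ⟨fun h => by simpa using h.map g⁻¹, fun h => h.map g⟩

/-- Every segment contains only finitely many branch points. -/
def HasFiniteBranching (Y : Type*) [MetricSpace Y] : Prop :=
  ∀ x y : Y, {z | z ∈ geodSegment x y ∧ IsBranchPoint z}.Finite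

/-- Supplies the points at which half-trees are cut off: the closure of a half-tree is easy to
describe only away from branch points. -/
lemma HasFiniteBranching.exists_not_isBranchPoint (hY : HasFiniteBranching Y) {f : ℝ → Y}
    (hf : Isometry f) {s t : ℝ} (h : s < t) : ∃ u, s < u ∧ u < t ∧ ¬ IsBranchPoint (f u) := by
  by_contra! hcon
  have hfin : (f '' Set.Ioo s t).Finite := by
    refine (hY (f s) (f t)).subset ?_
    rintro _ ⟨u, ⟨h1, h2⟩, rfl⟩
    exact ⟨hf.mem_geodSegment_line h1.le h2.le, hcon u h1 h2⟩
  exact Set.Ioo_infinite h (hfin.of_finite_image hf.injective.injOn)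

lemma isClosed_setOf_mem_geodSegment (o p : Y) : IsClosed {y | p ∈ geodSegment o y} := by
  simp only [mem_geodSegment]
  exact isClosed_eq (by fun_prop) (by fun_prop)

lemma image_halfTree (g : Y ≃ᵢ Y) (x p : Y) :
    g '' {y | p ∉ geodSegment x y} = {y | g p ∉ geodSegment (g x) y} := by
  ext z
  constructor
  · rintro ⟨y, hy, rfl⟩
    simpa only [Set.mem_ofPred_eq, apply_mem_geodSegment] using hy
  · intro hz
    refine ⟨g⁻¹ z, ?_, g.apply_inv_self z⟩
    have := apply_mem_geodSegment g (x := x) (y := g⁻¹ z) (z := p)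
    rw [g.apply_inv_self] at this
    simpa only [Set.mem_ofPred_eq, ← this] using hz

variable [IsRealTree Y]

/-- At a non-branch point between `x` and `o` there are only the directions of `x` and of `o`.
Everything behind `p` as seen from `o` is therefore the half-tree of `x` together with `p`. -/
lemma closure_halfTree {x o p : Y} (hp : ¬ IsBranchPoint p) (hm : p ∈ geodSegment x o)
    (hx : x ≠ p) (ho : o ≠ p) :
    closure {y | p ∉ geodSegment x y} = {y | p ∈ geodSegment o y} := by
  apply Set.Subset.antisymm
  · refine closure_minimal (fun y hy => ?_) (isClosed_setOf_mem_geodSegment o p)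
    rw [Set.mem_ofPred_eq, geodSegment_comm]
    exact (mem_geodSegment_or_mem_geodSegment (y := y) hm).resolve_left hy
  · intro y hy
    by_cases hyp : y = p
    · subst hyp
      rw [Metric.mem_closure_iff]
      intro ε hε
      have hd := dist_pos.2 hx.symm
      obtain ⟨z, hz1, hz2⟩ := IsRealTree.exists_point y x (min (ε / 2) (dist y x))
        (le_min (by linarith) hd.le) (min_le_right _ _)
      have h1 : 0 < min (ε / 2) (dist y x) := lt_min (by linarith) hd
      have h2 : min (ε / 2) (dist y x) ≤ ε / 2 := min_le_left _ _
      refine ⟨z, fun hcon => ?_, by linarith⟩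
      rw [mem_geodSegment, dist_comm x y, dist_comm x z] at hcon
      linarith
    · refine subset_closure fun hcon => hp ⟨x, o, y, hx, ho, hyp, hm, hy, hcon⟩

/-- Neither of `x`, `y` separates the other one from `o`. -/
def NonNested (o x y : Y) : Prop := x ∉ geodSegment o y ∧ y ∉ geodSegment o x

lemma NonNested.disjoint {o x y : Y} (h : NonNested o x y) :
    Disjoint {z | x ∈ geodSegment o z} {z | y ∈ geodSegment o z} := by
  rw [Set.disjoint_left]
  intro z hx hy
  rw [Set.mem_ofPred_eq] at hx hy
  rcases le_total (dist o x) (dist o y) with hle | hle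
  · refine h.1 ?_
    rw [mem_geodSegment, dist_of_mem_geodSegment hx hy hle]
    ring
  · refine h.2 ?_
    rw [mem_geodSegment, dist_of_mem_geodSegment hy hx hle]
    ring

omit [IsRealTree Y] in
lemma nonNested_of_dist {o x y : Y} (h1 : dist o y < dist o x + dist x y)
    (h2 : dist o x < dist o y + dist x y) : NonNested o x y := by
  constructor <;> intro h <;> rw [mem_geodSegment] at h
  · linarith
  · rw [dist_comm y x] at h
    linarith

/-- A criterion for a Schottky pair: `o` is a base point of the fundamental domain, whose four ends
are `p`, `a p`, `q` and `b q`. -/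
lemma isSchottkyPair_of_points {a b : Y ≃ᵢ Y} {o p q : Y} (hp : ¬ IsBranchPoint p)
    (hq : ¬ IsBranchPoint q) (hpo : p ≠ o) (hap : a p ≠ o) (hqo : q ≠ o) (hbq : b q ≠ o)
    (ha : a p ∈ geodSegment o (a o)) (hb : b q ∈ geodSegment o (b o))
    (h1 : NonNested o p (a p)) (h2 : NonNested o p q) (h3 : NonNested o p (b q))
    (h4 : NonNested o (a p) q) (h5 : NonNested o (a p) (b q)) (h6 : NonNested o q (b q)) :
    IsSchottkyPair a b := by
  -- The half-tree at `x` away from `o` is the side of `g⁻¹ o`. The complement of its closure is the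
  -- side of `o`, which `g` carries to the side of `g o` at `g x`.
  have half : ∀ (g : Y ≃ᵢ Y) (x : Y), ¬ IsBranchPoint x → x ≠ o → g x ≠ o →
      g x ∈ geodSegment o (g o) →
      ∃ m p : Set Y, IsHalfTree m ∧ IsHalfTree p ∧ closure m = {y | x ∈ geodSegment o y} ∧
        closure p = {y | g x ∈ geodSegment o y} ∧ g '' (closure m)ᶜ = p ∧
        ⇑g⁻¹ '' (closure p)ᶜ = m := by
    intro g x hx hxo hgo hg
    have hx1 : x ∈ geodSegment (g⁻¹ o) o := by simpa using (apply_mem_geodSegment_iff g).1 hg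
    have hne : g⁻¹ o ≠ x := fun h => hgo (by rw [← h, g.apply_inv_self])
    have hne' : g o ≠ g x := g.injective.ne hxo.symm
    have c1 := closure_halfTree hx hx1 hne hxo.symm
    have c2 := closure_halfTree ((isBranchPoint_map_iff g).not.2 hx)
      (by rwa [geodSegment_comm]) hne' hgo.symm
    refine ⟨_, _, ⟨x, g⁻¹ o, hne, rfl⟩, ⟨g x, g o, hne', rfl⟩, c1, c2, ?_, ?_⟩
    · rw [c1]
      exact image_halfTree g o x
    · rw [c2]
      have := image_halfTree g⁻¹ o (g x)
      rw [g.inv_apply_self] at this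
      exact this
  obtain ⟨am, ap, m1, m2, m3, m4, m5, m6⟩ := half a p hp hpo hap ha
  obtain ⟨bm, bp, n1, n2, n3, n4, n5, n6⟩ := half b q hq hqo hbq hb
  refine ⟨am, ap, bm, bp, m1, m2, n1, n2, ?_, m5, m6, n5, n6⟩
  rw [m3, m4, n3, n4]
  simp [h1.disjoint, h2.disjoint, h3.disjoint, h4.disjoint, h5.disjoint, h6.disjoint]

/-- Hyperbolic isometries whose axes share a segment shorter than both translation lengths. -/
lemma AxisPair.isSchottkyPair (hY : HasFiniteBranching Y) {a b : Y ≃ᵢ Y} {f h : ℝ → Y}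
    {p q α β : ℝ} (P : AxisPair a b f h p q α β) (hp : β - α < p) (hq : β - α < q) :
    IsSchottkyPair a b := by
  have o := P.overlap
  have hf := P.left.isometry
  have hh := P.right.isometry
  have hαβ := o.le
  -- The overlap is shorter than both periods, so `u < α` can be chosen with `u + p > β`, and
  -- likewise `v`. The four cuts lie on the four branches that leave the overlap.
  obtain ⟨u, hu1, hu2, hu⟩ := hY.exists_not_isBranchPoint hf (s := β - p) (t := α) (by linarith)
  obtain ⟨v, hv1, hv2, hv⟩ := hY.exists_not_isBranchPoint hh (s := β - q) (t := α) (by linarith)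
  have ho := o.eq α le_rfl hαβ
  have d1 : dist (f α) (f u) = α - u := by rw [dist_comm, hf.dist_line hu2.le]
  have d2 : dist (f α) (f (u + p)) = u + p - α := hf.dist_line (by linarith)
  have d3 : dist (f α) (h v) = α - v := by rw [ho, dist_comm, hh.dist_line hv2.le]
  have d4 : dist (f α) (h (v + q)) = v + q - α := by rw [ho, hh.dist_line (by linarith)]
  have d5 : dist (f u) (f (u + p)) = p := by rw [hf.dist_line (by linarith)]; ring
  have d6 : dist (h v) (h (v + q)) = q := by rw [hh.dist_line (by linarith)]; ring
  have d7 : dist (f u) (h v) = α - u + (α - v) := by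
    rw [o.dist_bot u hv2.le, abs_of_neg (by linarith)]
    ring
  have d8 : dist (f u) (h (v + q)) = v + q - u := by
    rw [o.dist_top u (by linarith), abs_of_neg (by linarith)]
    ring
  have d9 : dist (f (u + p)) (h v) = u + p - v := by
    rw [o.dist_bot _ hv2.le, abs_of_pos (by linarith)]
    ring
  have d10 : dist (f (u + p)) (h (v + q)) = u + p - β + (v + q - β) := by
    rw [o.dist_top _ (by linarith), abs_of_pos (by linarith)]
  refine isSchottkyPair_of_points (o := f α) (p := f u) (q := h v) hu hv ?_ ?_ ?_ ?_ ?_ ?_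
    (nonNested_of_dist ?_ ?_) (nonNested_of_dist ?_ ?_) (nonNested_of_dist ?_ ?_)
    (nonNested_of_dist ?_ ?_) (nonNested_of_dist ?_ ?_) (nonNested_of_dist ?_ ?_)
  · exact hf.injective.ne hu2.ne
  · rw [P.left.map]
    exact hf.injective.ne (by linarith)
  · rw [ho]
    exact hh.injective.ne hv2.ne
  · rw [P.right.map, ho]
    exact hh.injective.ne (by linarith)
  · rw [P.left.map, P.left.map]
    exact hf.mem_geodSegment_line (by linarith) (by linarith)
  · rw [ho, P.right.map, P.right.map]
    exact hh.mem_geodSegment_line (by linarith) (by linarith)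
  all_goals (try rw [P.left.map]); (try rw [P.right.map]); linarith

/-- The shortest segment between two lines that share at most one point. -/
lemma exists_bridge {f h : ℝ → Y} (hf : Isometry f) (hh : Isometry h)
    (hd : (Set.range f ∩ Set.range h).Subsingleton) :
    ∃ s₀ t₀ δ : ℝ, 0 ≤ δ ∧ ∀ s t, dist (f s) (h t) = |s - s₀| + δ + |t - t₀| := by
  by_cases hne : (Set.range f ∩ Set.range h).Nonempty
  · obtain ⟨_, ⟨s₀, rfl⟩, t₀, ht₀⟩ := hne
    refine ⟨s₀, t₀, 0, le_rfl, fun s t => ?_⟩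
    have hm : f s₀ ∈ geodSegment (f s) (h t) := by
      refine mem_geodSegment_of_inter fun c h1 h2 => hd ⟨?_, ?_⟩ ⟨⟨s₀, rfl⟩, t₀, ht₀⟩
      · exact hf.range_convex ⟨s₀, rfl⟩ ⟨s, rfl⟩ h1
      · exact hh.range_convex ⟨t₀, ht₀⟩ ⟨t, rfl⟩ h2
    rw [← mem_geodSegment.1 hm, hf.dist_eq, Real.dist_eq, ← ht₀, hh.dist_eq, Real.dist_eq,
      abs_sub_comm t₀, add_zero]
  -- Projecting a point of `h` to `f` and the result back to `h` gives the ends of the bridge.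
  · obtain ⟨s₀, hs⟩ := hf.exists_projection (h 0)
    obtain ⟨t₀, ht⟩ := hh.exists_projection (f s₀)
    refine ⟨s₀, t₀, dist (f s₀) (h t₀), dist_nonneg, fun s t => ?_⟩
    have hle : dist (h t₀) (f s) = dist (h t₀) (f s₀) + |s - s₀| := by
      have h1 := hs s
      have h2 := ht 0
      have t1 := dist_triangle (h 0) (h t₀) (f s)
      have t2 := dist_triangle (h t₀) (f s₀) (f s)
      rw [hh.dist_eq, Real.dist_eq] at t1
      rw [hf.dist_eq s₀, Real.dist_eq, abs_sub_comm s₀] at t2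
      rw [dist_comm (f s₀) (h 0), dist_comm (f s₀) (h t₀)] at h2
      linarith
    have := dist_concat (x := f s) (y := f s₀) (z := h t₀) (w := h t)
      (by rw [mem_geodSegment, hf.dist_eq, Real.dist_eq, dist_comm (f s) (h t₀), hle,
            dist_comm (f s₀)]; ring)
      (by rw [mem_geodSegment, ht t, hh.dist_eq, Real.dist_eq, abs_sub_comm])
      (fun e => hne ⟨f s₀, ⟨s₀, rfl⟩, t₀, e.symm⟩)
    rw [this, hf.dist_eq, hh.dist_eq, Real.dist_eq, Real.dist_eq, abs_sub_comm t₀]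

/-- Hyperbolic isometries whose axes share at most one point. -/
lemma isSchottkyPair_of_subsingleton (hY : HasFiniteBranching Y) {a b : Y ≃ᵢ Y} {f h : ℝ → Y}
    {p q : ℝ} (ha : IsAxisLine a f p) (hb : IsAxisLine b h q)
    (hd : (Set.range f ∩ Set.range h).Subsingleton) : IsSchottkyPair a b := by
  have hf := ha.isometry
  have hh := hb.isometry
  have hp := ha.pos
  have hq := hb.pos
  obtain ⟨s₀, t₀, δ, hδ, D⟩ := exists_bridge hf hh hd
  -- On each line the two cuts are one period apart and enclose the foot of the bridge. The base
  -- point is the foot `f s₀`.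
  obtain ⟨u, hu1, hu2, hu⟩ := hY.exists_not_isBranchPoint hf (s := s₀ - p) (t := s₀) (by linarith)
  obtain ⟨v, hv1, hv2, hv⟩ := hY.exists_not_isBranchPoint hh (s := t₀ - q) (t := t₀) (by linarith)
  have d1 : dist (f s₀) (f u) = s₀ - u := by rw [dist_comm, hf.dist_line hu2.le]
  have d2 : dist (f s₀) (f (u + p)) = u + p - s₀ := hf.dist_line (by linarith)
  have d3 : dist (f s₀) (h v) = δ + (t₀ - v) := by
    rw [D, sub_self, abs_zero, abs_of_neg (by linarith)]
    ring
  have d4 : dist (f s₀) (h (v + q)) = δ + (v + q - t₀) := by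
    rw [D, sub_self, abs_zero, abs_of_pos (by linarith)]
    ring
  have d5 : dist (f u) (f (u + p)) = p := by rw [hf.dist_line (by linarith)]; ring
  have d6 : dist (h v) (h (v + q)) = q := by rw [hh.dist_line (by linarith)]; ring
  have d7 : dist (f u) (h v) = s₀ - u + δ + (t₀ - v) := by
    rw [D, abs_of_neg (by linarith), abs_of_neg (by linarith)]
    ring
  have d8 : dist (f u) (h (v + q)) = s₀ - u + δ + (v + q - t₀) := by
    rw [D, abs_of_neg (by linarith), abs_of_pos (by linarith)]
    ring
  have d9 : dist (f (u + p)) (h v) = u + p - s₀ + δ + (t₀ - v) := by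
    rw [D, abs_of_pos (by linarith), abs_of_neg (by linarith)]
    ring
  have d10 : dist (f (u + p)) (h (v + q)) = u + p - s₀ + δ + (v + q - t₀) := by
    rw [D, abs_of_pos (by linarith), abs_of_pos (by linarith)]
  have hbD : ∀ t, dist (h (t + q)) (b (f s₀)) = δ + |t - t₀| := fun t => by
    rw [← hb.map, b.dist_eq, dist_comm, D, sub_self, abs_zero, zero_add]
  have d11 : dist (f s₀) (b (f s₀)) = δ + q + δ := by
    have e1 := hbD t₀
    have e2 := hbD (t₀ - q)
    rw [sub_self, abs_zero, add_zero] at e1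
    rw [sub_add_cancel, sub_sub_cancel_left, abs_neg, abs_of_pos hq] at e2
    have := dist_concat (x := f s₀) (y := h t₀) (z := h (t₀ + q)) (w := b (f s₀))
      (by rw [mem_geodSegment, D, D, hh.dist_line (by linarith), sub_self, sub_self, abs_zero,
            abs_of_pos (by linarith)]; ring)
      (by rw [mem_geodSegment, e1, e2, hh.dist_line (by linarith)]; ring)
      (hh.injective.ne (by linarith))
    rw [this, e1, D, hh.dist_line (by linarith), sub_self, sub_self, abs_zero]
    ring
  refine isSchottkyPair_of_points (o := f s₀) (p := f u) (q := h v) hu hv ?_ ?_ ?_ ?_ ?_ ?_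
    (nonNested_of_dist ?_ ?_) (nonNested_of_dist ?_ ?_) (nonNested_of_dist ?_ ?_)
    (nonNested_of_dist ?_ ?_) (nonNested_of_dist ?_ ?_) (nonNested_of_dist ?_ ?_)
  · exact hf.injective.ne hu2.ne
  · rw [ha.map]
    exact hf.injective.ne (by linarith)
  · rw [← dist_pos, dist_comm, d3]
    linarith
  · rw [hb.map, ← dist_pos, dist_comm, d4]
    linarith
  · rw [ha.map, ha.map]
    exact hf.mem_geodSegment_line (by linarith) (by linarith)
  · rw [hb.map, mem_geodSegment, d4, d11, hbD, abs_of_neg (by linarith)]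
    ring
  all_goals (try rw [ha.map]); (try rw [hb.map]); linarith

omit [IsRealTree Y] in
/-- The ping-pong lemma for Schottky pairs. -/
lemma IsSchottkyPair.isFreeOfRankTwo {a b : Y ≃ᵢ Y} (hs : IsSchottkyPair a b) :
    IsFreeOfRankTwo (Subgroup.closure {a, b}) := by
  obtain ⟨am, ap, bm, bp, h1, h2, h3, h4, hd, ha, ha', hb, hb'⟩ := hs
  simp only [List.pairwise_cons, List.mem_cons, List.not_mem_nil, or_false, forall_eq_or_imp,
    forall_eq, false_imp_iff, implies_true, and_true, List.Pairwise.nil] at hd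
  obtain ⟨⟨d1, d2, d3⟩, ⟨d4, d5⟩, d6⟩ := hd
  have hne : ∀ {H : Set Y}, IsHalfTree H → (closure H).Nonempty := by
    rintro _ ⟨p, x, hx, rfl⟩
    refine ⟨x, subset_closure fun hcon => hx ?_⟩
    rw [mem_geodSegment, dist_self] at hcon
    exact dist_le_zero.1 (by linarith [dist_nonneg (x := p) (y := x)])
  let _ : MulAction (Y ≃ᵢ Y) Y :=
    { smul := fun g x => g x
      one_smul := fun _ => rfl
      mul_smul := fun _ _ _ => rfl }
  -- The closures serve as attracting and repelling sets, since they are what is assumed disjoint.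
  have hinj := FreeGroup.injective_lift_of_ping_pong
    (fun i : ULift (Fin 2) => (![a, b] : Fin 2 → (Y ≃ᵢ Y)) i.down)
    (fun i => ![closure ap, closure bp] i.down) (fun i => ![closure am, closure bm] i.down)
    (by
      rintro ⟨i⟩
      fin_cases i
      · exact hne h2
      · exact hne h4)
    (by
      rintro ⟨i⟩ ⟨j⟩ hij
      fin_cases i <;> fin_cases j
      · exact absurd rfl hij
      · exact d5
      · exact d5.symm
      · exact absurd rfl hij)
    (by
      rintro ⟨i⟩ ⟨j⟩ hij
      fin_cases i <;> fin_cases j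
      · exact absurd rfl hij
      · exact d2
      · exact d2.symm
      · exact absurd rfl hij)
    (by
      rintro ⟨i⟩ ⟨j⟩
      fin_cases i <;> fin_cases j
      · exact d1.symm
      · exact d4
      · exact d3.symm
      · exact d6.symm)
    (by
      rintro ⟨i⟩
      fin_cases i
      · exact ha.subset.trans subset_closure
      · exact hb.subset.trans subset_closure)
    (by
      rintro ⟨i⟩
      fin_cases i
      · exact ha'.subset.trans subset_closure
      · exact hb'.subset.trans subset_closure)
  have hr : (FreeGroup.lift fun i : ULift (Fin 2) => (![a, b] : Fin 2 → (Y ≃ᵢ Y)) i.down).range =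
      Subgroup.closure {a, b} := by
    rw [FreeGroup.range_lift_eq_closure]
    congr 1
    have : (fun i : ULift (Fin 2) => (![a, b] : Fin 2 → (Y ≃ᵢ Y)) i.down) =
        ![a, b] ∘ ULift.down := rfl
    rw [this, ULift.down_surjective.range_comp, Matrix.range_cons, Matrix.range_cons,
      Matrix.range_empty, Set.union_empty, Set.singleton_union]
  rw [IsFreeOfRankTwo, ← hr]
  exact ⟨(MonoidHom.ofInjective hinj).symm.trans (FreeGroup.freeGroupCongr Equiv.ulift)⟩

end Schottky

namespace WeightedTree

variable {V : Type*} (T : WeightedTree V)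

/-! ### Distances between vertices -/

lemma vdist_adj_alternative {u v : V} (h : T.graph.Adj u v) (x : V) :
    T.vdist x v = T.vdist x u + T.vdist u v ∨ T.vdist x u = T.vdist x v + T.vdist u v := by
  rcases T.mem_path_of_adj h x with h' | h'
  · exact Or.inl (T.vdist_of_mem h')
  · right
    rw [T.vdist_of_mem h', T.vdist_comm v u]

/-- A path between vertices on different sides of an edge crosses the edge. -/
lemma vdist_crossing {u v x y : V} (h : T.graph.Adj u v)
    (hx : T.vdist x v = T.vdist x u + T.vdist u v) (hy : T.vdist y u = T.vdist y v + T.vdist u v) :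
    T.vdist x y = T.vdist x u + T.vdist u v + T.vdist v y := by
  have hL := T.vdist_pos h
  have hp : ((T.path x u).append (SimpleGraph.Walk.cons h (T.path v y))).IsPath := by
    rw [SimpleGraph.Walk.isPath_def, SimpleGraph.Walk.support_append,
      SimpleGraph.Walk.support_cons, List.tail_cons, List.nodup_append]
    refine ⟨(T.path_isPath x u).support_nodup, (T.path_isPath v y).support_nodup, ?_⟩
    rintro a ha _ hb rfl
    have e1 := T.vdist_of_mem ha
    have e2 := T.vdist_of_mem hb
    have t1 := T.vdist_triangle x a v
    have t2 := T.vdist_triangle y a u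
    rw [T.vdist_comm v y, T.vdist_comm v a, T.vdist_comm a y] at e2
    rcases T.vdist_adj_alternative h a with h' | h' <;> linarith
  rw [T.vdist_eq_of_isPath hp, T.walkLength_append, ← T.vdist_eq_of_isPath (T.path_isPath x u),
    T.vdist_adj h, add_assoc]
  simp only [vdist, walkLength, SimpleGraph.Walk.edges_cons, List.map_cons, List.sum_cons]

/-- Induction on a walk from `c` to `e`, moving `c` across one edge. If `a`, `b`, `e` lie on the
same side of the edge, all distances from `c` change by the same amount. Otherwise some paths cross
the edge, and `vdist_crossing` splits their lengths there. -/
lemma vdist_four_point (a b c e : V) : T.vdist a b + T.vdist c e ≤ T.vdist a c + T.vdist b e ∨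
    T.vdist a b + T.vdist c e ≤ T.vdist a e + T.vdist b c := by
  obtain ⟨p⟩ := T.isTree.1.preconnected c e
  induction p with
  | nil =>
    left
    rename_i c
    rw [T.vdist_self, T.vdist_comm b c]
    linarith [T.vdist_triangle a c b]
  | @cons u v e h p ih =>
    have hL := T.vdist_pos h
    have c1 := T.vdist_comm u e
    have c2 := T.vdist_comm v e
    have c3 := T.vdist_comm b a
    have c4 := T.vdist_comm e a
    have c5 := T.vdist_comm e b
    have c6 := T.vdist_comm v a
    have c7 := T.vdist_comm v b
    rcases T.vdist_adj_alternative h a with ha | ha <;>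
    rcases T.vdist_adj_alternative h b with hb | hb <;>
    rcases T.vdist_adj_alternative h e with he | he
    · rcases ih with ih | ih
      · left; linarith
      · right; linarith
    · have := T.vdist_triangle a u b
      have := T.vdist_comm u b
      have := T.vdist_crossing h ha he
      have := T.vdist_crossing h hb he
      left; linarith
    · have := T.vdist_crossing h ha hb
      have := T.vdist_crossing h he hb
      left; linarith
    · have := T.vdist_crossing h ha hb
      have := T.vdist_crossing h ha he
      right; linarith
    · have := T.vdist_crossing h hb ha
      have := T.vdist_crossing h he ha
      right; linarith
    · have := T.vdist_crossing h hb ha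
      have := T.vdist_crossing h hb he
      left; linarith
    · have := T.vdist_crossing h he ha
      have := T.vdist_crossing h he hb
      have := T.vdist_triangle a v b
      left; linarith
    · rcases ih with ih | ih
      · left; linarith
      · right; linarith

/-- Converse of `vdist_of_mem`. At each edge of the path, a vertex on the near side must be the near
end, by `vdist_crossing`; any other one is left to the rest of the path. -/
lemma mem_support_of_vdist {a b z : V} {p : T.graph.Walk a b} (hp : p.IsPath)
    (hz : T.vdist a z + T.vdist z b = T.vdist a b) : z ∈ p.support := by
  induction p with
  | nil =>
    rename_i a
    rw [T.vdist_self] at hz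
    have : T.vdist a z = 0 := by linarith [T.vdist_nonneg a z, T.vdist_nonneg z a]
    rw [T.vdist_eq_zero this]
    exact SimpleGraph.Walk.start_mem_support _
  | @cons u v e h p ih =>
    have hL := T.vdist_pos h
    have hue : T.vdist u e = T.vdist u v + T.vdist v e := by
      rw [T.vdist_eq_of_isPath hp, T.vdist_eq_of_isPath hp.of_cons, T.vdist_adj h]
      simp only [walkLength, SimpleGraph.Walk.edges_cons, List.map_cons, List.sum_cons]
    have he : T.vdist e u = T.vdist e v + T.vdist u v := by
      rw [T.vdist_comm e, T.vdist_comm e, hue, add_comm]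
    rw [SimpleGraph.Walk.support_cons, List.mem_cons]
    rcases T.vdist_adj_alternative h z with h' | h'
    · left
      have := T.vdist_crossing h h' he
      rw [T.vdist_comm u z] at hz
      exact T.vdist_eq_zero (by linarith [T.vdist_nonneg z u])
    · right
      refine ih hp.of_cons ?_
      rw [T.vdist_comm u z] at hz
      rw [T.vdist_comm v z]
      linarith

/-! ### The realization is a real tree -/

/-- The image of a prepoint in the realization. -/
noncomputable abbrev point (p : T.PrePoint) : T.Realization := SeparationQuotient.mk p

variable {T}

lemma dist_point (p q : T.PrePoint) : dist (T.point p) (T.point q) = PrePoint.pdist p q :=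
  SeparationQuotient.dist_mk p q

lemma point_flip (p : T.PrePoint) : T.point p.flip = T.point p := by
  obtain ⟨x, hx⟩ := PrePoint.exists_pdist_eq p.flip p
  rw [← dist_eq_zero, dist_point, hx, PrePoint.distVertex_flip, sub_self, abs_zero]

lemma PrePoint.distVertex_nonneg (p : T.PrePoint) (v : V) : 0 ≤ p.distVertex v := by
  have := p.vdist_le_distVertex v v
  rw [T.vdist_self] at this
  linarith

lemma dist_point_vertex (p : T.PrePoint) (v : V) :
    dist (T.point p) (T.vertex v) = p.distVertex v := by
  refine (dist_point p _).trans ?_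
  unfold PrePoint.pdist
  split_ifs with h
  · have hv : p.src = v := by
      have := Sym2.eq_iff.1 h
      tauto
    rw [hv]
    simp only [PrePoint.distVertex, T.vdist_self]
    have := p.distVertex_nonneg v
    simp only [PrePoint.distVertex] at this
    simp [abs_of_nonneg this]
  · simp

lemma dist_vertex (u v : V) : dist (T.vertex u) (T.vertex v) = T.vdist u v := by
  refine (dist_point_vertex _ v).trans ?_
  simp [PrePoint.distVertex]

lemma point_eq_vertex_src {p : T.PrePoint} (h : p.pos = 0) : T.point p = T.vertex p.src := by
  rw [← dist_eq_zero, dist_point_vertex, PrePoint.distVertex_src, h]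

lemma point_eq_vertex_tgt {p : T.PrePoint} (h : p.pos = T.vdist p.src p.tgt) :
    T.point p = T.vertex p.tgt := by
  rw [← dist_eq_zero, dist_point_vertex, PrePoint.distVertex_tgt, h, sub_self]

lemma PrePoint.adj_of_pos {p : T.PrePoint} (h : 0 < p.pos) : T.graph.Adj p.src p.tgt := by
  refine p.eq_or_adj.resolve_left fun e => ?_
  have := p.pos_le
  rw [e, T.vdist_self] at this
  linarith

/-- Seen from a vertex, every point lies in front of a vertex. -/
lemma exists_vertex_behind (z : T.Realization) (v : V) :
    ∃ u, z ∈ geodSegment (T.vertex v) (T.vertex u) := by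
  obtain ⟨p, rfl⟩ := SeparationQuotient.surjective_mk z
  have key : ∀ p : T.PrePoint,
      T.vdist v p.tgt = T.vdist v p.src + T.vdist p.src p.tgt →
      T.point p ∈ geodSegment (T.vertex v) (T.vertex p.tgt) := fun p hp => by
    have h1 : p.distVertex v ≤ p.pos + T.vdist p.src v := min_le_left _ _
    have h2 := dist_triangle (T.vertex v) (T.point p) (T.vertex p.tgt)
    rw [mem_geodSegment]
    rw [dist_comm _ (T.point p), dist_point_vertex, dist_point_vertex, dist_vertex,
      PrePoint.distVertex_tgt] at *
    rw [T.vdist_comm p.src v] at h1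
    linarith
  rcases p.eq_or_adj with h | h
  · refine ⟨p.tgt, key p ?_⟩
    rw [h, T.vdist_self, add_zero]
  · rcases T.vdist_adj_alternative h v with h' | h'
    · exact ⟨p.tgt, key p h'⟩
    · refine ⟨p.src, ?_⟩
      have := key p.flip (by
        simp only [PrePoint.flip]
        rw [h', T.vdist_comm p.tgt p.src])
      rwa [point_flip] at this

/-- Every segment can be extended to a vertex. -/
lemma exists_vertex_beyond (x y : T.Realization) :
    ∃ u, y ∈ geodSegment x (T.vertex u) ∨ x ∈ geodSegment y (T.vertex u) := by
  obtain ⟨p, rfl⟩ := SeparationQuotient.surjective_mk x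
  obtain ⟨q, rfl⟩ := SeparationQuotient.surjective_mk y
  obtain ⟨u, hu⟩ := PrePoint.exists_pdist_eq p q
  refine ⟨u, ?_⟩
  rw [← dist_point, ← dist_point_vertex, ← dist_point_vertex] at hu
  simp only [mem_geodSegment, dist_comm (SeparationQuotient.mk q) (SeparationQuotient.mk p)]
  rcases abs_cases (dist (T.point p) (T.vertex u) - dist (T.point q) (T.vertex u)) with h | h
  · left; linarith
  · right; linarith

lemma exists_point_of_isPath {u v : V} {p : T.graph.Walk u v} (hp : p.IsPath) {t : ℝ} (h0 : 0 ≤ t)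
    (h1 : t ≤ T.vdist u v) : ∃ z, dist (T.vertex u) z = t ∧
      dist z (T.vertex v) = T.vdist u v - t := by
  induction p generalizing t with
  | nil =>
    rw [T.vdist_self] at *
    exact ⟨_, by rw [dist_self]; linarith, by rw [dist_self]; linarith⟩
  | @cons u w v h p ih =>
    have huv : T.vdist u v = T.vdist u w + T.vdist w v := by
      rw [T.vdist_eq_of_isPath hp, T.vdist_eq_of_isPath hp.of_cons, T.vdist_adj h]
      simp only [walkLength, SimpleGraph.Walk.edges_cons, List.map_cons, List.sum_cons]
    rcases le_total t (T.vdist u w) with ht | ht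
    · refine ⟨T.point ⟨u, w, Or.inr h, t, h0, ht⟩, ?_, ?_⟩
      · rw [dist_comm, dist_point_vertex]
        exact PrePoint.distVertex_src ⟨u, w, Or.inr h, t, h0, ht⟩
      · rw [dist_point_vertex]
        simp only [PrePoint.distVertex]
        rw [min_eq_right (by linarith)]
        linarith
    · obtain ⟨z, hz1, hz2⟩ := ih hp.of_cons (t := t - T.vdist u w) (by linarith) (by linarith)
      have t1 := dist_triangle (T.vertex u) (T.vertex w) z
      have t2 := dist_triangle (T.vertex u) z (T.vertex v)
      rw [dist_vertex] at t1 t2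
      exact ⟨z, by linarith, by linarith⟩

/-- Extending `[x, y]` beyond `y` only makes the inequality stronger (`red`), and by
`exists_vertex_beyond` and `exists_vertex_behind` segments can be extended to vertices. With the
symmetries `swap` and `flip` this leads back to four vertices. -/
lemma realization_four_point (x y z w : T.Realization) :
    dist x y + dist z w ≤ dist x z + dist y w ∨ dist x y + dist z w ≤ dist x w + dist y z := by
  have red : ∀ {x y z w u : T.Realization}, y ∈ geodSegment x u →
      (dist x u + dist z w ≤ dist x z + dist u w ∨ dist x u + dist z w ≤ dist x w + dist u z) →
      (dist x y + dist z w ≤ dist x z + dist y w ∨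
        dist x y + dist z w ≤ dist x w + dist y z) := by
    intro x y z w u hy h
    rw [mem_geodSegment] at hy
    have t1 := dist_triangle u y w
    have t2 := dist_triangle u y z
    rw [dist_comm u y] at t1 t2
    rcases h with h | h
    · left; linarith
    · right; linarith
  have swap : ∀ {x y z w : T.Realization},
      (dist x y + dist z w ≤ dist x z + dist y w ∨ dist x y + dist z w ≤ dist x w + dist y z) →
      (dist z w + dist x y ≤ dist z x + dist w y ∨ dist z w + dist x y ≤ dist z y + dist w x) := by
    intro x y z w h
    rw [dist_comm z x, dist_comm w y, dist_comm z y, dist_comm w x]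
    rcases h with h | h
    · left; linarith
    · right; linarith
  have flip : ∀ {x y z w : T.Realization},
      (dist x y + dist z w ≤ dist x z + dist y w ∨ dist x y + dist z w ≤ dist x w + dist y z) →
      (dist y x + dist z w ≤ dist y z + dist x w ∨ dist y x + dist z w ≤ dist y w + dist x z) := by
    intro x y z w h
    rw [dist_comm y x]
    rcases h with h | h
    · right; linarith
    · left; linarith
  have s1 : ∀ (x z : T.Realization) (v w : V),
      dist x (T.vertex v) + dist z (T.vertex w) ≤ dist x z + dist (T.vertex v) (T.vertex w) ∨
      dist x (T.vertex v) + dist z (T.vertex w) ≤ dist x (T.vertex w) + dist (T.vertex v) z := by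
    intro x z v w
    obtain ⟨a, ha⟩ := exists_vertex_behind x v
    obtain ⟨c, hc⟩ := exists_vertex_behind z w
    refine flip (red ha (flip (swap (flip (red hc (flip (swap ?_)))))))
    simp only [dist_vertex]
    exact T.vdist_four_point a v c w
  have s2 : ∀ (x z w : T.Realization) (v : V),
      dist x (T.vertex v) + dist z w ≤ dist x z + dist (T.vertex v) w ∨
      dist x (T.vertex v) + dist z w ≤ dist x w + dist (T.vertex v) z := by
    intro x z w v
    obtain ⟨u, hu | hu⟩ := exists_vertex_beyond z w
    · exact swap (red hu (swap (s1 x z v u)))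
    · exact swap (flip (red hu (swap (s1 x w v u))))
  obtain ⟨u, hu | hu⟩ := exists_vertex_beyond x y
  · exact red hu (s2 x z w u)
  · exact flip (red hu (s2 y z w u))

instance : IsRealTree T.Realization where
  four_point := realization_four_point
  exists_point := by
    have main : ∀ (x y : T.Realization) (u : V), y ∈ geodSegment x (T.vertex u) →
        ∀ t, 0 ≤ t → t ≤ dist x y → ∃ z, dist x z = t ∧ dist z y = dist x y - t := by
      intro x y u hy t h0 h1
      obtain ⟨v, hv⟩ := exists_vertex_behind x u
      rw [mem_geodSegment] at hy hv
      have c1 := dist_comm x (T.vertex u)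
      have c2 := dist_comm x (T.vertex v)
      have n1 := dist_nonneg (x := x) (y := T.vertex v)
      have n2 := dist_nonneg (x := y) (y := T.vertex u)
      rw [dist_vertex] at hv
      -- `[x, y]` lies on the edge path from `v` to `u`, and `x` is at distance `dist x (T.vertex
      -- v)` from its start.
      obtain ⟨z, hz1, hz2⟩ := exists_point_of_isPath (T.path_isPath v u)
        (t := dist x (T.vertex v) + t) (by linarith) (by rw [T.vdist_comm]; linarith)
      rw [T.vdist_comm v u] at hz2
      have c3 := dist_comm z (T.vertex u)
      have c4 := dist_comm z (T.vertex v)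
      have c5 := dist_comm z x
      have c6 := dist_comm z y
      have c7 := dist_comm y (T.vertex u)
      have hxz : dist x z = t := by
        have t1 := dist_triangle (T.vertex v) x z
        rcases realization_four_point (T.vertex v) (T.vertex u) x z with h | h <;>
          rw [dist_vertex, T.vdist_comm v u] at h <;> linarith
      refine ⟨z, hxz, ?_⟩
      have t2 := dist_triangle x z y
      rcases realization_four_point x (T.vertex u) z y with h | h <;> linarith
    intro x y t h0 h1
    obtain ⟨u, hu | hu⟩ := exists_vertex_beyond x y
    · exact main x y u hu t h0 h1
    · obtain ⟨z, hz1, hz2⟩ := main y x u hu (dist x y - t) (by linarith)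
        (by rw [dist_comm y x]; linarith)
      refine ⟨z, ?_, ?_⟩
      · rw [dist_comm, hz2, dist_comm y x]
        ring
      · rw [dist_comm, hz1]

/-! ### Branch points and directions -/

lemma exists_vertices_of_segment (x y : T.Realization) :
    ∃ u v, geodSegment x y ⊆ geodSegment (T.vertex u) (T.vertex v) := by
  have main : ∀ (x y : T.Realization) (u : V), y ∈ geodSegment x (T.vertex u) →
      ∃ u v, geodSegment x y ⊆ geodSegment (T.vertex u) (T.vertex v) := by
    intro x y u hy
    obtain ⟨v, hv⟩ := exists_vertex_behind x u
    refine ⟨u, v, fun z hz => ?_⟩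
    simp only [mem_geodSegment] at *
    have t1 := dist_triangle (T.vertex u) z (T.vertex v)
    have t2 := dist_triangle (T.vertex u) y z
    have t3 := dist_triangle z x (T.vertex v)
    have c1 := dist_comm x (T.vertex u)
    have c2 := dist_comm y (T.vertex u)
    have c3 := dist_comm x z
    have c4 := dist_comm y z
    linarith
  obtain ⟨u, hu | hu⟩ := exists_vertex_beyond x y
  · exact main x y u hu
  · rw [geodSegment_comm]
    exact main y x u hu

lemma mem_support_of_vertex_mem {u v z : V} {p : T.graph.Walk u v} (hp : p.IsPath)
    (h : T.vertex z ∈ geodSegment (T.vertex u) (T.vertex v)) : z ∈ p.support := by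
  rw [mem_geodSegment, dist_vertex, dist_vertex, dist_vertex] at h
  exact T.mem_support_of_vdist hp h

lemma finite_vertices_of_segment (x y : T.Realization) :
    {z | z ∈ geodSegment x y ∧ z ∈ Set.range T.vertex}.Finite := by
  obtain ⟨u, v, huv⟩ := exists_vertices_of_segment x y
  refine (((T.path u v).support.finite_toSet).image T.vertex).subset ?_
  rintro _ ⟨hz, w, rfl⟩
  exact ⟨w, mem_support_of_vertex_mem (T.path_isPath u v) (huv hz), rfl⟩

/-- The point `p` has finitely many directions, represented by the points of `N`. -/
def _root_.IsDirectionSet {Y : Type*} [MetricSpace Y] (N : Set Y) (p : Y) : Prop :=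
  ∀ y, y ≠ p → ∃ n ∈ N, p ∉ geodSegment n y

/-- A point hidden behind `p` from both ends of the edge would have distances to these ends that
differ by `2 * p.pos - L`, where `L` is the length of the edge. Off the edge the difference is `L`
or `-L`; on the edge the two distances add up to only `L`. -/
lemma isDirectionSet_of_not_vertex {p : T.PrePoint} (h0 : 0 < p.pos)
    (h1 : p.pos < T.vdist p.src p.tgt) :
    IsDirectionSet {T.vertex p.src, T.vertex p.tgt} (T.point p) := by
  intro y hy
  obtain ⟨r, rfl⟩ := SeparationQuotient.surjective_mk y
  by_contra! hcon
  have e1 := mem_geodSegment.1 (hcon (T.vertex p.src) (by simp))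
  have e2 := mem_geodSegment.1 (hcon (T.vertex p.tgt) (by simp))
  have hd := dist_pos.2 hy
  rw [dist_comm, dist_point_vertex, PrePoint.distVertex_src,
    dist_comm (T.vertex p.src), dist_point_vertex, dist_comm] at e1
  rw [dist_comm, dist_point_vertex, PrePoint.distVertex_tgt,
    dist_comm (T.vertex p.tgt), dist_point_vertex, dist_comm] at e2
  by_cases he : s(r.src, r.tgt) = s(p.src, p.tgt)
  · have hr1 := r.distVertex_src
    have hr2 := r.distVertex_tgt
    rcases Sym2.eq_iff.1 he with ⟨h2, h3⟩ | ⟨h2, h3⟩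
    · rw [h2] at hr1 hr2
      rw [h3] at hr2
      linarith
    · rw [h2] at hr1 hr2
      rw [h3] at hr2
      rw [T.vdist_comm p.tgt] at hr2
      linarith
  · rcases r.distVertex_adj (PrePoint.adj_of_pos h0) he with h | h <;> linarith

lemma isDirectionSet_vertex (v : V) :
    IsDirectionSet (T.vertex '' T.graph.neighborSet v) (T.vertex v) := by
  intro y hy
  obtain ⟨x, hx⟩ := exists_vertex_behind y v
  have hvx := mem_geodSegment.1 hx
  have hne : x ≠ v := by
    rintro rfl
    rw [dist_self, dist_comm] at hvx
    exact hy (dist_le_zero.1 (by linarith [dist_nonneg (x := y) (y := T.vertex x)]))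
  cases hp : T.path v x with
  | nil => exact absurd rfl hne
  | @cons _ n _ h p =>
    have hpath := T.path_isPath v x
    have hvn : T.vdist v x = T.vdist v n + T.vdist n x := by
      rw [T.vdist_eq_of_isPath hpath, hp]
      rw [hp] at hpath
      rw [T.vdist_eq_of_isPath hpath.of_cons, T.vdist_adj h]
      simp only [walkLength, SimpleGraph.Walk.edges_cons, List.map_cons, List.sum_cons]
    refine ⟨_, ⟨n, h, rfl⟩, fun hcon => ?_⟩
    have := dist_concat hcon hx hy.symm
    rw [dist_vertex] at this hvx
    rw [dist_vertex, T.vdist_comm n v] at this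
    linarith [T.vdist_pos h]

lemma exists_finite_directionSet (hT : T.IsLocallyFinite) (p : T.Realization) :
    ∃ N, N.Finite ∧ IsDirectionSet N p := by
  obtain ⟨p, rfl⟩ := SeparationQuotient.surjective_mk p
  rcases p.pos_nonneg.eq_or_lt with h0 | h0
  · exact ⟨_, (hT p.src).image _, by
      change IsDirectionSet _ (T.point p)
      rw [point_eq_vertex_src h0.symm]
      exact isDirectionSet_vertex _⟩
  · rcases p.pos_le.eq_or_lt with h1 | h1
    · exact ⟨_, (hT p.tgt).image _, by
        change IsDirectionSet _ (T.point p)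
        rw [point_eq_vertex_tgt h1]
        exact isDirectionSet_vertex _⟩
    · exact ⟨_, by simp, isDirectionSet_of_not_vertex h0 h1⟩

/-- Pigeonhole: an interior point of an edge has two directions, so two of any three points lie in
the same one and are not separated. -/
lemma mem_range_vertex_of_isBranchPoint {z : T.Realization} (hz : IsBranchPoint z) :
    z ∈ Set.range T.vertex := by
  obtain ⟨p, rfl⟩ := SeparationQuotient.surjective_mk z
  rcases p.pos_nonneg.eq_or_lt with h0 | h0
  · exact ⟨_, (point_eq_vertex_src h0.symm).symm⟩
  rcases p.pos_le.eq_or_lt with h1 | h1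
  · exact ⟨_, (point_eq_vertex_tgt h1).symm⟩
  exfalso
  have hN := isDirectionSet_of_not_vertex h0 h1
  obtain ⟨x, y, z, hx, hy, hz, hxy, hyz, hxz⟩ := hz
  have same : ∀ {n x y : T.Realization}, T.point p ∉ geodSegment n x →
      T.point p ∉ geodSegment n y → T.point p ∈ geodSegment x y → False := by
    intro n x y h1 h2 h3
    rcases mem_geodSegment_or_mem_geodSegment (y := n) h3 with h4 | h4
    · rw [geodSegment_comm] at h4
      exact h1 h4
    · exact h2 h4
  obtain ⟨n1, hn1, h1⟩ := hN x hx
  obtain ⟨n2, hn2, h2⟩ := hN y hy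
  obtain ⟨n3, hn3, h3⟩ := hN z hz
  rcases hn1 with rfl | rfl <;> rcases hn2 with rfl | rfl <;> rcases hn3 with rfl | rfl
  all_goals first
    | exact same h1 h2 hxy
    | exact same h2 h3 hyz
    | exact same h1 h3 hxz

lemma hasFiniteBranching : HasFiniteBranching T.Realization := fun x y =>
  (finite_vertices_of_segment x y).subset fun _ hz =>
    ⟨hz.1, mem_range_vertex_of_isBranchPoint hz.2⟩

/-! ### Elliptic elements of a discrete group have finite order -/

/-- Let `h` be a power of `g` that fixes `y`. Two of the points `hⁱ z` lie in the same direction at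
`y`, so some power `f` of `h` keeps `z` in its direction. If `f z ≠ z`, the segments `[y, z]` and
`[y, f z]` would fork strictly inside `[y, z]`, at a branch point. -/
lemma _root_.exists_pow_apply_eq_of_directionSet {Y : Type*} [MetricSpace Y] [IsRealTree Y]
    {g : Y ≃ᵢ Y} {y z : Y} {N : Set Y} (hN : N.Finite) (hd : IsDirectionSet N y)
    (hy : ∃ n, 0 < n ∧ (g ^ n) y = y)
    (hb : ∀ c ∈ geodSegment y z, c ≠ y → c ≠ z → ¬ IsBranchPoint c) :
    ∃ n, 0 < n ∧ (g ^ n) z = z := by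
  by_cases hzy : z = y
  · rwa [hzy]
  obtain ⟨m, hm, hmy⟩ := hy
  set h := g ^ m with hh
  have hfix : ∀ i : ℕ, (h ^ i) y = y := fun i => by
    induction i with
    | zero => simp
    | succ i ih => rw [pow_succ, IsometryEquiv.mul_apply, hmy, ih]
  have hne : ∀ i : ℕ, (h ^ i) z ≠ y := fun i e => by
    conv_rhs at e => rw [← hfix i]
    exact hzy ((h ^ i).injective e)
  choose n hn hny using fun i : ℕ => hd _ (hne i)
  have : Finite N := hN
  obtain ⟨i, j, hij, hnij⟩ := Finite.exists_ne_map_eq_of_infinite fun i => (⟨n i, hn i⟩ : N)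
  rw [Subtype.mk.injEq] at hnij
  wlog hlt : i < j generalizing i j
  · exact this j i hij.symm hnij.symm (lt_of_le_of_ne (not_lt.1 hlt) hij.symm)
  obtain ⟨k, rfl⟩ := Nat.exists_eq_add_of_lt hlt
  set f := h ^ (k + 1) with hf
  have hfy : f y = y := hfix _
  have e : (h ^ (i + k + 1)) z = (h ^ i) (f z) := by
    rw [hf, add_assoc, pow_add, IsometryEquiv.mul_apply]
  have hnot : y ∉ geodSegment z (f z) := by
    rw [← apply_mem_geodSegment (h ^ i), hfix, ← e]
    intro hcon
    rcases mem_geodSegment_or_mem_geodSegment (y := n i) hcon with h1 | h1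
    · rw [geodSegment_comm] at h1
      exact hny i h1
    · rw [hnij] at h1
      exact hny _ h1
  obtain ⟨c, hc1, hc2, hc3⟩ := exists_median y z (f z)
  have hcy : c ≠ y := fun h => hnot (h ▸ hc3)
  have hfz : dist y (f z) = dist y z := by
    conv_lhs => rw [← hfy, f.dist_eq]
  refine ⟨m * (k + 1), by positivity, ?_⟩
  rw [pow_mul, ← hh, ← hf]
  have huniq : f z ∈ geodSegment y z ∨ z ∈ geodSegment y (f z) → f z = z := by
    rintro (h1 | h1)
    · exact geodSegment_point_unique h1 (right_mem_geodSegment y z) hfz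
    · exact (geodSegment_point_unique h1 (right_mem_geodSegment y (f z)) hfz.symm).symm
  by_contra hcon
  have hcz : c ≠ z := fun h => hcon (huniq (Or.inr (h ▸ hc2)))
  have hcfz : c ≠ f z := fun h => hcon (huniq (Or.inl (h ▸ hc1)))
  exact hb c hc1 hcy hcz ⟨y, z, f z, hcy.symm, hcz.symm, hcfz.symm, hc1, hc3, hc2⟩

/-- Periodicity spreads from the fixed point to an end of its edge and from there along edges:
branch points are vertices, and there are none inside an edge. -/
lemma exists_pow_apply_vertex_eq (hT : T.IsLocallyFinite) {g : T.Aut} (hg : IsElliptic g) (v : V) :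
    ∃ n, 0 < n ∧ (g ^ n) (T.vertex v) = T.vertex v := by
  have edge : ∀ {u v w : V}, T.graph.Adj u v →
      T.vertex w ∈ geodSegment (T.vertex u) (T.vertex v) → w = u ∨ w = v := by
    intro u v w h hw
    have hp : (SimpleGraph.Walk.cons h SimpleGraph.Walk.nil).IsPath := by
      simp [SimpleGraph.Walk.cons_isPath_iff, h.ne]
    simpa using mem_support_of_vertex_mem hp hw
  have step : ∀ {u v : V}, T.graph.Adj u v →
      (∃ n, 0 < n ∧ (g ^ n) (T.vertex u) = T.vertex u) →
      ∃ n, 0 < n ∧ (g ^ n) (T.vertex v) = T.vertex v := by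
    intro u v h hu
    obtain ⟨N, hN, hd⟩ := exists_finite_directionSet hT (T.vertex u)
    refine exists_pow_apply_eq_of_directionSet hN hd hu fun c hc h1 h2 hb => ?_
    obtain ⟨w, rfl⟩ := mem_range_vertex_of_isBranchPoint hb
    rcases edge h hc with rfl | rfl
    · exact h1 rfl
    · exact h2 rfl
  have start : ∃ u, ∃ n, 0 < n ∧ (g ^ n) (T.vertex u) = T.vertex u := by
    obtain ⟨x, hx⟩ := hg
    obtain ⟨p, rfl⟩ := SeparationQuotient.surjective_mk x
    have hx1 : ∃ n, 0 < n ∧ (g ^ n) (T.point p) = T.point p := ⟨1, one_pos, by rwa [pow_one]⟩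
    rcases p.pos_nonneg.eq_or_lt with h0 | h0
    · exact ⟨p.src, by rwa [← point_eq_vertex_src h0.symm]⟩
    refine ⟨p.src, ?_⟩
    obtain ⟨N, hN, hd⟩ := exists_finite_directionSet hT (T.point p)
    refine exists_pow_apply_eq_of_directionSet hN hd hx1 fun c hc h1 h2 hb => ?_
    obtain ⟨w, rfl⟩ := mem_range_vertex_of_isBranchPoint hb
    have hadj := PrePoint.adj_of_pos h0
    have hL := T.vdist_pos hadj
    rw [mem_geodSegment, dist_point_vertex p p.src, PrePoint.distVertex_src, dist_vertex] at hc
    have hpt := dist_point_vertex p p.tgt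
    rw [PrePoint.distVertex_tgt] at hpt
    have hle := p.pos_le
    have hpos := dist_pos.2 h1.symm
    have t1 := dist_triangle (T.vertex w) (T.point p) (T.vertex p.tgt)
    rw [dist_comm, dist_vertex] at t1
    have t2 := T.vdist_triangle p.tgt w p.src
    rw [dist_comm (T.vertex w)] at t1
    have c1 := T.vdist_comm p.tgt p.src
    rcases edge hadj.symm (w := w) (by
        rw [mem_geodSegment, dist_vertex, dist_vertex, dist_vertex]; linarith) with rfl | rfl
    · linarith
    · exact h2 rfl
  obtain ⟨u, hu⟩ := start
  obtain ⟨p⟩ := T.isTree.1.preconnected u v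
  induction p with
  | nil => exact hu
  | cons h p ih => exact ih (step h hu)

/-- One power of `g` fixes all of the finitely many vertices of a subtree with trivial stabilizer,
so this power is trivial. -/
lemma isOfFinOrder_of_isElliptic (hT : T.IsLocallyFinite) {Γ : Subgroup T.Aut}
    (hΓ : T.IsDiscrete Γ) {g : T.Aut} (hg : g ∈ Γ) (he : IsElliptic g) : IsOfFinOrder g := by
  obtain ⟨S, hS, -, hstab⟩ := hΓ
  have hpow : ∀ (n k : ℕ) (x : T.Realization), (g ^ n) x = x → (g ^ (n * k)) x = x := by
    intro n k x hx
    induction k with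
    | zero => simp
    | succ k ih => rw [Nat.mul_succ, pow_add, IsometryEquiv.mul_apply, hx, ih]
  have hall : ∃ n, 0 < n ∧ ∀ v ∈ S.verts, (g ^ n) (T.vertex v) = T.vertex v := by
    refine Set.Finite.induction_on (motive := fun s _ =>
      ∃ n, 0 < n ∧ ∀ v ∈ s, (g ^ n) (T.vertex v) = T.vertex v) _ hS ⟨1, one_pos, by simp⟩ ?_
    rintro v s - - ⟨n, hn, hns⟩
    obtain ⟨m, hm, hmv⟩ := exists_pow_apply_vertex_eq hT he v
    refine ⟨n * m, Nat.mul_pos hn hm, ?_⟩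
    rintro w (rfl | hw)
    · rw [mul_comm]
      exact hpow m n _ hmv
    · exact hpow n m _ (hns w hw)
  obtain ⟨n, hn, h⟩ := hall
  exact isOfFinOrder_iff_pow_eq_one.2 ⟨n, hn, hstab _ (Γ.pow_mem hg n) h⟩

end WeightedTree

/-! ### Arithmetic of the Euclidean algorithm -/

section Euclid

variable {m₁ m₂ : ℝ}

lemma euclidSeq_add_two {i : ℕ} (hi : 1 ≤ i) :
    euclidSeq m₁ m₂ (i + 2) =
      euclidSeq m₁ m₂ i - euclidQuot m₁ m₂ i * euclidSeq m₁ m₂ (i + 1) := by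
  obtain ⟨i, rfl⟩ := Nat.exists_eq_add_of_le' hi
  rfl

lemma euclidGen_add_two {G : Type*} [Group G] {γ₁ γ₂ : G} {i : ℕ} (hi : 1 ≤ i) :
    euclidGen m₁ m₂ γ₁ γ₂ (i + 2) =
      euclidGen m₁ m₂ γ₁ γ₂ i * euclidGen m₁ m₂ γ₁ γ₂ (i + 1) ^ (-euclidQuot m₁ m₂ i) := by
  obtain ⟨i, rfl⟩ := Nat.exists_eq_add_of_le' hi
  rfl

lemma euclidQuot_mul_le {i : ℕ} (h : 0 < euclidSeq m₁ m₂ (i + 1)) :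
    euclidQuot m₁ m₂ i * euclidSeq m₁ m₂ (i + 1) ≤ euclidSeq m₁ m₂ i := by
  rw [← le_div_iff₀ h]
  exact Int.floor_le _

lemma euclidSeq_add_two_nonneg {i : ℕ} (hi : 1 ≤ i) (h : 0 < euclidSeq m₁ m₂ (i + 1)) :
    0 ≤ euclidSeq m₁ m₂ (i + 2) := by
  rw [euclidSeq_add_two hi]
  linarith [euclidQuot_mul_le h]

lemma euclidSeq_add_two_lt {i : ℕ} (hi : 1 ≤ i) (h : 0 < euclidSeq m₁ m₂ (i + 1)) :
    euclidSeq m₁ m₂ (i + 2) < euclidSeq m₁ m₂ (i + 1) := by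
  have := Int.lt_floor_add_one (euclidSeq m₁ m₂ i / euclidSeq m₁ m₂ (i + 1))
  rw [div_lt_iff₀ h] at this
  rw [euclidSeq_add_two hi, euclidQuot]
  linarith

lemma euclidSeq_succ_le (hm : m₂ ≤ m₁) {i : ℕ} (hi : 1 ≤ i) (h : 0 < euclidSeq m₁ m₂ i) :
    euclidSeq m₁ m₂ (i + 1) ≤ euclidSeq m₁ m₂ i := by
  rcases hi.eq_or_lt with rfl | hi'
  · exact hm
  · obtain ⟨j, rfl⟩ := Nat.exists_eq_add_of_lt hi'
    rw [show 1 + j + 1 = (1 + j) + 1 from rfl] at *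
    exact (euclidSeq_add_two_lt (by omega) h).le

lemma one_le_euclidQuot (hm : m₂ ≤ m₁) {i : ℕ} (hi : 1 ≤ i) (h : 0 < euclidSeq m₁ m₂ i)
    (h' : 0 < euclidSeq m₁ m₂ (i + 1)) : 1 ≤ euclidQuot m₁ m₂ i := by
  rw [euclidQuot, Int.le_floor, Int.cast_one, le_div_iff₀ h', one_mul]
  exact euclidSeq_succ_le hm hi h

/-- The left end of the first window with index `j`. -/
noncomputable def windowStart (m₁ m₂ : ℝ) (j : ℕ) : ℝ :=
  m₁ + m₂ - euclidSeq m₁ m₂ j - euclidSeq m₁ m₂ (j + 1)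

lemma windowStart_one : windowStart m₁ m₂ 1 = 0 := by
  simp only [windowStart, euclidSeq]
  ring

/-- The `q_j` windows with index `j`, each of length `m_{j+1}`, fill the interval between
consecutive starts. All windows together thus tile a half-open interval from `0`, which gives
existence and uniqueness. -/
lemma windowStart_succ {j : ℕ} (hj : 1 ≤ j) : windowStart m₁ m₂ (j + 1) =
    windowStart m₁ m₂ j + euclidQuot m₁ m₂ j * euclidSeq m₁ m₂ (j + 1) := by
  simp only [windowStart, euclidSeq_add_two hj]
  ring

lemma inWindow_iff {l : ℝ} {j : ℕ} {q : ℤ} : InWindow m₁ m₂ l j q ↔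
    1 ≤ j ∧ 0 ≤ q ∧ q ≤ euclidQuot m₁ m₂ j - 1 ∧
      windowStart m₁ m₂ j + q * euclidSeq m₁ m₂ (j + 1) < l ∧
      l ≤ windowStart m₁ m₂ j + (q + 1) * euclidSeq m₁ m₂ (j + 1) := by
  rw [InWindow, windowStart]
  have e1 : m₁ + m₂ - euclidSeq m₁ m₂ j + (q - 1) * euclidSeq m₁ m₂ (j + 1) =
    m₁ + m₂ - euclidSeq m₁ m₂ j - euclidSeq m₁ m₂ (j + 1) + q * euclidSeq m₁ m₂ (j + 1) := by ring
  have e2 : m₁ + m₂ - euclidSeq m₁ m₂ j + q * euclidSeq m₁ m₂ (j + 1) =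
    m₁ + m₂ - euclidSeq m₁ m₂ j - euclidSeq m₁ m₂ (j + 1) +
      (q + 1) * euclidSeq m₁ m₂ (j + 1) := by ring
  rw [e1, e2]

lemma windowStart_mono (hm : m₂ ≤ m₁) {i j : ℕ} (hi : 1 ≤ i) (hij : i ≤ j)
    (h : ∀ n, 1 ≤ n → n ≤ j → 0 < euclidSeq m₁ m₂ n) :
    windowStart m₁ m₂ i ≤ windowStart m₁ m₂ j := by
  induction j, hij using Nat.le_induction with
  | base => exact le_rfl
  | succ j hj ih =>
    refine (ih fun n h1 h2 => h n h1 (by omega)).trans ?_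
    have h1 := h (j + 1) (by omega) le_rfl
    have h2 := one_le_euclidQuot hm (by omega) (h j (by omega) (by omega)) h1
    rw [windowStart_succ (by omega)]
    have h3 : (1 : ℝ) ≤ euclidQuot m₁ m₂ j := by exact_mod_cast h2
    nlinarith

lemma InWindow.unique (hm : m₂ ≤ m₁) {l : ℝ} {j j' : ℕ} {q q' : ℤ} (h : InWindow m₁ m₂ l j q)
    (h' : InWindow m₁ m₂ l j' q')
    (hpos : ∀ n, 1 ≤ n → n ≤ max j j' + 1 → 0 < euclidSeq m₁ m₂ n) : j = j' ∧ q = q' := by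
  wlog hle : j < j' ∨ (j = j' ∧ q ≤ q') generalizing j j' q q'
  · have := this h' h (by rwa [max_comm]) (by omega)
    exact ⟨this.1.symm, this.2.symm⟩
  rw [inWindow_iff] at h h'
  obtain ⟨h1, h2, h3, h4, h5⟩ := h
  obtain ⟨h1', h2', h3', h4', h5'⟩ := h'
  have hp := hpos (j + 1) (by omega) (by omega)
  have hp' := hpos (j' + 1) (by omega) (by omega)
  rcases hle with hlt | ⟨rfl, hq⟩
  · exfalso
    have e1 := windowStart_mono hm (i := j + 1) (j := j') (by omega) hlt
      fun n hn hn' => hpos n hn (by omega)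
    rw [windowStart_succ h1] at e1
    have e2 : (q : ℝ) + 1 ≤ euclidQuot m₁ m₂ j := by
      have : q + 1 ≤ euclidQuot m₁ m₂ j := by omega
      exact_mod_cast this
    have e3 : (0 : ℝ) ≤ q' := by exact_mod_cast h2'
    nlinarith [mul_le_mul_of_nonneg_right e2 hp.le, mul_nonneg e3 hp'.le]
  · refine ⟨rfl, ?_⟩
    by_contra hne
    have e1 : (q : ℝ) + 1 ≤ q' := by
      have : q + 1 ≤ q' := by omega
      exact_mod_cast this
    nlinarith [mul_le_mul_of_nonneg_right e1 hp.le]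

lemma exists_inWindow {l : ℝ} (hl : 0 < l) {k : ℕ} (hk : 1 ≤ k)
    (hpos : ∀ n, 1 ≤ n → n ≤ k → 0 < euclidSeq m₁ m₂ n) (hlk : l ≤ windowStart m₁ m₂ k) :
    ∃ j q, j ≤ k - 1 ∧ InWindow m₁ m₂ l j q := by
  classical
  have hex : ∃ j, l ≤ windowStart m₁ m₂ (j + 1) := ⟨k - 1, by rwa [Nat.sub_add_cancel hk]⟩
  set j := Nat.find hex with hj
  have h1 : l ≤ windowStart m₁ m₂ (j + 1) := Nat.find_spec hex
  have hjk : j ≤ k - 1 := Nat.find_min' hex (by rwa [Nat.sub_add_cancel hk])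
  have hj1 : 1 ≤ j := by
    by_contra hcon
    have : j = 0 := by omega
    rw [this, zero_add, windowStart_one] at h1
    linarith
  have h2 : windowStart m₁ m₂ j < l := by
    have := Nat.find_min hex (m := j - 1) (by omega)
    rw [Nat.sub_add_cancel hj1] at this
    exact not_le.1 this
  have hp := hpos (j + 1) (by omega) (by omega)
  set x := (l - windowStart m₁ m₂ j) / euclidSeq m₁ m₂ (j + 1) with hx
  have hxe : l = windowStart m₁ m₂ j + x * euclidSeq m₁ m₂ (j + 1) := by
    rw [hx, div_mul_cancel₀ _ hp.ne']
    ring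
  have hx0 : 0 < x := div_pos (by linarith) hp
  -- Windows are open on the left and closed on the right, so `q` is determined by `q < x ≤ q + 1`.
  refine ⟨j, ⌈x⌉ - 1, hjk, inWindow_iff.2 ⟨hj1, ?_, ?_, ?_, ?_⟩⟩
  · have := Int.ceil_pos.2 hx0
    omega
  · rw [windowStart_succ hj1] at h1
    have : x ≤ euclidQuot m₁ m₂ j := by
      rw [hx, div_le_iff₀ hp]
      linarith
    have := Int.ceil_le.2 this
    omega
  · conv_rhs => rw [hxe]
    have := Int.ceil_lt_add_one x
    push_cast
    nlinarith
  · conv_lhs => rw [hxe]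
    have := Int.le_ceil x
    push_cast
    nlinarith

/-- As `q_i ≥ 1`, `m_{i+2}` is at most `m_i - m_{i+1}`; it is also less than `m_{i+1}`. So the
sequence is at least halved every two steps. -/
lemma euclidSeq_tendsto_zero (hm : m₂ ≤ m₁) (hpos : ∀ n, 1 ≤ n → 0 < euclidSeq m₁ m₂ n) {ε : ℝ}
    (hε : 0 < ε) : ∃ k, 1 ≤ k ∧ euclidSeq m₁ m₂ k + euclidSeq m₁ m₂ (k + 1) < ε := by
  have half : ∀ n, euclidSeq m₁ m₂ (1 + 2 * n) ≤ m₁ * (1 / 2) ^ n := by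
    intro n
    induction n with
    | zero => simp [euclidSeq]
    | succ n ih =>
      have h1 : 1 ≤ 1 + 2 * n := by omega
      have h2 := hpos _ h1
      have h3 := hpos (1 + 2 * n + 1) (by omega)
      have h4 : (1 : ℝ) ≤ euclidQuot m₁ m₂ (1 + 2 * n) := by
        exact_mod_cast one_le_euclidQuot hm h1 h2 h3
      have h5 := euclidSeq_add_two (m₁ := m₁) (m₂ := m₂) h1
      have h6 := euclidSeq_add_two_lt (m₁ := m₁) (m₂ := m₂) h1 h3
      have e : 1 + 2 * (n + 1) = 1 + 2 * n + 2 := by ring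
      rw [e, pow_succ]
      nlinarith
  have hm1 : 0 < m₁ := hpos 1 le_rfl
  obtain ⟨n, hn⟩ := exists_pow_lt_of_lt_one (show 0 < ε / (2 * m₁) by positivity)
    (show (1 / 2 : ℝ) < 1 by norm_num)
  refine ⟨1 + 2 * n, by omega, ?_⟩
  rw [lt_div_iff₀ (by positivity)] at hn
  have h1 := half n
  have h2 := euclidSeq_succ_le hm (i := 1 + 2 * n) (by omega) (hpos _ (by omega))
  nlinarith

/-- The next ratio is the inverse of the previous one minus an integer, so ratios remain irrational
and never vanish. -/
lemma euclidSeq_pos_of_irrational (h2 : 0 < m₂) (h1 : 0 < m₁) (hirr : Irrational (m₂ / m₁)) :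
    ∀ i, 1 ≤ i → 0 < euclidSeq m₁ m₂ i := by
  have key : ∀ i, 1 ≤ i → 0 < euclidSeq m₁ m₂ i ∧ 0 < euclidSeq m₁ m₂ (i + 1) ∧
      Irrational (euclidSeq m₁ m₂ (i + 1) / euclidSeq m₁ m₂ i) := by
    intro i hi
    induction i, hi using Nat.le_induction with
    | base => exact ⟨h1, h2, hirr⟩
    | succ i hi ih =>
      obtain ⟨a, b, c⟩ := ih
      have e : euclidSeq m₁ m₂ (i + 2) / euclidSeq m₁ m₂ (i + 1) =
          (euclidSeq m₁ m₂ (i + 1) / euclidSeq m₁ m₂ i)⁻¹ - euclidQuot m₁ m₂ i := by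
        rw [euclidSeq_add_two hi, inv_div, sub_div, mul_div_cancel_right₀ _ b.ne']
      have hir : Irrational (euclidSeq m₁ m₂ (i + 2) / euclidSeq m₁ m₂ (i + 1)) := by
        rw [e]
        exact c.inv.sub_intCast _
      refine ⟨b, lt_of_le_of_ne (euclidSeq_add_two_nonneg hi b) fun h0 => hir.ne_zero ?_, hir⟩
      change 0 = euclidSeq m₁ m₂ (i + 2) at h0
      rw [← h0, zero_div]
  exact fun i hi => (key i hi).1

lemma euclidSeq_eq_int_mul {d : ℝ} (h1 : ∃ a : ℤ, m₁ = a * d) (h2 : ∃ b : ℤ, m₂ = b * d) :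
    ∀ i, 1 ≤ i → ∃ a : ℤ, euclidSeq m₁ m₂ i = a * d := by
  have key : ∀ i, 1 ≤ i → (∃ a : ℤ, euclidSeq m₁ m₂ i = a * d) ∧
      ∃ a : ℤ, euclidSeq m₁ m₂ (i + 1) = a * d := by
    intro i hi
    induction i, hi using Nat.le_induction with
    | base => exact ⟨h1, h2⟩
    | succ i hi ih =>
      obtain ⟨⟨a, ha⟩, b, hb⟩ := ih
      refine ⟨⟨b, hb⟩, a - euclidQuot m₁ m₂ i * b, ?_⟩
      rw [show i + 1 + 1 = i + 2 from rfl, euclidSeq_add_two hi, ha, hb]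
      push_cast
      ring
  exact fun i hi => (key i hi).1

lemma exists_euclidSeq_eq_zero (hm : m₂ ≤ m₁) (h2 : 0 < m₂)
    (hrat : m₂ / m₁ ∈ Set.range ((↑) : ℚ → ℝ)) :
    ∃ k : ℕ, 2 ≤ k ∧ (∀ i, 1 ≤ i → i ≤ k → 0 < euclidSeq m₁ m₂ i) ∧
      euclidSeq m₁ m₂ (k + 1) = 0 := by
  classical
  have h1 : 0 < m₁ := h2.trans_le hm
  have hex : ∃ i, 1 ≤ i ∧ ¬ 0 < euclidSeq m₁ m₂ i := by
    by_contra! hcon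
    obtain ⟨r, hr⟩ := hrat
    have hden : (0 : ℝ) < r.den := by exact_mod_cast r.den_pos
    -- A common divisor of `m₁` and `m₂`. All terms are integer multiples of it, so they cannot be
    -- positive and tend to zero.
    set d := m₁ / r.den with hd
    have hd0 : 0 < d := div_pos h1 hden
    have e1 : m₁ = ((r.den : ℤ) : ℝ) * d := by
      rw [hd]
      push_cast
      field_simp
    have e2 : m₂ = (r.num : ℝ) * d := by
      have h3 : m₂ = r * m₁ := by rw [hr, div_mul_cancel₀ _ h1.ne']
      rw [h3, hd, Rat.cast_def]
      ring
    obtain ⟨k, hk, hlt⟩ := euclidSeq_tendsto_zero hm hcon hd0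
    obtain ⟨a, ha⟩ := euclidSeq_eq_int_mul ⟨_, e1⟩ ⟨_, e2⟩ k hk
    have h4 := hcon k hk
    have h5 := hcon (k + 1) (by omega)
    rw [ha] at h4 hlt
    have h6 : (0 : ℝ) < a := pos_of_mul_pos_left h4 hd0.le
    have h7 : (1 : ℝ) ≤ a := by
      have : 0 < a := by exact_mod_cast h6
      exact_mod_cast this
    nlinarith
  obtain ⟨hi1, hi2⟩ := Nat.find_spec hex
  have hmin : ∀ j, 1 ≤ j → j < Nat.find hex → 0 < euclidSeq m₁ m₂ j := fun j hj hlt => by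
    by_contra hcon
    exact Nat.find_min hex hlt ⟨hj, hcon⟩
  set i := Nat.find hex with hidef
  have hi3 : 3 ≤ i := by
    by_contra hcon
    have : i = 1 ∨ i = 2 := by omega
    rcases this with h | h <;> rw [h] at hi2
    · exact hi2 h1
    · exact hi2 h2
  obtain ⟨k, hk⟩ := Nat.exists_eq_add_of_le' hi3
  refine ⟨k + 2, by omega, fun j h3 h4 => hmin j h3 (by omega), ?_⟩
  rw [hk] at hi2
  have h5 := euclidSeq_add_two_nonneg (m₁ := m₁) (m₂ := m₂) (i := k + 1) (by omega)
    (hmin (k + 1 + 1) (by omega) (by omega))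
  exact le_antisymm (not_lt.1 hi2) h5

lemma isGreatest_commonDivisors {k : ℕ} (hk : 1 ≤ k) (hpos : 0 < euclidSeq m₁ m₂ k)
    (hz : euclidSeq m₁ m₂ (k + 1) = 0) :
    IsGreatest (commonDivisors m₁ m₂) (euclidSeq m₁ m₂ k) := by
  constructor
  · have key : ∀ n, n + 1 ≤ k → (∃ a : ℤ, euclidSeq m₁ m₂ (k - n) = a * euclidSeq m₁ m₂ k) ∧
        ∃ a : ℤ, euclidSeq m₁ m₂ (k - n + 1) = a * euclidSeq m₁ m₂ k := by
      intro n hn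
      induction n with
      | zero => exact ⟨⟨1, by simp⟩, 0, by simpa using hz⟩
      | succ n ih =>
        obtain ⟨⟨a, ha⟩, b, hb⟩ := ih (by omega)
        have e : k - n = k - (n + 1) + 1 := by omega
        rw [e] at ha hb
        refine ⟨⟨b + euclidQuot m₁ m₂ (k - (n + 1)) * a, ?_⟩, a, ha⟩
        have := euclidSeq_add_two (m₁ := m₁) (m₂ := m₂) (i := k - (n + 1)) (by omega)
        rw [show k - (n + 1) + 1 + 1 = k - (n + 1) + 2 from rfl, this, ha] at hb
        push_cast
        linarith
    have := key (k - 1) (by omega)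
    rw [show k - (k - 1) = 1 by omega] at this
    exact ⟨hpos, this⟩
  · rintro d ⟨hd, ha, hb⟩
    obtain ⟨c, hc⟩ := euclidSeq_eq_int_mul ha hb k hk
    rw [hc] at hpos ⊢
    have h1 : (0 : ℝ) < c := pos_of_mul_pos_left hpos hd.le
    have h2 : (1 : ℝ) ≤ c := by
      have : 0 < c := by exact_mod_cast h1
      exact_mod_cast this
    nlinarith

end Euclid

/-! ### The Euclidean algorithm on pairs of isometries. -/

section Reduction

variable {Y : Type*} [MetricSpace Y]

/-- `a` and `b` generate the same group as `γ₁` and `γ₂`; they translate by `p` and `q` toward `v`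
along axes whose intersection has length `κ + p + q` and ends in `v`. -/
def IsReducedPair (γ₁ γ₂ : Y ≃ᵢ Y) (κ : ℝ) (v : Y) (a b : Y ≃ᵢ Y) (p q : ℝ) : Prop :=
  Subgroup.closure {a, b} = Subgroup.closure {γ₁, γ₂} ∧
  ∃ f h α β, AxisPair a b f h p q α β ∧ β - α = κ + p + q ∧ h β = v

lemma closure_mul_inv_pair {G : Type*} [Group G] (a b : G) :
    Subgroup.closure {a * b⁻¹, b} = Subgroup.closure {a, b} := by
  apply le_antisymm <;> rw [Subgroup.closure_le] <;> rintro x (rfl | rfl)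
  · exact mul_mem (Subgroup.subset_closure (by simp))
      (inv_mem (Subgroup.subset_closure (by simp)))
  · exact Subgroup.subset_closure (by simp)
  · rw [SetLike.mem_coe, ← inv_mul_cancel_right x b]
    exact mul_mem (Subgroup.subset_closure (by simp)) (Subgroup.subset_closure (by simp))
  · exact Subgroup.subset_closure (by simp)

lemma not_isFreeGroup_of_isOfFinOrder {G : Type*} [Group G] {H : Subgroup G} {g : G} (hg : g ∈ H)
    (h1 : g ≠ 1) (h : IsOfFinOrder g) : ¬ IsFreeGroup H := by
  intro hfree
  have h2 : IsOfFinOrder (⟨g, hg⟩ : H) := Submonoid.isOfFinOrder_coe.1 h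
  have h3 := (IsFreeGroup.mulEquiv H).symm.toMonoidHom.isOfFinOrder h2
  have h4 := h3.eq_one'
  have h5 : (⟨g, hg⟩ : H) = 1 := (IsFreeGroup.mulEquiv H).symm.map_eq_one_iff.1 h4
  exact h1 (congrArg Subtype.val h5)

namespace IsReducedPair

variable {γ₁ γ₂ : Y ≃ᵢ Y} {κ : ℝ} {v : Y} {a b : Y ≃ᵢ Y} {p q : ℝ}

lemma symm (R : IsReducedPair γ₁ γ₂ κ v a b p q) : IsReducedPair γ₁ γ₂ κ v b a q p := by
  obtain ⟨hc, f, h, α, β, P, hl, hv⟩ := R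
  refine ⟨by rw [Set.pair_comm, hc], h, f, α, β, P.symm, by linarith, ?_⟩
  rw [P.overlap.eq β P.overlap.le le_rfl, hv]

variable [IsRealTree Y]

/-- The first translation length and the overlap both drop by `q`, so `κ` is unchanged. The
condition on `κ + p` says that the overlap exceeds `q`. -/
lemma step (R : IsReducedPair γ₁ γ₂ κ v a b p q) (hpq : q < p) (hκ : 0 < κ + p) :
    IsReducedPair γ₁ γ₂ κ v (a * b⁻¹) b (p - q) q := by
  obtain ⟨hc, f, h, α, β, P, hl, hv⟩ := R
  obtain ⟨f', P'⟩ := P.step hpq (by linarith)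
  exact ⟨by rw [closure_mul_inv_pair, hc], f', h, _, β, P', by linarith, hv⟩

/-- A short overlap. -/
lemma freeSchottky_of_lt (hY : HasFiniteBranching Y) (R : IsReducedPair γ₁ γ₂ κ v a b p q)
    (hqp : q ≤ p) (hκ : κ + p < 0) :
    FreeSchottky γ₁ γ₂ b a q p ∧ (∃ y, axis b ∩ axis a = geodSegment y v) ∧
      arcLength (axis b ∩ axis a) = ENNReal.ofReal (κ + p + q) := by
  obtain ⟨hc, f, h, α, β, P, hl, hv⟩ := R
  have hs := P.symm.isSchottkyPair hY (by linarith) (by linarith)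
  have hi : axis b ∩ axis a = geodSegment (h α) v := by
    rw [P.right.axis_eq, P.left.axis_eq, Set.inter_comm, P.overlap.range_inter, ← hv,
      P.right.isometry.geodSegment_eq_image P.overlap.le]
  refine ⟨⟨?_, by rw [Set.pair_comm, hc], hs, P.right.hyperbolic, P.right.translationLength_eq,
    P.left.hyperbolic, P.left.translationLength_eq⟩, ⟨_, hi⟩, ?_⟩
  · rw [← hc, Set.pair_comm]
    exact hs.isFreeOfRankTwo
  · rw [hi, arcLength_geodSegment, ← hv, P.right.isometry.dist_line P.overlap.le, hl]

lemma notFreeElliptic (hfin : ∀ g ∈ Subgroup.closure {γ₁, γ₂}, IsElliptic g → IsOfFinOrder g)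
    (R : IsReducedPair γ₁ γ₂ κ v a b p q) (he : IsElliptic (a * b⁻¹)) :
    NotFreeElliptic γ₁ γ₂ b (a * b⁻¹) q := by
  obtain ⟨hc, f, h, α, β, P, hl, hv⟩ := R
  have hmem : a * b⁻¹ ∈ Subgroup.closure {γ₁, γ₂} := by
    rw [← hc, ← closure_mul_inv_pair]
    exact Subgroup.subset_closure (by simp)
  exact ⟨not_isFreeGroup_of_isOfFinOrder hmem P.mul_inv_ne_one (hfin _ hmem he),
    by rw [Set.pair_comm, closure_mul_inv_pair, hc], P.right.hyperbolic,
    P.right.translationLength_eq, he⟩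

/-- A long overlap of axes of isometries of equal translation lengths. -/
lemma elliptic_of_eq (hfin : ∀ g ∈ Subgroup.closure {γ₁, γ₂}, IsElliptic g → IsOfFinOrder g)
    (R : IsReducedPair γ₁ γ₂ κ v a b p p) (hκ : 0 ≤ κ + p) :
    NotFreeElliptic γ₁ γ₂ b (a * b⁻¹) p ∧
      (∃ y, axis b ∩ fixedTree (a * b⁻¹) = geodSegment y v) ∧
      arcLength (axis b ∩ fixedTree (a * b⁻¹)) = ENNReal.ofReal (κ + p) := by
  have R' := R
  obtain ⟨hc, f, h, α, β, P, hl, hv⟩ := R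
  have hle : α + p ≤ β := by linarith
  have hi := P.range_inter_fixedTree hle
  rw [← P.right.isometry.geodSegment_eq_image hle, hv, ← P.right.axis_eq] at hi
  refine ⟨R'.notFreeElliptic hfin ⟨v, ?_⟩, ⟨_, hi⟩, ?_⟩
  · have := right_mem_geodSegment (h (α + p)) v
    rw [← hi] at this
    exact this.2
  · rw [hi, arcLength_geodSegment, ← hv, P.right.isometry.dist_line hle]
    congr 1
    linarith

/-- The overlap has the length of the smaller translation length, and the axis of `a` and its
translate by `b` share a long segment. -/
lemma elliptic_of_le_arcLength
    (hfin : ∀ g ∈ Subgroup.closure {γ₁, γ₂}, IsElliptic g → IsOfFinOrder g)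
    (R : IsReducedPair γ₁ γ₂ κ v a b p q) (hqp : q ≤ p) (hκ : κ + p = 0)
    (hL : ENNReal.ofReal ((p - q) / 2) ≤ arcLength (axis a ∩ b '' axis a)) :
    NotFreeElliptic γ₁ γ₂ b (a * b⁻¹) q ∧ EdgeDisjoint (axis b) (fixedTree (a * b⁻¹)) ∧
      setDist (axis b) (fixedTree (a * b⁻¹)) = ENNReal.ofReal ((p - q) / 2) := by
  -- For `p = q` the bound on the common length is void. The fixed tree then meets the axis in the
  -- single point `v`, at distance `0`.
  rcases hqp.eq_or_lt with rfl | hlt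
  · obtain ⟨h1, ⟨y, h2⟩, h3⟩ := R.elliptic_of_eq hfin hκ.ge
    rw [hκ, ENNReal.ofReal_zero] at h3
    refine ⟨h1, Metric.ediam_eq_zero_iff.1 h3, ?_⟩
    rw [sub_self, zero_div]
    have hv : v ∈ axis b ∩ fixedTree (a * b⁻¹) := by
      rw [h2]
      exact right_mem_geodSegment y v
    exact setDist_eq_ofReal (fun _ _ _ _ => dist_nonneg) ⟨v, hv.1, v, hv.2, dist_self v⟩
  · have R' := R
    obtain ⟨hc, f, h, α, β, P, hl, hv⟩ := R
    have hle : α + q = β := by linarith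
    rw [P.left.axis_eq] at hL
    have := P.setDist_fixedTree hle hlt hL
    rw [← P.right.axis_eq] at this
    exact ⟨R'.notFreeElliptic hfin ⟨_, P.apply_eq_of_le_arcLength hle hqp hL⟩, this⟩

/-- The overlap has the length of the smaller translation length, and the axis of `a` and its
translate by `b` share a short segment. -/
lemma freeSchottky_of_arcLength_lt (hY : HasFiniteBranching Y)
    (R : IsReducedPair γ₁ γ₂ κ v a b p q) (hκ : κ + p = 0)
    (hL : arcLength (axis a ∩ b '' axis a) < ENNReal.ofReal ((p - q) / 2)) :
    FreeSchottky γ₁ γ₂ b (a * b⁻¹) q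
        (p - q - 2 * (arcLength (axis a ∩ b '' axis a)).toReal) ∧
      EdgeDisjoint (axis b) (axis (a * b⁻¹)) ∧
      setDist (axis b) (axis (a * b⁻¹)) = arcLength (axis a ∩ b '' axis a) := by
  obtain ⟨hc, f, h, α, β, P, hl, hv⟩ := R
  have hle : α + q = β := by linarith
  rw [P.left.axis_eq] at hL ⊢
  obtain ⟨k, hk, hd, hD⟩ := P.exists_axisLine_of_arcLength_lt hle hL
  have hs := isSchottkyPair_of_subsingleton hY P.right hk hd
  have hc' : Subgroup.closure {b, a * b⁻¹} = Subgroup.closure {γ₁, γ₂} := by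
    rw [Set.pair_comm, closure_mul_inv_pair, hc]
  rw [hk.axis_eq, P.right.axis_eq]
  refine ⟨⟨?_, hc', hs, P.right.hyperbolic, P.right.translationLength_eq, hk.hyperbolic,
    hk.translationLength_eq⟩, hd, hD⟩
  rw [← hc']
  exact hs.isFreeOfRankTwo

end IsReducedPair

variable [IsRealTree Y]

lemma isReducedPair_of_overlap {γ₁ γ₂ : Y ≃ᵢ Y} (h₁ : IsHyperbolic γ₁) (h₂ : IsHyperbolic γ₂)
    {l : ℝ} (hl₀ : 0 ≤ l) (hl : arcLength (axis γ₁ ∩ axis γ₂) = ENNReal.ofReal l) {v w : Y}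
    (hi : axis γ₁ ∩ axis γ₂ = geodSegment v w) (ht₁ : TranslatesToward γ₁ v w)
    (ht₂ : TranslatesToward γ₂ v w) :
    IsReducedPair γ₁ γ₂ (l - (translationLength γ₁ + translationLength γ₂)) w γ₁ γ₂
      (translationLength γ₁) (translationLength γ₂) := by
  have : Nonempty Y := ⟨v⟩
  obtain ⟨f₀, hf₀⟩ := h₁.exists_axisLine
  obtain ⟨h₀, hh₀⟩ := h₂.exists_axisLine
  have hv : v ∈ axis γ₁ ∩ axis γ₂ := hi ▸ left_mem_geodSegment v w
  have hw : w ∈ axis γ₁ ∩ axis γ₂ := hi ▸ right_mem_geodSegment v w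
  rw [hf₀.axis_eq, hh₀.axis_eq] at hv hw
  obtain ⟨f, hf, hf1, hf2⟩ := hf₀.exists_shift hv.1 hw.1 ht₁
  obtain ⟨h, hh, hh1, hh2⟩ := hh₀.exists_shift hv.2 hw.2 ht₂
  have hd : dist v w = l := by
    rw [hi, arcLength_geodSegment] at hl
    exact (ENNReal.ofReal_eq_ofReal_iff dist_nonneg hl₀).1 hl
  rw [hd] at hf2 hh2
  refine ⟨rfl, f, h, 0, l, ⟨hf, hh, ⟨hf.isometry, hh.isometry, hl₀, fun t h1 h2 => ?_,
    fun s t e => ?_⟩⟩, by ring, hh2⟩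
  · exact hf.isometry.line_eq_of_eq hh.isometry (hf1.trans hh1.symm) (hf2.trans hh2.symm) h1 h2
  · have hm : f s ∈ axis γ₁ ∩ axis γ₂ := by
      rw [hf.axis_eq, hh.axis_eq]
      exact ⟨⟨s, rfl⟩, t, e.symm⟩
    rw [hi, ← hf1, ← hf2, hf.isometry.geodSegment_eq_image hl₀] at hm
    obtain ⟨u, hu, e'⟩ := hm
    rw [← hf.isometry.injective e']
    exact hu

/-- The reduction of a pair by the Euclidean algorithm. -/
lemma IsReducedPair.euclid {γ₁ γ₂ : Y ≃ᵢ Y} {m₁ m₂ κ : ℝ} {v : Y} (hm : m₂ ≤ m₁)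
    (R : IsReducedPair γ₁ γ₂ κ v γ₁ γ₂ m₁ m₂) {j : ℕ} (hj : 1 ≤ j)
    (hpos : ∀ i, 1 ≤ i → i ≤ j + 1 → 0 < euclidSeq m₁ m₂ i) {q : ℤ} (hq0 : 0 ≤ q)
    (hq : q ≤ euclidQuot m₁ m₂ j - 1)
    (hκ : 0 < κ + (euclidSeq m₁ m₂ j - q * euclidSeq m₁ m₂ (j + 1)) + euclidSeq m₁ m₂ (j + 1)) :
    IsReducedPair γ₁ γ₂ κ v
      (euclidGen m₁ m₂ γ₁ γ₂ j * euclidGen m₁ m₂ γ₁ γ₂ (j + 1) ^ (-q))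
      (euclidGen m₁ m₂ γ₁ γ₂ (j + 1)) (euclidSeq m₁ m₂ j - q * euclidSeq m₁ m₂ (j + 1))
      (euclidSeq m₁ m₂ (j + 1)) := by
  have inner : ∀ {j : ℕ}, 0 < euclidSeq m₁ m₂ (j + 1) →
      IsReducedPair γ₁ γ₂ κ v (euclidGen m₁ m₂ γ₁ γ₂ j) (euclidGen m₁ m₂ γ₁ γ₂ (j + 1))
        (euclidSeq m₁ m₂ j) (euclidSeq m₁ m₂ (j + 1)) → ∀ n : ℕ,
      (n : ℤ) ≤ euclidQuot m₁ m₂ j - 1 →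
      0 < κ + (euclidSeq m₁ m₂ j - n * euclidSeq m₁ m₂ (j + 1)) + euclidSeq m₁ m₂ (j + 1) →
      IsReducedPair γ₁ γ₂ κ v
        (euclidGen m₁ m₂ γ₁ γ₂ j * euclidGen m₁ m₂ γ₁ γ₂ (j + 1) ^ (-(n : ℤ)))
        (euclidGen m₁ m₂ γ₁ γ₂ (j + 1)) (euclidSeq m₁ m₂ j - n * euclidSeq m₁ m₂ (j + 1))
        (euclidSeq m₁ m₂ (j + 1)) := by
    intro j hp R₀ n
    induction n with
    | zero => simpa using fun _ _ => R₀
    | succ n ih =>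
      intro hn hk
      push_cast at hn hk
      have hle := euclidQuot_mul_le hp
      -- One more subtraction needs the strict inequality `m_{j+1} < m_j - n m_{j+1}`, which `n + 2
      -- ≤ q_j` guarantees.
      have hn' : (n : ℝ) + 2 ≤ euclidQuot m₁ m₂ j := by
        have : (n : ℤ) + 2 ≤ euclidQuot m₁ m₂ j := by omega
        exact_mod_cast this
      have hmul := mul_le_mul_of_nonneg_right hn' hp.le
      have := (ih (by omega) (by linarith)).step (by linarith) (by linarith)
      convert this using 1
      · rw [mul_assoc, ← zpow_sub_one]
        congr 2
        push_cast
        ring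
      · push_cast
        ring
  have main : ∀ j, 1 ≤ j → (∀ i, 1 ≤ i → i ≤ j + 1 → 0 < euclidSeq m₁ m₂ i) →
      0 < κ + euclidSeq m₁ m₂ j + euclidSeq m₁ m₂ (j + 1) →
      IsReducedPair γ₁ γ₂ κ v (euclidGen m₁ m₂ γ₁ γ₂ j) (euclidGen m₁ m₂ γ₁ γ₂ (j + 1))
        (euclidSeq m₁ m₂ j) (euclidSeq m₁ m₂ (j + 1)) := by
    intro j hj
    induction j, hj using Nat.le_induction with
    | base => exact fun _ _ => R
    | succ j hj ih =>
      intro hpos hk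
      have h0 := hpos j hj (by omega)
      have h1 := hpos (j + 1) (by omega) (by omega)
      have h2 := hpos (j + 2) (by omega) (by omega)
      have he := euclidSeq_add_two (m₁ := m₁) (m₂ := m₂) hj
      have hQ := one_le_euclidQuot hm hj h0 h1
      have hlt := euclidSeq_add_two_lt (m₁ := m₁) (m₂ := m₂) hj h1
      change 0 < κ + euclidSeq m₁ m₂ (j + 1) + euclidSeq m₁ m₂ (j + 2) at hk
      obtain ⟨n, hn⟩ := Int.eq_ofNat_of_zero_le (show 0 ≤ euclidQuot m₁ m₂ j - 1 by omega)
      have hnQ : (n : ℝ) = euclidQuot m₁ m₂ j - 1 := by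
        have : (n : ℤ) = euclidQuot m₁ m₂ j - 1 := hn.symm
        exact_mod_cast this
      -- After `q_j - 1` subtractions one more is left. It is allowed because `m_{j+2} > 0`, and
      -- exchanging the two elements then gives the pair with index `j + 1`.
      have e1 : euclidSeq m₁ m₂ j - n * euclidSeq m₁ m₂ (j + 1) =
          euclidSeq m₁ m₂ (j + 2) + euclidSeq m₁ m₂ (j + 1) := by
        rw [he, hnQ]
        ring
      have hle := euclidSeq_succ_le hm hj h0
      have := inner h1 (ih (fun i hi hi' => hpos i hi (by omega)) (by linarith)) n
        (by omega) (by linarith)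
      rw [e1] at this
      have := (this.step (by linarith) (by linarith)).symm
      convert this using 1
      · rw [show j + 1 + 1 = j + 2 from rfl, euclidGen_add_two hj, mul_assoc, ← zpow_sub_one]
        congr 2
        omega
      · rw [show j + 1 + 1 = j + 2 from rfl]
        ring
  obtain ⟨n, rfl⟩ := Int.eq_ofNat_of_zero_le hq0
  have hp := hpos (j + 1) (by omega) le_rfl
  refine inner hp (main j hj hpos ?_) n hq (by exact_mod_cast hκ)
  have : (0 : ℝ) ≤ n := n.cast_nonneg
  push_cast at hκ
  nlinarith [mul_nonneg this hp.le]

/-- The overlap of the axes of two isometries with incommensurable translation lengths is shorter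
than their sum, because an end of the overlap is a branch point. -/
lemma IsReducedPair.neg_of_irrational (hY : HasFiniteBranching Y) {γ₁ γ₂ a b : Y ≃ᵢ Y} {κ p q : ℝ}
    {v : Y} (R : IsReducedPair γ₁ γ₂ κ v a b p q) (hirr : Irrational (q / p)) : κ < 0 := by
  by_contra hκ
  push Not at hκ
  obtain ⟨-, f, h, α, β, P, hl, -⟩ := R
  have o := P.overlap
  have hh := P.right.isometry
  have hp := P.left.pos
  have hq := P.right.pos
  -- The two axes part at the end of the overlap.
  have hbranch : IsBranchPoint (h β) := by
    refine ⟨h (β - 1), h (β + 1), f (β + 1), hh.injective.ne (by linarith),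
      hh.injective.ne (by linarith), ?_, hh.mem_geodSegment_line (by linarith) (by linarith), ?_,
      ?_⟩
    · rw [← o.eq β o.le le_rfl]
      exact P.left.isometry.injective.ne (by linarith)
    · rw [geodSegment_comm]
      exact o.mem_geodSegment_top _ (by linarith)
    · rw [← o.eq β o.le le_rfl]
      exact o.symm.mem_geodSegment_top _ (by linarith)
  -- The overlap has length at least `p + q`, so if the step back by `p` leaves it, the step forward
  -- by `q` does not.
  have next : ∀ t : ℝ, α ≤ t → t ≤ β → IsBranchPoint (h t) →
      ∃ s, α ≤ s ∧ s ≤ β ∧ IsBranchPoint (h s) ∧ (s = t - p ∨ s = t + q) := by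
    intro t h1 h2 h3
    by_cases hc : α ≤ t - p
    · refine ⟨t - p, hc, by linarith, ?_, Or.inl rfl⟩
      rw [← o.eq _ hc (by linarith), ← P.left.inv_map, o.eq t h1 h2]
      exact h3.map _
    · refine ⟨t + q, by linarith, by linarith, ?_, Or.inr rfl⟩
      rw [← P.right.map]
      exact h3.map _
  have orbit : ∀ n : ℕ, ∃ t, α ≤ t ∧ t ≤ β ∧ IsBranchPoint (h t) ∧
      ∃ i j : ℕ, i + j = n ∧ t = β - i * p + j * q := by
    intro n
    induction n with
    | zero => exact ⟨β, o.le, le_rfl, hbranch, 0, 0, rfl, by simp⟩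
    | succ n ih =>
      obtain ⟨t, h1, h2, h3, i, j, hn, ht⟩ := ih
      obtain ⟨s, h4, h5, h6, hs⟩ := next t h1 h2 h3
      refine ⟨s, h4, h5, h6, ?_⟩
      rcases hs with rfl | rfl
      · exact ⟨i + 1, j, by omega, by rw [ht]; push_cast; ring⟩
      · exact ⟨i, j + 1, by omega, by rw [ht]; push_cast; ring⟩
  choose t h1 h2 h3 i j hn ht using orbit
  refine Set.infinite_of_injective_forall_mem 
    (s := {z | z ∈ geodSegment (h α) (h β) ∧ IsBranchPoint z}) (f := fun n => h (t n)) ?_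
    (fun n => ⟨hh.mem_geodSegment_line (h1 n) (h2 n), h3 n⟩) (hY (h α) (h β))
  intro n n' e
  have e' := hh.injective e
  rw [ht n, ht n'] at e'
  -- Two coincident positions `β - i p + j q` with different `j` would make `q / p` rational.
  have hj : j n = j n' := by
    by_contra hne
    have hne' : (j n : ℝ) - j n' ≠ 0 := sub_ne_zero.2 (by exact_mod_cast hne)
    refine hirr ⟨((i n : ℚ) - i n') / ((j n : ℚ) - j n'), ?_⟩
    push_cast
    rw [div_eq_div_iff hne' hp.ne']
    linarith
  have hi : i n = i n' := by
    rw [hj] at e'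
    have : ((i n : ℝ) - i n') * p = 0 := by linarith
    have := (mul_eq_zero.1 this).resolve_right hp.ne'
    exact_mod_cast sub_eq_zero.1 this
  rw [← hn n, ← hn n', hi, hj]

lemma caseDisjoint_of_arcLength_eq_zero (hY : HasFiniteBranching Y) [Nonempty Y] {γ₁ γ₂ : Y ≃ᵢ Y}
    (h₁ : IsHyperbolic γ₁) (h₂ : IsHyperbolic γ₂) (hl : arcLength (axis γ₁ ∩ axis γ₂) = 0) :
    CaseDisjoint γ₁ γ₂ (translationLength γ₁) (translationLength γ₂) := by
  obtain ⟨f, hf⟩ := h₁.exists_axisLine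
  obtain ⟨h, hh⟩ := h₂.exists_axisLine
  have hd := Metric.ediam_eq_zero_iff.1 hl
  have hd' := hd
  rw [hf.axis_eq, hh.axis_eq] at hd'
  have hs := isSchottkyPair_of_subsingleton hY hf hh hd'
  exact ⟨⟨hs.isFreeOfRankTwo, rfl, hs, h₁, rfl, h₂, rfl⟩, hd⟩

/-- The lower bound of the window says that the reduced pair still has a positive overlap, the upper
bound that the overlap is at most `m_{j+1}`. Equality in the upper bound is case (a), strict
inequality case (b). -/
lemma caseWindow_of_isReducedPair (hY : HasFiniteBranching Y) {γ₁ γ₂ : Y ≃ᵢ Y}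
    (hfin : ∀ g ∈ Subgroup.closure {γ₁, γ₂}, IsElliptic g → IsOfFinOrder g) {m₁ m₂ l : ℝ} {v : Y}
    (hm : m₂ ≤ m₁) (R : IsReducedPair γ₁ γ₂ (l - (m₁ + m₂)) v γ₁ γ₂ m₁ m₂) {j : ℕ} {q : ℤ}
    (hpos : ∀ i, 1 ≤ i → i ≤ j + 1 → 0 < euclidSeq m₁ m₂ i) (hw : InWindow m₁ m₂ l j q) :
    CaseWindow γ₁ γ₂ m₁ m₂ l v j q := by
  obtain ⟨hj, hq0, hq, hl1, hl2⟩ := hw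
  have hp := hpos (j + 1) (by omega) le_rfl
  have R' := R.euclid hm hj hpos hq0 hq (by linarith)
  have hqp : euclidSeq m₁ m₂ (j + 1) ≤ euclidSeq m₁ m₂ j - q * euclidSeq m₁ m₂ (j + 1) := by
    have h1 := euclidQuot_mul_le hp
    have h2 : (q : ℝ) + 1 ≤ euclidQuot m₁ m₂ j := by
      have : q + 1 ≤ euclidQuot m₁ m₂ j := by omega
      exact_mod_cast this
    have h3 := mul_le_mul_of_nonneg_right h2 hp.le
    linarith
  have hb : euclidGen m₁ m₂ γ₁ γ₂ j * euclidGen m₁ m₂ γ₁ γ₂ (j + 1) ^ (-q - 1) =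
      euclidGen m₁ m₂ γ₁ γ₂ j * euclidGen m₁ m₂ γ₁ γ₂ (j + 1) ^ (-q) *
        (euclidGen m₁ m₂ γ₁ γ₂ (j + 1))⁻¹ := by
    rw [zpow_sub_one, mul_assoc]
  have hD : euclidSeq m₁ m₂ j - (q + 1) * euclidSeq m₁ m₂ (j + 1) =
      euclidSeq m₁ m₂ j - q * euclidSeq m₁ m₂ (j + 1) - euclidSeq m₁ m₂ (j + 1) := by ring
  refine ⟨fun hl => ⟨?_, ?_, ?_⟩, fun hl => ?_⟩
  · obtain ⟨-, f, h, α, β, P, -⟩ := R'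
    exact P.left.hyperbolic
  · intro hL
    simp only [hb, hD] at hL ⊢
    exact R'.elliptic_of_le_arcLength hfin hqp (by linarith) hL
  · intro hL
    simp only [hb, hD] at hL ⊢
    exact R'.freeSchottky_of_arcLength_lt hY (by linarith) hL
  · obtain ⟨h1, h2, h3⟩ := R'.freeSchottky_of_lt hY hqp (by linarith)
    refine ⟨h1, h2, by linarith, h3.trans ?_⟩
    congr 1
    ring

/-- As `m_{k+1} = 0`, after `q_{k-1} - 1` subtractions at index `k - 1` both translation lengths
equal `m_k`. The last quotient `a * b⁻¹` is `γ_{k+1}`, which is elliptic. -/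
lemma caseLong_of_isReducedPair {γ₁ γ₂ : Y ≃ᵢ Y}
    (hfin : ∀ g ∈ Subgroup.closure {γ₁, γ₂}, IsElliptic g → IsOfFinOrder g) {m₁ m₂ l : ℝ} {v : Y}
    (hm : m₂ ≤ m₁) (R : IsReducedPair γ₁ γ₂ (l - (m₁ + m₂)) v γ₁ γ₂ m₁ m₂) {k : ℕ} (hk : 2 ≤ k)
    (hpos : ∀ i, 1 ≤ i → i ≤ k → 0 < euclidSeq m₁ m₂ i) (hz : euclidSeq m₁ m₂ (k + 1) = 0)
    (hl : m₁ + m₂ - euclidSeq m₁ m₂ k < l) : CaseLong γ₁ γ₂ m₁ m₂ l v k := by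
  obtain ⟨j, rfl⟩ := Nat.exists_eq_add_of_le' hk
  have h1 := hpos (j + 2) (by omega) le_rfl
  have h0 := hpos (j + 1) (by omega) (by omega)
  have hQ := one_le_euclidQuot hm (i := j + 1) (by omega) h0 h1
  have he := euclidSeq_add_two (m₁ := m₁) (m₂ := m₂) (i := j + 1) (by omega)
  have hz' : euclidSeq m₁ m₂ (j + 1 + 2) = 0 := hz
  rw [hz'] at he
  have e : euclidSeq m₁ m₂ (j + 1) -
      (euclidQuot m₁ m₂ (j + 1) - 1 : ℤ) * euclidSeq m₁ m₂ (j + 1 + 1) =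
      euclidSeq m₁ m₂ (j + 1 + 1) := by
    push_cast
    linarith
  have hk' : m₁ + m₂ - euclidSeq m₁ m₂ (j + 1 + 1) < l := hl
  have R' := R.euclid hm (j := j + 1) (by omega) hpos (q := euclidQuot m₁ m₂ (j + 1) - 1)
    (by linarith) le_rfl (by rw [e]; linarith)
  rw [e] at R'
  have hg : euclidGen m₁ m₂ γ₁ γ₂ (j + 1) *
      euclidGen m₁ m₂ γ₁ γ₂ (j + 1 + 1) ^ (-(euclidQuot m₁ m₂ (j + 1) - 1)) *
        (euclidGen m₁ m₂ γ₁ γ₂ (j + 1 + 1))⁻¹ = euclidGen m₁ m₂ γ₁ γ₂ (j + 1 + 2) := by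
    rw [euclidGen_add_two (i := j + 1) (by omega), mul_assoc, ← zpow_sub_one]
    congr 2
    ring
  obtain ⟨h2, h3, h4⟩ := R'.elliptic_of_eq hfin (by linarith)
  rw [hg] at h2 h3 h4
  refine ⟨h2, h3, h4.trans ?_⟩
  congr 1
  ring

end Reduction

/-! ### The classification. -/

theorem mainTheorem2 {V : Type*} (T : WeightedTree V) (hT : T.IsLocallyFinite)
    (γ₁ γ₂ : T.Aut) (h₁ : IsHyperbolic γ₁) (h₂ : IsHyperbolic γ₂)
    (hdisc : T.IsDiscrete (Subgroup.closure {γ₁, γ₂}))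
    (m₁ m₂ l : ℝ) (hm₁ : m₁ = translationLength γ₁) (hm₂ : m₂ = translationLength γ₂)
    (hm : m₂ ≤ m₁)
    (hl₀ : 0 ≤ l) (hl : arcLength (axis γ₁ ∩ axis γ₂) = ENNReal.ofReal l)
    (vminus vplus : T.Realization)
    (hv : 0 < l → axis γ₁ ∩ axis γ₂ = geodSegment vminus vplus ∧
      TranslatesToward γ₁ vminus vplus ∧ TranslatesToward γ₂ vminus vplus) :
    (m₂ / m₁ ∈ Set.range ((↑) : ℚ → ℝ) →
      ∃ k : ℕ, 2 ≤ k ∧ (∀ i, 1 ≤ i → i ≤ k → 0 < euclidSeq m₁ m₂ i) ∧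
        euclidSeq m₁ m₂ (k + 1) = 0 ∧
        IsGreatest (commonDivisors m₁ m₂) (euclidSeq m₁ m₂ k) ∧
        (l = 0 → CaseDisjoint γ₁ γ₂ m₁ m₂) ∧
        (0 < l → l ≤ m₁ + m₂ - euclidSeq m₁ m₂ k →
          (∃! p : ℕ × ℤ, p.1 ≤ k - 1 ∧ InWindow m₁ m₂ l p.1 p.2) ∧
          ∀ (j : ℕ) (q : ℤ), j ≤ k - 1 → InWindow m₁ m₂ l j q →
            CaseWindow γ₁ γ₂ m₁ m₂ l vplus j q) ∧
        (m₁ + m₂ - euclidSeq m₁ m₂ k < l → CaseLong γ₁ γ₂ m₁ m₂ l vplus k)) ∧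
    (Irrational (m₂ / m₁) →
      (∀ i, 1 ≤ i → 0 < euclidSeq m₁ m₂ i) ∧
      (l = 0 → CaseDisjoint γ₁ γ₂ m₁ m₂) ∧
      (0 < l → l < m₁ + m₂ →
        (∃! p : ℕ × ℤ, InWindow m₁ m₂ l p.1 p.2) ∧
        ∀ (j : ℕ) (q : ℤ), InWindow m₁ m₂ l j q → CaseWindow γ₁ γ₂ m₁ m₂ l vplus j q) ∧
      l < m₁ + m₂) := by
  have : Nonempty T.Realization := ⟨vminus⟩
  have hY : HasFiniteBranching T.Realization := WeightedTree.hasFiniteBranching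
  have hfin : ∀ g ∈ Subgroup.closure {γ₁, γ₂}, IsElliptic g → IsOfFinOrder g :=
    fun g hg he => WeightedTree.isOfFinOrder_of_isElliptic hT hdisc hg he
  have hpos₂ : 0 < m₂ := by
    obtain ⟨f, hf⟩ := h₂.exists_axisLine
    rw [hm₂]
    exact hf.pos
  have hpos₁ : 0 < m₁ := hpos₂.trans_le hm
  have hR : 0 < l → IsReducedPair γ₁ γ₂ (l - (m₁ + m₂)) vplus γ₁ γ₂ m₁ m₂ := fun h => by
    obtain ⟨hi, ht₁, ht₂⟩ := hv h
    rw [hm₁, hm₂]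
    exact isReducedPair_of_overlap h₁ h₂ hl₀ hl hi ht₁ ht₂
  have hD : l = 0 → CaseDisjoint γ₁ γ₂ m₁ m₂ := fun h => by
    rw [h, ENNReal.ofReal_zero] at hl
    rw [hm₁, hm₂]
    exact caseDisjoint_of_arcLength_eq_zero hY h₁ h₂ hl
  constructor
  · intro hrat
    obtain ⟨k, hk, hpos, hz⟩ := exists_euclidSeq_eq_zero hm hpos₂ hrat
    have hgcd := isGreatest_commonDivisors (by omega) (hpos k (by omega) le_rfl) hz
    -- Makes `l` positive in the third case, so that the overlap `[v⁻, v⁺]` is available there.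
    have hkm : euclidSeq m₁ m₂ k ≤ m₂ := by
      obtain ⟨hd, -, b, hb⟩ := hgcd.1
      have hb0 : (0 : ℝ) < b := pos_of_mul_pos_left (hb ▸ hpos₂) hd.le
      have hb1 : (1 : ℝ) ≤ b := by
        have : 0 < b := by exact_mod_cast hb0
        exact_mod_cast this
      nlinarith
    refine ⟨k, hk, hpos, hz, hgcd,
      hD, fun h0 hlk => ⟨?_, fun j q hj hw => ?_⟩, fun hlk => ?_⟩
    -- Since `m_{k+1} = 0`, the windows with `j ≤ k - 1` end exactly at `m₁ + m₂ - m_k`.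
    · obtain ⟨j, q, hj, hw⟩ := exists_inWindow h0 (show 1 ≤ k by omega) hpos
        (by rw [windowStart, hz]; linarith)
      refine ⟨(j, q), ⟨hj, hw⟩, ?_⟩
      rintro ⟨j', q'⟩ ⟨hj', hw'⟩
      obtain ⟨h1, h2⟩ := hw'.unique hm hw fun n h1 h2 => hpos n h1 (by simp only at hj'; omega)
      exact Prod.ext h1 h2
    · exact caseWindow_of_isReducedPair hY hfin hm (hR h0)
        (fun i h1 h2 => hpos i h1 (by omega)) hw
    · exact caseLong_of_isReducedPair hfin hm (hR (by linarith)) hk hpos hz hlk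
  · intro hirr
    have hpos := euclidSeq_pos_of_irrational hpos₂ hpos₁ hirr
    refine ⟨hpos, hD, fun h0 hlt => ⟨?_, fun j q hw => ?_⟩, ?_⟩
    -- The starts `m₁ + m₂ - m_k - m_{k+1}` tend to `m₁ + m₂`, so one of them lies beyond `l`.
    · obtain ⟨k, hk, hlt'⟩ := euclidSeq_tendsto_zero hm hpos (sub_pos.2 hlt)
      obtain ⟨j, q, -, hw⟩ := exists_inWindow h0 hk (fun n h1 _ => hpos n h1)
        (by rw [windowStart]; linarith)
      refine ⟨(j, q), hw, ?_⟩
      rintro ⟨j', q'⟩ hw'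
      obtain ⟨h1, h2⟩ := hw'.unique hm hw fun n h1 _ => hpos n h1
      exact Prod.ext h1 h2
    · exact caseWindow_of_isReducedPair hY hfin hm (hR h0) (fun i h1 _ => hpos i h1) hw
    · rcases hl₀.eq_or_lt with h0 | h0
      · linarith
      · linarith [(hR h0).neg_of_irrational hY hirr]
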